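/- For $\xi\in\mathbb R^2$ write $e(t)=e^{2\pi i t}$ and, for $S\subset[0,1]^2$ measurable and $F\in L^1([0,1]^2)$, let $$E_SF(x)=\int_S F(\xi)\,e\big((\xi,|\xi|^2)\cdot x\big)\,d\xi\qquad(x\in\mathbb R^3),\qquad EF=E_{[0,1]^2}F .$$ For $R\ge 1$ with $\sqrt R\in\mathbb N$, let $\mathcal Q_R$ be the collection of the $R$ squares $[\frac{j}{\sqrt R},\frac{j+1}{\sqrt R}]\times[\frac{i}{\sqrt R},\frac{i+1}{\sqrt R}]$, $0\le i,j<\sqrt R$. An $M$-set is a union of $M$ distinct squares in $\mathcal Q_R$. For a ball $B_R\subset\mathbb R^3$ with centre $c$ and radius $R$, and for a fixed $E_0>3$, let $w_{B_R}(x)=(1+|x-c|/R)^{-E_0}$ and $\|f\|_{L^3(w_{B_R})}=(\int_{\mathbb R^3}|f|^3w_{B_R})^{1/3}$. **Theorem.** Fix $\beta\in(0,1)$ and $E_0>3$. Assume that for each $\epsilon>0$ there is a constant $C_\epsilon$ such that $$\|EF\|_{L^3(B_R)}\le C_\epsilon R^\epsilon\Big(\sum_{i=1}^N\|E_{S_i}F\|_{L^3(w_{B_R})}^2\Big)^{1/2}$$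 for all $R\ge1$ with $\sqrt R\in\mathbb N$, all integers $M$ with $R^\beta\le M\le 2R^\beta$, all partitions of $\mathcal Q_R$ into $M$-sets $S_1,\dots,S_N$, all balls $B_R$ of radius $R$ and all $F\in L^1([0,1]^2)$. Then the Restriction conjecture for the paraboloid $\mathbb P^2$ holds: for each $\epsilon>0$ there is a constant $C_\epsilon'$ such that $$\int_{B_{\sqrt R}}|EF|^3\le C_\epsilon'R^\epsilon\|F\|_{L^\infty([0,1]^2)}^3$$ for all $R\ge1$, all balls $B_{\sqrt R}$ of radius $\sqrt R$ and all $F\in L^\infty([0,1]^2)$. -/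

import Mathlib

open MeasureTheory
open scoped ENNReal

noncomputable section

/-- The unit square `[0,1]²`. -/
def unitSquare : Set (EuclideanSpace ℝ (Fin 2)) :=
  {ξ | ∀ i, ξ i ∈ Set.Icc (0 : ℝ) 1}

/-- The lift `(ξ, |ξ|²)` of `ξ ∈ ℝ²` to the paraboloid in `ℝ³`. -/
def paraboloidPoint (ξ : EuclideanSpace ℝ (Fin 2)) : EuclideanSpace ℝ (Fin 3) :=
  !₂[ξ 0, ξ 1, ‖ξ‖ ^ 2]

/-- The extension operator `E_S F (x) = ∫_S F(ξ) e((ξ,|ξ|²)·x) dξ`, with `e(t) = exp(2πit)`. -/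
def extensionOp (S : Set (EuclideanSpace ℝ (Fin 2))) (F : EuclideanSpace ℝ (Fin 2) → ℂ)
    (x : EuclideanSpace ℝ (Fin 3)) : ℂ :=
  ∫ ξ in S, F ξ * Complex.exp (2 * Real.pi * Complex.I * (inner ℝ (paraboloidPoint ξ) x : ℝ))

/-- For `R = n²`, the canonical `1/√R`-square `[j/n, (j+1)/n] × [i/n, (i+1)/n]` with index
`q = (j, i)`, `0 ≤ j, i < n`. -/
def canonicalSquare (n : ℕ) (q : Fin n × Fin n) : Set (EuclideanSpace ℝ (Fin 2)) :=
  {ξ | ξ 0 ∈ Set.Icc ((q.1 : ℝ) / n) (((q.1 : ℝ) + 1) / n) ∧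
       ξ 1 ∈ Set.Icc ((q.2 : ℝ) / n) (((q.2 : ℝ) + 1) / n)}

/-- The large ensemble (union of canonical squares) with index set `S`. The squares overlap only
in null sets. -/
def ensemble (n : ℕ) (S : Finset (Fin n × Fin n)) : Set (EuclideanSpace ℝ (Fin 2)) :=
  ⋃ q ∈ S, canonicalSquare n q

/-- The measure `w_B(x) dx`, where `w_B(x) = (1 + |x - c| / R)^(-E)` is the usual smoothed
substitute for the indicator function of the ball `B` of centre `c` and radius `R`. -/
def ballWeight (E : ℝ) (c : EuclideanSpace ℝ (Fin 3)) (R : ℝ) :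
    Measure (EuclideanSpace ℝ (Fin 3)) :=
  volume.withDensity fun x => ENNReal.ofReal ((1 + dist x c / R) ^ (-E))

/-- `l²` large ensemble decoupling in `L^p`, for all partitions into `R^β`-sets. Here `√R = n` is a
positive integer, so that the `R` canonical squares tile `[0,1]²`, and an `R^β`-set is a union of
`M` of them, where `R^β ≤ M ≤ 2 R^β`; `P` runs through the partitions of the canonical squares into
sets of `M` squares each. The norms on the right are taken in `L^p(w_B)`. -/
def LargeEnsembleDecoupling (p : ℝ≥0∞) (β E : ℝ) : Prop :=
  ∀ ε : ℝ, 0 < ε → ∃ C : ℝ, ∀ (n : ℕ), 1 ≤ n → ∀ (R : ℝ), R = (n : ℝ) ^ 2 →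
    ∀ (M : ℕ), R ^ β ≤ M → (M : ℝ) ≤ 2 * R ^ β →
    ∀ (P : Finpartition (Finset.univ : Finset (Fin n × Fin n))), (∀ S ∈ P.parts, S.card = M) →
    ∀ (c : EuclideanSpace ℝ (Fin 3)) (F : EuclideanSpace ℝ (Fin 2) → ℂ),
      IntegrableOn F unitSquare →
      eLpNorm (extensionOp unitSquare F) p (volume.restrict (Metric.closedBall c R)) ≤
        ENNReal.ofReal (C * R ^ ε) *
          (∑ S ∈ P.parts, eLpNorm (extensionOp (ensemble n S) F) p (ballWeight E c R) ^ 2) ^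
            (1 / 2 : ℝ)

/-- The Restriction conjecture for the paraboloid in `ℝ³`:
`∫_{B_{√R}} |EF|³ ≲_ε R^ε ‖F‖_∞³` for all `F ∈ L^∞([0,1]²)`, all `R ≥ 1` and all balls of
radius `√R`. -/
def RestrictionConjectureParaboloid : Prop :=
  ∀ ε : ℝ, 0 < ε → ∃ C : ℝ, ∀ (R : ℝ), 1 ≤ R →
    ∀ (c : EuclideanSpace ℝ (Fin 3)) (F : EuclideanSpace ℝ (Fin 2) → ℂ),
      MemLp F ∞ (volume.restrict unitSquare) →
      ∫⁻ x in Metric.closedBall c (Real.sqrt R), ‖extensionOp unitSquare F x‖ₑ ^ 3 ≤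
        ENNReal.ofReal (C * R ^ ε) * eLpNorm F ∞ (volume.restrict unitSquare) ^ 3

end

open MeasureTheory
open scoped ENNReal

noncomputable section

/-! Consider first densities F = ∑ a_q 1_q with |a_q| ≤ 1 that are constant on the canonical
squares. If the squares are split at random into N sets, the extension of each piece is N⁻¹ EF plus
a fluctuation, and moment estimates bound the L³ norm of the fluctuation by a quantity y: the L³
norm of the square function (∑ |a_q E1_q|²)^{1/2} up to a power of N. Let D be the largest L³ norm
of EF over balls of radius R. Decoupling with constant Q then reads D ≲ Q (N^{-1/2} D + N^{1/2} y).
As soon as N exceeds a suitable multiple of Q² the term in D is absorbed and only the square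
function is left (`exists_transversal_partition`, `lintegral_extensionOp_stepFunction_le`).

The square function is explicit. E1_q is a product of two waves over intervals, so the sum over q is
dominated by a product of two one-dimensional sums. Each of these is bounded in L¹ by Parseval and
in L^∞ by the first derivative test, the latter with bound 1/(1+|t|) + 1/R up to constants.
Interpolating and integrating in t over a range of length R costs a logarithm, recorded as R^δ
(`lintegral_squareFunction_le`).

The loss is a power of N, so N may only be R^{O(η)}, whereas a partition of the whole grid has about
R^{1-β} pieces. Hence F is supported in a corner of s × s cells with s² = MN: it meets only N
pieces, and parabolic rescaling turns the corner into the unit square without loss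
(`lintegral_sum_cellWave_le`). Since M ≥ R^β gives s ≥ R^{β/2}, every radius is reached.

For a general bounded F and s ≥ 1024 r, subtract the averages of F over the cells of side 1/s. The
remainder has mean zero on every cell, so a Taylor expansion of the phase around the cell corners
writes its extension, on B_r, as a small combination of extensions of bounded densities. The norm of
the extension operator on B_r thus reappears with factor 1/2 and is absorbed (`extensionNorm_le`).
Modulating F moves the ball to any centre. -/

/-! ### One-dimensional waves: Parseval and the first derivative test -/

/-- The character `e(θ) = exp(2πiθ)`. -/
def unitExp (θ : ℝ) : ℂ := Complex.exp (2 * Real.pi * Complex.I * (θ : ℂ))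

lemma norm_unitExp (θ : ℝ) : ‖unitExp θ‖ = 1 := by
  have h : (2 * Real.pi * Complex.I * (θ : ℂ)) = ((2 * Real.pi * θ : ℝ) : ℂ) * Complex.I := by
    push_cast; ring
  rw [unitExp, h, Complex.norm_exp_ofReal_mul_I]

lemma unitExp_add (a b : ℝ) : unitExp (a + b) = unitExp a * unitExp b := by
  rw [unitExp, unitExp, unitExp, ← Complex.exp_add]; congr 1; push_cast; ring

lemma continuous_unitExp : Continuous unitExp := by
  unfold unitExp; fun_prop

lemma hasDerivAt_unitExp (θ : ℝ) :
    HasDerivAt unitExp (2 * Real.pi * Complex.I * unitExp θ) θ := by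
  have h1 : HasDerivAt (fun x : ℝ => (2 * Real.pi * Complex.I * (x : ℂ)))
      (2 * Real.pi * Complex.I * 1) θ :=
    (Complex.ofRealCLM.hasDerivAt (x := θ)).const_mul _
  have := h1.cexp
  unfold unitExp
  convert this using 1
  ring

/-- The one-dimensional extension of the constant function on `[a, b]` to the parabola. -/
def wave (a b u t : ℝ) : ℂ := ∫ η in a..b, unitExp (η * u + η ^ 2 * t)

lemma norm_wave_le {a b : ℝ} (hab : a ≤ b) (u t : ℝ) : ‖wave a b u t‖ ≤ b - a := by
  have := intervalIntegral.norm_integral_le_of_norm_le_const (a := a) (b := b)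
    (f := fun η => unitExp (η * u + η ^ 2 * t)) (C := 1) (fun η _ => (norm_unitExp _).le)
  rwa [one_mul, abs_of_nonneg (sub_nonneg.2 hab)] at this

lemma continuous_wave (a b : ℝ) : Continuous fun p : ℝ × ℝ => wave a b p.1 p.2 := by
  unfold wave
  apply intervalIntegral.continuous_parametric_intervalIntegral_of_continuous'
  have := continuous_unitExp
  fun_prop

/-- Integer translates of the linear frequency only multiply the integrand by characters of ℝ/ℤ. As
[a, b] lies in one period, Parseval on the circle can be used for each fixed `u`. -/
lemma wave_eq_fourierCoeffOn {a b : ℝ} (ha : 0 ≤ a) (hab : a ≤ b) (hb : b ≤ 1) (u t : ℝ) (k : ℤ) :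
    wave a b (u - k) t = fourierCoeffOn zero_lt_one
      ((Set.Ioc a b).indicator fun η => unitExp (η * u + η ^ 2 * t)) k := by
  rw [fourierCoeffOn_eq_integral, wave, intervalIntegral.integral_of_le hab,
    intervalIntegral.integral_of_le zero_le_one]
  have h : Set.Ioc a b = Set.Ioc 0 1 ∩ Set.Ioc a b := by
    rw [Set.inter_eq_right.2 (Set.Ioc_subset_Ioc ha hb)]
  simp only [sub_zero, div_one, one_smul]
  rw [h, ← integral_indicator (measurableSet_Ioc.inter measurableSet_Ioc), ← integral_indicator
    measurableSet_Ioc]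
  congr 1
  ext η
  by_cases h1 : η ∈ Set.Ioc (0 : ℝ) 1 <;> by_cases h2 : η ∈ Set.Ioc a b
  · have h3 : η ∈ Set.Ioc (0:ℝ) 1 ∩ Set.Ioc a b := ⟨h1, h2⟩
    rw [Set.indicator_of_mem h3, Set.indicator_of_mem h1, Set.indicator_of_mem h3,
      fourier_coe_apply, unitExp, unitExp, smul_eq_mul, ← Complex.exp_add]
    congr 1
    push_cast
    ring
  · have h3 : η ∉ Set.Ioc (0:ℝ) 1 ∩ Set.Ioc a b := fun h => h2 h.2
    simp [h1, h3]
  · exact absurd (Set.Ioc_subset_Ioc ha hb h2) h1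
  · simp [h1, h2]

lemma lintegral_eq_tsum_int (f : ℝ → ℝ≥0∞) (hf : Measurable f) :
    ∫⁻ u, f u = ∫⁻ u in Set.Ioc (0 : ℝ) 1, ∑' k : ℤ, f (u - k) := by
  have h := (isAddFundamentalDomain_Ioc (zero_lt_one : (0:ℝ) < 1) 0 volume).lintegral_eq_tsum' f
  have h2 := lintegral_tsum (μ := volume.restrict (Set.Ioc (0 : ℝ) 1))
    (f := fun (k : ℤ) u => f (u - k))
    (fun k => (hf.comp (measurable_id.sub_const (k : ℝ))).aemeasurable)
  rw [h, zero_add, h2]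
  let e : ℤ ≃ AddSubgroup.zmultiples (1 : ℝ) :=
    Equiv.ofBijective (fun k => ⟨(k : ℝ), ⟨k, by simp⟩⟩) ⟨fun a b h => by
      simpa using congrArg Subtype.val h, fun ⟨x, ⟨k, hk⟩⟩ => ⟨k, Subtype.ext (by simpa using hk)⟩⟩
  rw [← e.tsum_eq]
  refine tsum_congr fun k => lintegral_congr fun u => ?_
  congr 1
  show -(k : ℝ) + u = u - k
  ring

/-- Parseval's identity for `wave` in the linear frequency variable. -/
lemma lintegral_wave_sq_le {a b : ℝ} (ha : 0 ≤ a) (hab : a ≤ b) (hb : b ≤ 1) (t : ℝ) :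
    ∫⁻ u, ‖wave a b u t‖ₑ ^ 2 ≤ ENNReal.ofReal (b - a) := by
  have hc : Continuous fun u => wave a b u t :=
    (continuous_wave a b).comp (continuous_id.prodMk continuous_const)
  rw [lintegral_eq_tsum_int _ (hc.measurable.enorm.pow_const 2)]
  -- For each `u` in one period, the sum over the integers is the squared L² norm of a function of
  -- modulus 1 on (a, b].
  have key : ∀ u : ℝ, ∑' k : ℤ, ‖wave a b (u - k) t‖ₑ ^ 2 ≤ ENNReal.ofReal (b - a) := by
    intro u
    set f := (Set.Ioc a b).indicator fun η => unitExp (η * u + η ^ 2 * t) with hf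
    have hfm : Measurable f := by
      refine Measurable.indicator ?_ measurableSet_Ioc
      have := continuous_unitExp
      fun_prop
    have hfb : ∀ x, ‖f x‖ ≤ 1 := fun x => by
      rw [hf]; refine (norm_indicator_le_norm_self _ _).trans (norm_unitExp _).le
    have hL2 : MemLp f 2 (volume.restrict (Set.Ioc (0:ℝ) 1)) :=
      MemLp.of_bound hfm.aestronglyMeasurable 1 (Filter.Eventually.of_forall hfb)
    have hs := hasSum_sq_fourierCoeffOn zero_lt_one hL2
    have e1 : ∀ k : ℤ, ‖wave a b (u - k) t‖ₑ ^ 2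
        = ENNReal.ofReal (‖fourierCoeffOn zero_lt_one f k‖ ^ 2) := by
      intro k
      rw [wave_eq_fourierCoeffOn ha hab hb, ENNReal.ofReal_pow (norm_nonneg _), ofReal_norm]
    simp_rw [e1]
    rw [← ENNReal.ofReal_tsum_of_nonneg (fun _ => by positivity) hs.summable, hs.tsum_eq]
    apply ENNReal.ofReal_le_ofReal
    have e2 : ∀ x, ‖f x‖ ^ 2 = (Set.Ioc a b).indicator (fun _ => (1:ℝ)) x := by
      intro x
      by_cases hx : x ∈ Set.Ioc a b <;> simp [hf, hx, norm_unitExp]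
    simp_rw [e2]
    rw [intervalIntegral.integral_of_le zero_le_one, integral_indicator measurableSet_Ioc,
      Measure.restrict_restrict measurableSet_Ioc,
      Set.inter_eq_left.2 (Set.Ioc_subset_Ioc ha hb)]
    simp [hab]
  calc _ ≤ ∫⁻ u in Set.Ioc (0 : ℝ) 1, ENNReal.ofReal (b - a) := lintegral_mono key
    _ = _ := by simp

/-- The first derivative test. -/
lemma norm_wave_le_of_le_abs {a b u t δ : ℝ} (hab : a ≤ b) (hδ : 0 < δ)
    (h : ∀ η ∈ Set.Icc a b, δ ≤ |u + 2 * η * t|) :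
    ‖wave a b u t‖ ≤ 1 / δ + |t| * (b - a) / δ ^ 2 := by
  have hpi : (0:ℝ) < Real.pi := Real.pi_pos
  have h2pi : (2 * Real.pi * Complex.I : ℂ) ≠ 0 := Complex.two_pi_I_ne_zero
  have n2pi : ‖(2 * Real.pi * Complex.I : ℂ)‖ = 2 * Real.pi := by
    simp [abs_of_pos hpi]
  have hne : ∀ η ∈ Set.Icc a b, u + 2 * η * t ≠ 0 := fun η hη h0 => by
    have := h η hη; rw [h0, abs_zero] at this; linarith
  have hneC : ∀ η ∈ Set.Icc a b, ((u + 2 * η * t : ℝ) : ℂ) ≠ 0 := fun η hη => by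
    exact_mod_cast hne η hη
  set ph : ℝ → ℝ := fun η => η * u + η ^ 2 * t with hph
  -- Integration by parts: `G` is the exponential divided by 2πi times the derivative of the phase,
  -- and `r` is the error in its derivative that comes from the second derivative 2t.
  set G : ℝ → ℂ := fun η => unitExp (ph η) / (2 * Real.pi * Complex.I * ((u + 2 * η * t : ℝ) : ℂ))
    with hG
  set r : ℝ → ℂ := fun η => (2 * t : ℝ) / (2 * Real.pi * Complex.I * ((u + 2 * η * t : ℝ) : ℂ) ^ 2)
      * unitExp (ph η) with hr
  have hphd : ∀ η, HasDerivAt ph (u + 2 * η * t) η := by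
    intro η
    have := ((hasDerivAt_id η).mul_const u).add ((hasDerivAt_pow 2 η).mul_const t)
    exact this.congr_deriv (by simp)
  have hder : ∀ η ∈ Set.uIcc a b, HasDerivAt G (unitExp (ph η) - r η) η := by
    intro η hη
    rw [Set.uIcc_of_le hab] at hη
    have h1 : HasDerivAt (fun η => unitExp (ph η))
        ((u + 2 * η * t) • (2 * Real.pi * Complex.I * unitExp (ph η))) η :=
      (hasDerivAt_unitExp (ph η)).scomp η (hphd η)
    have h2 : HasDerivAt (fun η : ℝ => ((u + 2 * η * t : ℝ) : ℂ)) ((2 * t : ℝ) : ℂ) η := by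
      apply HasDerivAt.ofReal_comp
      have := (((hasDerivAt_id η).const_mul 2).mul_const t).const_add u
      exact this.congr_deriv (by simp)
    have h3 := h1.div (h2.const_mul (2 * Real.pi * Complex.I)) (mul_ne_zero h2pi (hneC η hη))
    refine h3.congr_deriv ?_
    have := hneC η hη
    have hI := Complex.I_ne_zero
    have hp : (Real.pi : ℂ) ≠ 0 := by exact_mod_cast hpi.ne'
    simp only [hr, Complex.real_smul]
    generalize ((u + 2 * η * t : ℝ) : ℂ) = z at *
    field_simp
  have hcph : Continuous fun η => unitExp (ph η) := by
    have := continuous_unitExp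
    simp only [hph]; fun_prop
  have hcr : ContinuousOn r (Set.Icc a b) := by
    apply ContinuousOn.mul
    · apply ContinuousOn.div continuousOn_const (by fun_prop)
      intro η hη
      exact mul_ne_zero h2pi (pow_ne_zero 2 (hneC η hη))
    · exact hcph.continuousOn
  have hir : IntervalIntegrable r volume a b := by
    apply ContinuousOn.intervalIntegrable; rwa [Set.uIcc_of_le hab]
  have hic : IntervalIntegrable (fun η => unitExp (ph η)) volume a b :=
    hcph.intervalIntegrable a b
  have hint := intervalIntegral.integral_eq_sub_of_hasDerivAt hder (hic.sub hir)
  rw [intervalIntegral.integral_sub hic hir] at hint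
  have hw : wave a b u t = G b - G a + ∫ η in a..b, r η := by
    rw [← hint]; simp [wave, hph]
  have hGn : ∀ η ∈ Set.Icc a b, ‖G η‖ ≤ 1 / (2 * δ) := by
    intro η hη
    simp only [hG]
    rw [norm_div, norm_unitExp, norm_mul, n2pi, Complex.norm_real, Real.norm_eq_abs]
    apply one_div_le_one_div_of_le (by positivity)
    have := h η hη
    have := Real.pi_gt_three
    nlinarith
  have hrn : ∀ η ∈ Set.Icc a b, ‖r η‖ ≤ |t| / δ ^ 2 := by
    intro η hη
    simp only [hr]
    rw [norm_mul, norm_unitExp, norm_div, norm_mul, n2pi, norm_pow, Complex.norm_real,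
      Complex.norm_real, Real.norm_eq_abs, Real.norm_eq_abs, mul_one, abs_mul, abs_two,
      div_le_div_iff₀ (by have := abs_pos.2 (hne η hη); positivity) (by positivity)]
    have h1 := h η hη
    have h2 : δ ^ 2 ≤ |u + 2 * η * t| ^ 2 := pow_le_pow_left₀ hδ.le h1 2
    have := Real.pi_gt_three
    have h4 : 2 * δ ^ 2 ≤ 2 * Real.pi * |u + 2 * η * t| ^ 2 := by nlinarith [sq_nonneg δ]
    nlinarith [abs_nonneg t]
  rw [hw]
  have h5 : ‖∫ η in a..b, r η‖ ≤ |t| / δ ^ 2 * |b - a| := by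
    apply intervalIntegral.norm_integral_le_of_norm_le_const
    intro η hη
    rw [Set.uIoc_of_le hab] at hη
    exact hrn η ⟨hη.1.le, hη.2⟩
  rw [abs_of_nonneg (sub_nonneg.2 hab)] at h5
  calc _ ≤ ‖G b‖ + ‖G a‖ + ‖∫ η in a..b, r η‖ := by
        refine (norm_add_le _ _).trans ?_
        gcongr
        exact norm_sub_le _ _
    _ ≤ 1 / (2 * δ) + 1 / (2 * δ) + |t| / δ ^ 2 * (b - a) := by
        gcongr
        · exact hGn b ⟨hab, le_rfl⟩
        · exact hGn a ⟨le_rfl, hab⟩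
    _ = _ := by field_simp; ring

/-- The phase is stationary at -u/(2t). A cell within h·D of this point gets the trivial bound h. On
a farther cell the first derivative test gives decay like the inverse distance, which squared is the
tail of a Lorentzian of width h·D. The bound holds at every point η of the cell, so that sums over
cells become integrals. -/
lemma norm_wave_sq_le_lorentzian {h a u t D η : ℝ} (hh : 0 < h) (ht : t ≠ 0) (hD1 : 1 ≤ D)
    (hD : 1 / (h ^ 2 * |t|) ≤ D) (hη : η ∈ Set.Icc a (a + h)) :
    ‖wave a (a + h) u t‖ ^ 2 ≤ 8 * h ^ 2 * (1 + ((η - -u / (2 * t)) / (h * D)) ^ 2)⁻¹ := by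
  set η₀ := -u / (2 * t) with hη₀
  have hab : a ≤ a + h := by linarith
  have hD0 : 0 < D := by linarith
  have htr : ‖wave a (a + h) u t‖ ≤ h := by simpa using norm_wave_le hab u t
  have hhD : h ≤ h * D := by nlinarith
  have htri : ∀ η₁ ∈ Set.Icc a (a + h), |η - η₀| ≤ |η₁ - η₀| + h := by
    intro η₁ h₁
    have e1 : |η - η₁| ≤ h := abs_le.2 ⟨by linarith [hη.1, h₁.2], by linarith [hη.2, h₁.1]⟩
    have e2 : η - η₀ = (η₁ - η₀) + (η - η₁) := by ring
    rw [e2]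
    exact (abs_add_le _ _).trans (by linarith)
  by_cases hc : ∃ η₁ ∈ Set.Icc a (a + h), |η₁ - η₀| ≤ h * D
  · obtain ⟨η₁, h₁, h₂⟩ := hc
    have h3 : |η - η₀| ≤ 2 * (h * D) := by linarith [htri η₁ h₁]
    have h4 : ((η - η₀) / (h * D)) ^ 2 ≤ 2 ^ 2 := by
      rw [← sq_abs, abs_div, abs_of_pos (show 0 < h * D by positivity)]
      apply pow_le_pow_left₀ (by positivity)
      rwa [div_le_iff₀ (by positivity)]
    have h5 : (5 : ℝ)⁻¹ ≤ (1 + ((η - η₀) / (h * D)) ^ 2)⁻¹ :=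
      inv_anti₀ (by positivity) (by linarith)
    have h6 : ‖wave a (a + h) u t‖ ^ 2 ≤ h ^ 2 := pow_le_pow_left₀ (norm_nonneg _) htr 2
    nlinarith [sq_nonneg h]
  · push Not at hc
    have hy := hc η hη
    have hpos : 0 < |η - η₀| := lt_trans (by positivity) hy
    have htp : 0 < |t| := abs_pos.2 ht
    have hδ : 0 < |t| * |η - η₀| := by positivity
    have hw := norm_wave_le_of_le_abs (u := u) (t := t) hab hδ (by
      intro η₁ h₁
      have e : u + 2 * η₁ * t = 2 * (t * (η₁ - η₀)) := by rw [hη₀]; field_simp; ring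
      rw [e, abs_mul, abs_mul, abs_two]
      have := htri η₁ h₁
      have := hc η₁ h₁
      nlinarith)
    -- A far cell is at distance more than h from the stationary point, so the second term of the
    -- derivative test is dominated by the first.
    have hw2 : ‖wave a (a + h) u t‖ ≤ 2 / (|t| * |η - η₀|) := by
      refine hw.trans ?_
      have : |t| * (a + h - a) / (|t| * |η - η₀|) ^ 2 ≤ 1 / (|t| * |η - η₀|) := by
        rw [div_le_div_iff₀ (by positivity) (by positivity)]
        have : h ≤ |η - η₀| := by linarith
        nlinarith [mul_le_mul_of_nonneg_left this (show 0 ≤ |t| * (|t| * |η - η₀|) by positivity)]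
      calc _ ≤ 1 / (|t| * |η - η₀|) + 1 / (|t| * |η - η₀|) := by gcongr
        _ = _ := by ring
    set y := (η - η₀) / (h * D) with hyd
    have hya : |η - η₀| = |y| * (h * D) := by
      rw [hyd, abs_div, abs_of_pos (show 0 < h * D by positivity)]; field_simp
    have hy1 : 1 < |y| := by
      rw [hya] at hy
      by_contra hcon
      have : |y| * (h * D) ≤ 1 * (h * D) := by gcongr; linarith
      linarith
    have hw3 : ‖wave a (a + h) u t‖ ≤ 2 * h / |y| := by
      refine hw2.trans ?_
      rw [hya, div_le_div_iff₀ (by positivity) (by positivity)]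
      rw [div_le_iff₀ (by positivity)] at hD
      nlinarith [mul_le_mul_of_nonneg_left hD (show 0 ≤ 2 * |y| by positivity)]
    have hw4 : ‖wave a (a + h) u t‖ ^ 2 ≤ (2 * h / |y|) ^ 2 :=
      pow_le_pow_left₀ (norm_nonneg _) hw3 2
    refine hw4.trans ?_
    rw [div_pow, sq_abs, ← div_eq_mul_inv, div_le_div_iff₀ (by nlinarith [sq_abs y]) (by positivity)]
    have : 1 ≤ y ^ 2 := by rw [← sq_abs]; nlinarith
    nlinarith [mul_le_mul_of_nonneg_left this (sq_nonneg h)]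

lemma integrable_lorentzian {L η₀ : ℝ} (hL : 0 < L) :
    Integrable (fun η : ℝ => (1 + ((η - η₀) / L) ^ 2)⁻¹) :=
  ((integrable_inv_one_add_sq.comp_div hL.ne').comp_sub_right η₀)

lemma integral_lorentzian {L η₀ : ℝ} (hL : 0 < L) :
    ∫ η : ℝ, (1 + ((η - η₀) / L) ^ 2)⁻¹ = L * Real.pi := by
  rw [integral_sub_right_eq_self (fun η : ℝ => (1 + (η / L) ^ 2)⁻¹) η₀,
    Measure.integral_comp_div (fun η : ℝ => (1 + η ^ 2)⁻¹), integral_univ_inv_one_add_sq,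
    abs_of_pos hL, smul_eq_mul]

/-- Square function of the waves of the cells `[jh, (j+1)h]`. -/
lemma sum_norm_wave_sq_le {h : ℝ} (hh : 0 < h) (s : ℕ) (u : ℝ) {t : ℝ} (ht : t ≠ 0) :
    ∑ j ∈ Finset.range s, ‖wave (j * h) (j * h + h) u t‖ ^ 2 ≤ 32 * (h ^ 2 + 1 / |t|) := by
  have htp : 0 < |t| := abs_pos.2 ht
  -- Waves spread over the larger of the cell length h and the uncertainty length 1/(h|t|), which is
  -- h·D.
  set D := max 1 (1 / (h ^ 2 * |t|)) with hD
  have hD1 : 1 ≤ D := le_max_left _ _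
  have hD0 : 0 < D := by linarith
  set g : ℝ → ℝ := fun η => (1 + ((η - -u / (2 * t)) / (h * D)) ^ 2)⁻¹ with hg
  have hgi : Integrable g := integrable_lorentzian (by positivity)
  have hg0 : ∀ η, 0 ≤ g η := fun η => by simp only [hg]; positivity
  have h1 : ∀ j : ℕ, h * ‖wave (j * h) (j * h + h) u t‖ ^ 2 ≤
      ∫ η in (j * h : ℝ)..((j + 1 : ℕ) * h : ℝ), 8 * h ^ 2 * g η := by
    intro j
    have e : ((j + 1 : ℕ) * h : ℝ) = j * h + h := by push_cast; ring
    rw [e]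
    have h2 : ∫ η in (j * h : ℝ)..(j * h + h), ‖wave (j * h) (j * h + h) u t‖ ^ 2
        = h * ‖wave (j * h) (j * h + h) u t‖ ^ 2 := by simp
    rw [← h2]
    apply intervalIntegral.integral_mono_on (by linarith) (by simp)
      (hgi.const_mul _).intervalIntegrable
    intro η hη
    exact norm_wave_sq_le_lorentzian hh ht hD1 (le_max_right _ _) hη
  have h2 : h * ∑ j ∈ Finset.range s, ‖wave (j * h) (j * h + h) u t‖ ^ 2 ≤
      8 * h ^ 2 * (h * D * Real.pi) := by
    rw [Finset.mul_sum]
    calc _ ≤ ∑ j ∈ Finset.range s, ∫ η in (j * h : ℝ)..((j + 1 : ℕ) * h : ℝ), 8 * h ^ 2 * g η :=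
          Finset.sum_le_sum fun j _ => h1 j
      _ = ∫ η in ((0 : ℕ) * h : ℝ)..(s * h : ℝ), 8 * h ^ 2 * g η :=
          intervalIntegral.sum_integral_adjacent_intervals (a := fun j : ℕ => (j * h : ℝ))
            fun j _ => (hgi.const_mul _).intervalIntegrable
      _ ≤ ∫ η, 8 * h ^ 2 * g η := by
          rw [intervalIntegral.integral_of_le (by push_cast; nlinarith [Nat.cast_nonneg (α := ℝ) s])]
          exact setIntegral_le_integral (hgi.const_mul _)
            (Filter.Eventually.of_forall fun η => mul_nonneg (by positivity) (hg0 η))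
      _ = _ := by
          rw [integral_const_mul, hg, integral_lorentzian (by positivity)]
  have h3 : ∑ j ∈ Finset.range s, ‖wave (j * h) (j * h + h) u t‖ ^ 2 ≤ 8 * h ^ 2 * D * Real.pi := by
    refine le_of_mul_le_mul_left (h2.trans_eq (by ring)) hh
  refine h3.trans ?_
  have h4 : h ^ 2 * D ≤ h ^ 2 + 1 / |t| := by
    rw [hD, mul_max_of_nonneg _ _ (by positivity)]
    apply max_le
    · have : 0 ≤ 1 / |t| := by positivity
      linarith
    · have : h ^ 2 * (1 / (h ^ 2 * |t|)) = 1 / |t| := by field_simp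
      rw [this]; nlinarith
  have := Real.pi_lt_four
  have := Real.pi_pos
  have h5 : 0 ≤ h ^ 2 * D := by positivity
  nlinarith

lemma sum_norm_wave_sq_le_mul {h : ℝ} (hh : 0 < h) (s : ℕ) (u t : ℝ) :
    ∑ j ∈ Finset.range s, ‖wave (j * h) (j * h + h) u t‖ ^ 2 ≤ s * h ^ 2 := by
  calc _ ≤ ∑ j ∈ Finset.range s, h ^ 2 := by
        apply Finset.sum_le_sum
        intro j _
        apply pow_le_pow_left₀ (norm_nonneg _)
        simpa using norm_wave_le (show (j * h : ℝ) ≤ j * h + h by linarith) u t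
    _ = _ := by simp

/-! ### Extensions of step functions on the canonical squares -/

lemma inner_paraboloidPoint (ξ : EuclideanSpace ℝ (Fin 2)) (x : EuclideanSpace ℝ (Fin 3)) :
    inner ℝ (paraboloidPoint ξ) x
      = (ξ 0 * x 0 + ξ 0 ^ 2 * x 2) + (ξ 1 * x 1 + ξ 1 ^ 2 * x 2) := by
  have h : ‖ξ‖ ^ 2 = ξ 0 ^ 2 + ξ 1 ^ 2 := by
    rw [EuclideanSpace.norm_sq_eq]; simp
  simp [paraboloidPoint, PiLp.inner_apply, Fin.sum_univ_three, h]
  ring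

lemma extensionOp_eq (S : Set (EuclideanSpace ℝ (Fin 2))) (F : EuclideanSpace ℝ (Fin 2) → ℂ)
    (x : EuclideanSpace ℝ (Fin 3)) :
    extensionOp S F x = ∫ ξ in S, F ξ * unitExp (inner ℝ (paraboloidPoint ξ) x) := rfl

lemma continuous_paraboloidPoint : Continuous paraboloidPoint := by
  unfold paraboloidPoint
  refine (PiLp.continuous_toLp 2 _).comp (continuous_pi fun i => ?_)
  fin_cases i <;> simp <;> fun_prop

lemma continuous_unitExp_inner (x : EuclideanSpace ℝ (Fin 3)) :
    Continuous fun ξ => unitExp (inner ℝ (paraboloidPoint ξ) x) :=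
  continuous_unitExp.comp (continuous_paraboloidPoint.inner continuous_const)

/-- The plane as a product of two lines. -/
def planeEquiv : EuclideanSpace ℝ (Fin 2) ≃ᵐ ℝ × ℝ :=
  (MeasurableEquiv.toLp 2 (Fin 2 → ℝ)).symm.trans MeasurableEquiv.finTwoArrow

lemma planeEquiv_apply (ξ : EuclideanSpace ℝ (Fin 2)) : planeEquiv ξ = (ξ 0, ξ 1) := rfl

lemma measurePreserving_planeEquiv : MeasurePreserving planeEquiv :=
  (EuclideanSpace.volume_preserving_symm_measurableEquiv_toLp (Fin 2)).trans
    (volume_preserving_finTwoArrow ℝ)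

lemma setIntegral_rectangle {a b a' b' : ℝ} (hab : a ≤ b) (hab' : a' ≤ b')
    (x : EuclideanSpace ℝ (Fin 3)) :
    ∫ ξ in {ξ : EuclideanSpace ℝ (Fin 2) | ξ 0 ∈ Set.Icc a b ∧ ξ 1 ∈ Set.Icc a' b'},
      unitExp (inner ℝ (paraboloidPoint ξ) x)
      = wave a b (x 0) (x 2) * wave a' b' (x 1) (x 2) := by
  have h := measurePreserving_planeEquiv.setIntegral_preimage_emb
    planeEquiv.measurableEmbedding
    (fun p : ℝ × ℝ => unitExp (p.1 * x 0 + p.1 ^ 2 * x 2) * unitExp (p.2 * x 1 + p.2 ^ 2 * x 2))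
    (Set.Icc a b ×ˢ Set.Icc a' b')
  have hs : planeEquiv ⁻¹' (Set.Icc a b ×ˢ Set.Icc a' b') =
      {ξ : EuclideanSpace ℝ (Fin 2) | ξ 0 ∈ Set.Icc a b ∧ ξ 1 ∈ Set.Icc a' b'} := rfl
  rw [hs] at h
  rw [wave, wave, intervalIntegral.integral_of_le hab, intervalIntegral.integral_of_le hab',
    ← integral_Icc_eq_integral_Ioc, ← integral_Icc_eq_integral_Ioc,
    ← setIntegral_prod_mul, ← Measure.volume_eq_prod, ← h]
  refine integral_congr_ae (Filter.Eventually.of_forall fun ξ => ?_)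
  simp only [inner_paraboloidPoint, unitExp_add, planeEquiv_apply]

lemma measurableSet_canonicalSquare (n : ℕ) (q : Fin n × Fin n) :
    MeasurableSet (canonicalSquare n q) := by
  have : canonicalSquare n q = planeEquiv ⁻¹' (Set.Icc ((q.1 : ℝ) / n) (((q.1 : ℝ) + 1) / n) ×ˢ
      Set.Icc ((q.2 : ℝ) / n) (((q.2 : ℝ) + 1) / n)) := rfl
  rw [this]
  exact planeEquiv.measurable (measurableSet_Icc.prod measurableSet_Icc)

lemma unitSquare_eq : unitSquare = planeEquiv ⁻¹' (Set.Icc (0 : ℝ) 1 ×ˢ Set.Icc (0 : ℝ) 1) := by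
  ext ξ
  simp only [unitSquare, Fin.forall_fin_two, Set.mem_preimage, planeEquiv_apply, Set.mem_prod,
    Set.mem_ofPred_eq]

lemma measurableSet_unitSquare : MeasurableSet unitSquare := by
  rw [unitSquare_eq]
  exact planeEquiv.measurable (measurableSet_Icc.prod measurableSet_Icc)

lemma volume_unitSquare : volume unitSquare = 1 := by
  rw [unitSquare_eq, measurePreserving_planeEquiv.measure_preimage_equiv, Measure.volume_eq_prod,
    Measure.prod_prod]
  simp

lemma canonicalSquare_subset (n : ℕ) (q : Fin n × Fin n) : canonicalSquare n q ⊆ unitSquare := by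
  have hc : ∀ j : Fin n, 0 ≤ (j : ℝ) / n ∧ ((j : ℝ) + 1) / n ≤ 1 := fun j => by
    have hn : 0 < n := j.pos
    refine ⟨by positivity, (div_le_one (by positivity)).2 ?_⟩
    exact_mod_cast j.2
  rintro ξ ⟨h0, h1⟩ i
  fin_cases i
  · exact ⟨(hc q.1).1.trans h0.1, h0.2.trans (hc q.1).2⟩
  · exact ⟨(hc q.2).1.trans h1.1, h1.2.trans (hc q.2).2⟩

lemma volume_canonicalSquare (n : ℕ) (q : Fin n × Fin n) :
    volume (canonicalSquare n q) = ENNReal.ofReal (1 / (n : ℝ) ^ 2) := by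
  have : canonicalSquare n q = planeEquiv ⁻¹' (Set.Icc ((q.1 : ℝ) / n) (((q.1 : ℝ) + 1) / n) ×ˢ
      Set.Icc ((q.2 : ℝ) / n) (((q.2 : ℝ) + 1) / n)) := rfl
  rw [this, measurePreserving_planeEquiv.measure_preimage_equiv, Measure.volume_eq_prod,
    Measure.prod_prod, Real.volume_Icc, Real.volume_Icc, ← ENNReal.ofReal_mul]
  · congr 1; ring
  · rw [← sub_div]; simp

lemma volume_line_eq_zero (v : ℝ) (i : Fin 2) :
    volume {ξ : EuclideanSpace ℝ (Fin 2) | ξ i = v} = 0 := by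
  fin_cases i
  · have : {ξ : EuclideanSpace ℝ (Fin 2) | ξ 0 = v} = planeEquiv ⁻¹' ({v} ×ˢ Set.univ) := by
      ext ξ; simp [planeEquiv_apply]
    show volume {ξ : EuclideanSpace ℝ (Fin 2) | ξ 0 = v} = 0
    rw [this, measurePreserving_planeEquiv.measure_preimage_equiv, Measure.volume_eq_prod,
      Measure.prod_prod]
    simp
  · have : {ξ : EuclideanSpace ℝ (Fin 2) | ξ 1 = v} = planeEquiv ⁻¹' (Set.univ ×ˢ {v}) := by
      ext ξ; simp [planeEquiv_apply]
    show volume {ξ : EuclideanSpace ℝ (Fin 2) | ξ 1 = v} = 0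
    rw [this, measurePreserving_planeEquiv.measure_preimage_equiv, Measure.volume_eq_prod,
      Measure.prod_prod]
    simp

lemma eq_div_of_mem_Icc_of_lt {n i j : ℕ} (hn : 0 < n) (hij : i < j) {v : ℝ}
    (hi : v ∈ Set.Icc ((i : ℝ) / n) (((i : ℝ) + 1) / n))
    (hj : v ∈ Set.Icc ((j : ℝ) / n) (((j : ℝ) + 1) / n)) : v = (j : ℝ) / n := by
  refine le_antisymm (hi.2.trans ?_) hj.1
  have : (i : ℝ) + 1 ≤ j := by exact_mod_cast hij
  gcongr

lemma volume_canonicalSquare_inter (n : ℕ) {q q' : Fin n × Fin n} (h : q ≠ q') :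
    volume (canonicalSquare n q ∩ canonicalSquare n q') = 0 := by
  have hn : 0 < n := q.1.pos
  have h1 : q.1 ≠ q'.1 ∨ q.2 ≠ q'.2 := by
    by_contra hc; push Not at hc; exact h (Prod.ext hc.1 hc.2)
  have key : ∀ i j : Fin n, i ≠ j → ∃ w : ℝ, ∀ v, v ∈ Set.Icc ((i : ℝ) / n) (((i : ℝ) + 1) / n) →
      v ∈ Set.Icc ((j : ℝ) / n) (((j : ℝ) + 1) / n) → v = w := by
    intro i j hij
    rcases lt_or_gt_of_ne (Fin.val_ne_of_ne hij) with h2 | h2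
    · exact ⟨_, fun v hi hj => eq_div_of_mem_Icc_of_lt hn h2 hi hj⟩
    · exact ⟨_, fun v hi hj => eq_div_of_mem_Icc_of_lt hn h2 hj hi⟩
  rcases h1 with h1 | h1
  · obtain ⟨w, hw⟩ := key _ _ h1
    exact measure_mono_null (fun ξ hξ => hw _ hξ.1.1 hξ.2.1) (volume_line_eq_zero w 0)
  · obtain ⟨w, hw⟩ := key _ _ h1
    exact measure_mono_null (fun ξ hξ => hw _ hξ.1.2 hξ.2.2) (volume_line_eq_zero w 1)

/-- The extension of the indicator function of a canonical square. -/
def cellWave (n : ℕ) (q : Fin n × Fin n) (x : EuclideanSpace ℝ (Fin 3)) : ℂ :=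
  wave ((q.1 : ℝ) / n) (((q.1 : ℝ) + 1) / n) (x 0) (x 2) *
    wave ((q.2 : ℝ) / n) (((q.2 : ℝ) + 1) / n) (x 1) (x 2)

lemma continuous_cellWave (n : ℕ) (q : Fin n × Fin n) : Continuous (cellWave n q) := by
  have h : ∀ (a b : ℝ) (i : Fin 3), Continuous fun x : EuclideanSpace ℝ (Fin 3) =>
      wave a b (x i) (x 2) := fun a b i =>
    (continuous_wave a b).comp ((by fun_prop : Continuous fun x : EuclideanSpace ℝ (Fin 3) => x i).prodMk
      (by fun_prop : Continuous fun x : EuclideanSpace ℝ (Fin 3) => x 2))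
  exact (h _ _ _).mul (h _ _ _)

lemma setIntegral_canonicalSquare (n : ℕ) (q : Fin n × Fin n) (x : EuclideanSpace ℝ (Fin 3)) :
    ∫ ξ in canonicalSquare n q, unitExp (inner ℝ (paraboloidPoint ξ) x) = cellWave n q x :=
  setIntegral_rectangle (by gcongr; linarith) (by gcongr; linarith) x

/-- The function with value `a q` on the canonical square `q`. -/
def stepFunction (n : ℕ) (a : Fin n × Fin n → ℂ) (ξ : EuclideanSpace ℝ (Fin 2)) : ℂ :=
  ∑ q, (canonicalSquare n q).indicator (fun _ => a q) ξ

lemma integrableOn_unitExp_inner {S : Set (EuclideanSpace ℝ (Fin 2))} (hS : volume S ≠ ∞)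
    (x : EuclideanSpace ℝ (Fin 3)) :
    IntegrableOn (fun ξ => unitExp (inner ℝ (paraboloidPoint ξ) x)) S := by
  have : IsFiniteMeasure (volume.restrict S) := ⟨by simpa using hS.lt_top⟩
  exact Integrable.of_bound (continuous_unitExp_inner x).aestronglyMeasurable 1
    (Filter.Eventually.of_forall fun ξ => (norm_unitExp _).le)

lemma integrable_stepFunction (n : ℕ) (a : Fin n × Fin n → ℂ) :
    Integrable (stepFunction n a) := by
  refine integrable_finsetSum _ fun q _ => ?_
  rw [integrable_indicator_iff (measurableSet_canonicalSquare n q)]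
  exact integrableOn_const (by rw [volume_canonicalSquare]; simp)

/-- One statement for the unit square and for ensembles: neighbouring closed squares share only
edges, so a square outside `S` contributes nothing. -/
lemma extensionOp_stepFunction_of_inter (n : ℕ) (a : Fin n × Fin n → ℂ)
    {A : Set (EuclideanSpace ℝ (Fin 2))} (S : Finset (Fin n × Fin n))
    (hmem : ∀ q ∈ S, canonicalSquare n q ⊆ A)
    (hnot : ∀ q ∉ S, volume (canonicalSquare n q ∩ A) = 0) (x : EuclideanSpace ℝ (Fin 3)) :
    extensionOp A (stepFunction n a) x = ∑ q ∈ S, a q * cellWave n q x := by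
  have e : ∀ ξ, stepFunction n a ξ * unitExp (inner ℝ (paraboloidPoint ξ) x) =
      ∑ q, (canonicalSquare n q).indicator
        (fun ξ => a q * unitExp (inner ℝ (paraboloidPoint ξ) x)) ξ := by
    intro ξ
    rw [stepFunction, Finset.sum_mul]
    refine Finset.sum_congr rfl fun q _ => ?_
    by_cases h : ξ ∈ canonicalSquare n q <;> simp [h]
  have hi : ∀ q, Integrable ((canonicalSquare n q).indicator
        (fun ξ => a q * unitExp (inner ℝ (paraboloidPoint ξ) x))) (volume.restrict A) := by
    intro q
    refine Integrable.restrict ?_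
    rw [integrable_indicator_iff (measurableSet_canonicalSquare n q)]
    exact (integrableOn_unitExp_inner (by rw [volume_canonicalSquare]; simp) x).const_mul _
  rw [extensionOp_eq]
  simp_rw [e]
  rw [integral_finsetSum _ fun q _ => hi q, ← Finset.sum_subset (Finset.subset_univ S)]
  · refine Finset.sum_congr rfl fun q hq => ?_
    rw [integral_indicator (measurableSet_canonicalSquare n q), Measure.restrict_restrict
      (measurableSet_canonicalSquare n q), Set.inter_eq_left.2 (hmem q hq), integral_const_mul,
      setIntegral_canonicalSquare]
  · intro q _ hq
    rw [integral_indicator (measurableSet_canonicalSquare n q), Measure.restrict_restrict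
      (measurableSet_canonicalSquare n q), Measure.restrict_eq_zero.2 (hnot q hq)]
    simp

lemma extensionOp_ensemble_stepFunction (n : ℕ) (a : Fin n × Fin n → ℂ)
    (S : Finset (Fin n × Fin n)) (x : EuclideanSpace ℝ (Fin 3)) :
    extensionOp (ensemble n S) (stepFunction n a) x = ∑ q ∈ S, a q * cellWave n q x := by
  refine extensionOp_stepFunction_of_inter n a S
    (fun q hq => Set.subset_biUnion_of_mem (u := canonicalSquare n) hq) (fun q hq => ?_) x
  change volume (canonicalSquare n q ∩ ⋃ q' ∈ S, canonicalSquare n q') = 0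
  rw [Set.inter_iUnion₂]
  refine (measure_biUnion_null_iff S.countable_toSet).2 fun q' hq' => ?_
  exact volume_canonicalSquare_inter n fun h => hq (h ▸ hq')

lemma extensionOp_unitSquare_stepFunction (n : ℕ) (a : Fin n × Fin n → ℂ)
    (x : EuclideanSpace ℝ (Fin 3)) :
    extensionOp unitSquare (stepFunction n a) x = ∑ q, a q * cellWave n q x :=
  extensionOp_stepFunction_of_inter n a Finset.univ
    (fun q _ => canonicalSquare_subset n q) (fun q hq => absurd (Finset.mem_univ q) hq) x

/-! ### The L³ norm of the square function -/

/-- Space as the product of the vertical line and the horizontal plane. -/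
def spaceEquiv : EuclideanSpace ℝ (Fin 3) ≃ᵐ ℝ × (ℝ × ℝ) :=
  ((MeasurableEquiv.toLp 2 (Fin 3 → ℝ)).symm.trans
    (MeasurableEquiv.piFinSuccAbove (fun _ => ℝ) 2)).trans
    ((MeasurableEquiv.refl ℝ).prodCongr MeasurableEquiv.finTwoArrow)

lemma measurePreserving_spaceEquiv : MeasurePreserving spaceEquiv :=
  ((EuclideanSpace.volume_preserving_symm_measurableEquiv_toLp (Fin 3)).trans
    (volume_preserving_piFinSuccAbove (fun _ => ℝ) 2)).trans
    ((MeasurePreserving.id volume).prod (volume_preserving_finTwoArrow ℝ))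

/-- The square function of the waves of the first `s` intervals of length `h`. -/
def waveSquare (h : ℝ) (s : ℕ) (u t : ℝ) : ℝ :=
  ∑ j ∈ Finset.range s, ‖wave (j * h) (j * h + h) u t‖ ^ 2

lemma waveSquare_nonneg (h : ℝ) (s : ℕ) (u t : ℝ) : 0 ≤ waveSquare h s u t :=
  Finset.sum_nonneg fun _ _ => by positivity

lemma continuous_waveSquare (h : ℝ) (s : ℕ) :
    Continuous fun p : ℝ × ℝ => waveSquare h s p.1 p.2 :=
  continuous_finsetSum _ fun _ _ => ((continuous_wave _ _).norm.pow 2)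

lemma measurable_waveSquare_rpow (h : ℝ) (s : ℕ) :
    Measurable fun p : ℝ × ℝ => ENNReal.ofReal (waveSquare h s p.2 p.1) ^ (3 / 2 : ℝ) := by
  have : Measurable fun p : ℝ × ℝ => waveSquare h s p.2 p.1 :=
    ((continuous_waveSquare h s).comp (continuous_snd.prodMk continuous_fst)).measurable
  exact this.ennreal_ofReal.pow_const _

/-- Parseval on each of the `s` cells, each of length 1/n. -/
lemma lintegral_waveSquare_le {n s : ℕ} (hn : 0 < n) (hs : s ≤ n) (t : ℝ) :
    ∫⁻ u, ENNReal.ofReal (waveSquare (1 / n) s u t) ≤ ENNReal.ofReal (s / n) := by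
  have hn' : (0 : ℝ) < n := by exact_mod_cast hn
  have e : ∀ u, ENNReal.ofReal (waveSquare (1 / n) s u t) =
      ∑ j ∈ Finset.range s, ‖wave (j * (1 / n)) (j * (1 / n) + 1 / n) u t‖ₑ ^ 2 := by
    intro u
    rw [waveSquare, ENNReal.ofReal_sum_of_nonneg fun _ _ => by positivity]
    refine Finset.sum_congr rfl fun j _ => ?_
    rw [ENNReal.ofReal_pow (norm_nonneg _), ofReal_norm]
  simp_rw [e]
  have hm : ∀ j : ℕ, Measurable fun u =>
      ‖wave (j * (1 / n)) (j * (1 / n) + 1 / n) u t‖ₑ ^ 2 := fun j =>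
    (((continuous_wave (j * (1 / n)) (j * (1 / n) + 1 / n)).comp
      (continuous_id.prodMk (continuous_const (y := t)))).measurable.enorm.pow_const 2)
  rw [lintegral_finsetSum _ fun j _ => hm j]
  calc _ ≤ ∑ j ∈ Finset.range s, ENNReal.ofReal (1 / n) := by
        refine Finset.sum_le_sum fun j hj => ?_
        have hj' : (j : ℝ) + 1 ≤ n := by
          exact_mod_cast (Nat.succ_le_of_lt (Finset.mem_range.1 hj)).trans hs
        refine (lintegral_wave_sq_le (by positivity) (by simp) ?_ t).trans_eq (by simp)
        have : (j : ℝ) * (1 / n) + 1 / n = (j + 1) / n := by ring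
        rw [this]
        exact (div_le_one hn').2 hj'
    _ = _ := by
        rw [Finset.sum_const, Finset.card_range, nsmul_eq_mul, div_eq_mul_one_div (s : ℝ),
          ENNReal.ofReal_mul (by positivity), ENNReal.ofReal_natCast]

/-- Stationary phase gives 1/n² + 1/(1+|t|), and the trivial bound covers |t| < 1. Below 2n², the
non-integrable 1/(1+|t|) is traded for an integrable power at the price (2n²)^δ; above, it is at
most 1/n². Thus no truncation in t is needed later. -/
lemma waveSquare_le {n s : ℕ} (hn : 0 < n) (hs : s ≤ n) {δ : ℝ} (hδ : 0 < δ) (u t : ℝ) :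
    waveSquare (1 / n) s u t ≤
      64 * (2 / (n : ℝ) ^ 2 + (2 * (n : ℝ) ^ 2) ^ δ * (1 + |t|) ^ (-(1 + δ))) := by
  have hn' : (1 : ℝ) ≤ n := by exact_mod_cast hn
  have hs' : (s : ℝ) ≤ n := by exact_mod_cast hs
  have ht : 0 < 1 + |t| := by positivity
  have h1 : waveSquare (1 / n) s u t ≤ 64 * (1 / (n : ℝ) ^ 2 + 1 / (1 + |t|)) := by
    rcases le_or_gt 1 |t| with h | h
    · have := sum_norm_wave_sq_le (h := 1 / n) (by positivity) s u
        (t := t) (fun h0 => by rw [h0, abs_zero] at h; linarith)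
      refine this.trans ?_
      have h2 : 1 / |t| ≤ 2 * (1 / (1 + |t|)) := by
        rw [mul_one_div, div_le_div_iff₀ (by linarith) ht]; linarith
      have h3 : (1 / (n : ℝ)) ^ 2 = 1 / (n : ℝ) ^ 2 := by ring
      have : 0 ≤ 1 / (n : ℝ) ^ 2 := by positivity
      rw [h3]; linarith
    · refine (sum_norm_wave_sq_le_mul (h := 1 / n) (by positivity) s u t).trans ?_
      have h2 : (s : ℝ) * (1 / n) ^ 2 ≤ 1 := by
        have : (s : ℝ) * (1 / n) ^ 2 = s / n ^ 2 := by ring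
        rw [this, div_le_one (by positivity)]
        nlinarith
      have h3 : 1 / 2 ≤ 1 / (1 + |t|) := one_div_le_one_div_of_le ht (by linarith)
      have : 0 ≤ 1 / (n : ℝ) ^ 2 := by positivity
      linarith
  have h2 : 1 / (1 + |t|) ≤
      1 / (n : ℝ) ^ 2 + (2 * (n : ℝ) ^ 2) ^ δ * (1 + |t|) ^ (-(1 + δ)) := by
    rcases le_or_gt (1 + |t|) (2 * (n : ℝ) ^ 2) with h | h
    · have e : 1 / (1 + |t|) = (1 + |t|) ^ δ * (1 + |t|) ^ (-(1 + δ)) := by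
        rw [← Real.rpow_add ht, one_div, ← Real.rpow_neg_one]; congr 1; ring
      have h3 : (1 + |t|) ^ δ ≤ (2 * (n : ℝ) ^ 2) ^ δ := Real.rpow_le_rpow ht.le h hδ.le
      have h4 : 0 ≤ 1 / (n : ℝ) ^ 2 := by positivity
      have h5 : 0 ≤ (1 + |t|) ^ (-(1 + δ)) := by positivity
      rw [e]
      nlinarith
    · have h3 : 1 / (1 + |t|) ≤ 1 / (n : ℝ) ^ 2 :=
        one_div_le_one_div_of_le (by positivity) (by nlinarith)
      have : 0 ≤ (2 * (n : ℝ) ^ 2) ^ δ * (1 + |t|) ^ (-(1 + δ)) := by positivity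
      linarith
  have e2 : 2 / (n : ℝ) ^ 2 = 1 / (n : ℝ) ^ 2 + 1 / (n : ℝ) ^ 2 := by ring
  rw [e2]
  linarith

/-- Interpolation: the exponent 3/2 splits as 1/2 + 1, with the uniform bound used for the first
factor and Parseval for the second. The outer square stands for the two horizontal variables. -/
lemma lintegral_waveSquare_rpow_le {n s : ℕ} (hn : 0 < n) (hs : s ≤ n) {δ : ℝ} (hδ : 0 < δ)
    (t : ℝ) :
    (∫⁻ u, ENNReal.ofReal (waveSquare (1 / n) s u t) ^ (3 / 2 : ℝ)) ^ 2 ≤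
      ENNReal.ofReal (64 * (2 / (n : ℝ) ^ 2 + (2 * (n : ℝ) ^ 2) ^ δ * (1 + |t|) ^ (-(1 + δ))))
        * ENNReal.ofReal (s / n) ^ 2 := by
  set S := ENNReal.ofReal
    (64 * (2 / (n : ℝ) ^ 2 + (2 * (n : ℝ) ^ 2) ^ δ * (1 + |t|) ^ (-(1 + δ)))) with hS
  have h1 : ∫⁻ u, ENNReal.ofReal (waveSquare (1 / n) s u t) ^ (3 / 2 : ℝ) ≤
      S ^ (1 / 2 : ℝ) * ENNReal.ofReal (s / n) := by
    calc _ ≤ ∫⁻ u, S ^ (1 / 2 : ℝ) * ENNReal.ofReal (waveSquare (1 / n) s u t) := by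
          refine lintegral_mono fun u => ?_
          have e : (3 / 2 : ℝ) = 1 / 2 + 1 := by norm_num
          rw [e, ENNReal.rpow_add_of_nonneg _ _ (by norm_num) (by norm_num), ENNReal.rpow_one]
          gcongr
          apply ENNReal.ofReal_le_ofReal
          exact waveSquare_le hn hs hδ u t
      _ = S ^ (1 / 2 : ℝ) * ∫⁻ u, ENNReal.ofReal (waveSquare (1 / n) s u t) := by
          rw [lintegral_const_mul']
          exact ENNReal.rpow_ne_top_of_nonneg (by norm_num) ENNReal.ofReal_ne_top
      _ ≤ _ := by gcongr; exact lintegral_waveSquare_le hn hs t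
  calc _ ≤ (S ^ (1 / 2 : ℝ) * ENNReal.ofReal (s / n)) ^ 2 := by gcongr
    _ = _ := by
      rw [mul_pow, ← ENNReal.rpow_natCast (S ^ (1 / 2 : ℝ)), ← ENNReal.rpow_mul]; norm_num

/-- Each cell wave is a product and the coefficients live in an s × s square, so enlarging the sum
to the full square lets it factor. -/
lemma sum_norm_cellWave_sq_le {n s : ℕ} {a : Fin n × Fin n → ℂ} (ha : ∀ q, ‖a q‖ ≤ 1)
    (hsupp : ∀ q, a q ≠ 0 → (q.1 : ℕ) < s ∧ (q.2 : ℕ) < s) (x : EuclideanSpace ℝ (Fin 3)) :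
    ∑ q, ‖a q * cellWave n q x‖ ^ 2 ≤
      waveSquare (1 / n) s (x 0) (x 2) * waveSquare (1 / n) s (x 1) (x 2) := by
  set f : ℕ → Fin 3 → ℝ := fun j i => ‖wave (j * (1 / n)) (j * (1 / n) + 1 / n) (x i) (x 2)‖ ^ 2
    with hf
  have hf0 : ∀ j i, 0 ≤ f j i := fun j i => by simp only [hf]; positivity
  have e : waveSquare (1 / n) s (x 0) (x 2) * waveSquare (1 / n) s (x 1) (x 2) =
      ∑ p ∈ Finset.range s ×ˢ Finset.range s, f p.1 0 * f p.2 1 := by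
    rw [waveSquare, waveSquare, Finset.sum_mul_sum, Finset.sum_product]
  rw [e]
  have e2 : ∀ j : ℕ, (j : ℝ) / n = j * (1 / n) ∧ ((j : ℝ) + 1) / n = j * (1 / n) + 1 / n :=
    fun j => ⟨by ring, by ring⟩
  calc _ = ∑ q ∈ Finset.univ.filter (fun q => a q ≠ 0), ‖a q * cellWave n q x‖ ^ 2 := by
        rw [Finset.sum_filter_of_ne]
        intro q _ h h0
        simp [h0] at h
    _ ≤ ∑ q ∈ Finset.univ.filter (fun q => a q ≠ 0), f q.1 0 * f q.2 1 := by
        refine Finset.sum_le_sum fun q _ => ?_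
        rw [norm_mul, cellWave, norm_mul, mul_pow, mul_pow, (e2 _).1, (e2 _).2, (e2 _).1, (e2 _).2]
        have : ‖a q‖ ^ 2 ≤ 1 := pow_le_one₀ (norm_nonneg _) (ha q)
        exact mul_le_of_le_one_left (mul_nonneg (hf0 q.1 0) (hf0 q.2 1)) this
    _ = ∑ p ∈ (Finset.univ.filter (fun q => a q ≠ 0)).image
          (fun q : Fin n × Fin n => ((q.1 : ℕ), (q.2 : ℕ))), f p.1 0 * f p.2 1 := by
        rw [Finset.sum_image]
        intro q _ q' _ h
        have h1 := congrArg Prod.fst h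
        have h2 := congrArg Prod.snd h
        exact Prod.ext (Fin.ext h1) (Fin.ext h2)
    _ ≤ _ := by
        apply Finset.sum_le_sum_of_subset_of_nonneg
        · intro p hp
          obtain ⟨q, hq, rfl⟩ := Finset.mem_image.1 hp
          have := hsupp q (Finset.mem_filter.1 hq).2
          simp [this]
        · intro p _ _
          exact mul_nonneg (hf0 _ _) (hf0 _ _)

/-- Horizontal decay of the weight can be dropped because Parseval provides integrability in these
directions. What is left depends on the vertical variable alone, so Tonelli separates the integral.
-/
lemma lintegral_ballWeight_le (E : ℝ) (hE : 0 < E) (c : EuclideanSpace ℝ (Fin 3)) {R : ℝ}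
    (hR : 0 < R) (f : EuclideanSpace ℝ (Fin 3) → ℝ≥0∞) (hf : Measurable f) :
    ∫⁻ x, f x ∂ballWeight E c R ≤
      ∫⁻ x, f x * ENNReal.ofReal ((1 + |x 2 - c 2| / R) ^ (-E)) := by
  rw [ballWeight, lintegral_withDensity_eq_lintegral_mul _ (by fun_prop) hf]
  refine lintegral_mono fun x => ?_
  rw [Pi.mul_apply, mul_comm]
  refine mul_le_mul_right (ENNReal.ofReal_le_ofReal ?_) (f x)
  apply Real.rpow_le_rpow_of_nonpos (by positivity) _ (by linarith)
  gcongr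
  have := EuclideanSpace.norm_eq (x - c)
  rw [dist_eq_norm, ← Real.norm_eq_abs]
  exact PiLp.norm_apply_le (x - c) 2

lemma lintegral_eq_mul_lintegral_comp_mul {f : ℝ → ℝ≥0∞} (hf : Measurable f) {a : ℝ}
    (ha : a ≠ 0) : ∫⁻ t, f t = ENNReal.ofReal |a| * ∫⁻ t, f (t * a) := by
  conv_lhs => rw [← Real.smul_map_volume_mul_right ha]
  rw [lintegral_smul_measure, lintegral_map hf (by fun_prop), smul_eq_mul]

lemma lintegral_one_add_div_rpow (E : ℝ) (v : ℝ) {R : ℝ} (hR : 0 < R) :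
    ∫⁻ t, ENNReal.ofReal ((1 + |t - v| / R) ^ (-E)) =
      ENNReal.ofReal R * ∫⁻ t : ℝ, ENNReal.ofReal ((1 + |t|) ^ (-E)) := by
  rw [lintegral_sub_right_eq_self (fun t : ℝ => ENNReal.ofReal ((1 + |t| / R) ^ (-E))) v]
  rw [lintegral_eq_mul_lintegral_comp_mul (a := R⁻¹)
      (f := fun t : ℝ => ENNReal.ofReal ((1 + |t|) ^ (-E))) (by fun_prop) (by positivity),
    ← mul_assoc, ← ENNReal.ofReal_mul hR.le, abs_of_pos (by positivity), mul_inv_cancel₀ hR.ne',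
    ENNReal.ofReal_one, one_mul]
  refine lintegral_congr fun t => ?_
  rw [abs_mul, abs_of_pos (inv_pos.2 hR), div_eq_mul_inv]

lemma lintegral_mul_mul_space {W : ℝ → ℝ≥0∞} {B : ℝ → ℝ → ℝ≥0∞} (hW : Measurable W)
    (hB : Measurable fun p : ℝ × ℝ => B p.1 p.2) :
    ∫⁻ x : EuclideanSpace ℝ (Fin 3), W (x 2) * (B (x 2) (x 0) * B (x 2) (x 1)) =
      ∫⁻ t, W t * (∫⁻ u, B t u) ^ 2 := by
  have hm : Measurable fun p : ℝ × (ℝ × ℝ) => B p.1 p.2.1 * B p.1 p.2.2 :=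
    (hB.comp (measurable_fst.prodMk (measurable_fst.comp measurable_snd))).mul
      (hB.comp (measurable_fst.prodMk (measurable_snd.comp measurable_snd)))
  have h := measurePreserving_spaceEquiv.lintegral_comp_emb spaceEquiv.measurableEmbedding
    (fun p : ℝ × (ℝ × ℝ) => W p.1 * (B p.1 p.2.1 * B p.1 p.2.2))
  refine h.trans ?_
  have hm2 : Measurable fun p : ℝ × (ℝ × ℝ) => W p.1 * (B p.1 p.2.1 * B p.1 p.2.2) :=
    (hW.comp measurable_fst).mul hm
  rw [Measure.volume_eq_prod, lintegral_prod _ hm2.aemeasurable]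
  refine lintegral_congr fun t => ?_
  have hmt : Measurable (B t) := hB.comp (measurable_const.prodMk measurable_id)
  have hmt2 : Measurable fun p : ℝ × ℝ => B t p.1 * B t p.2 :=
    (hmt.comp measurable_fst).mul (hmt.comp measurable_snd)
  change ∫⁻ p : ℝ × ℝ, W t * (B t p.1 * B t p.2) = _
  rw [lintegral_const_mul _ hmt2, Measure.volume_eq_prod,
    lintegral_prod_mul hmt.aemeasurable hmt.aemeasurable, sq]

/-- By Tonelli the integral is at most that of W(t) times the square of a one-dimensional integral.
The part 1/R of the uniform bound is integrated against the weight, of mass comparable to R; the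
other part is integrable on its own. The factor (s/n)² is what parabolic rescaling of the corner
consumes. -/
theorem lintegral_squareFunction_le {E δ : ℝ} (hE : 1 < E) (hδ : 0 < δ) :
    ∃ C : ℝ, 0 < C ∧ ∀ (n s : ℕ), 0 < n → s ≤ n → ∀ a : Fin n × Fin n → ℂ, (∀ q, ‖a q‖ ≤ 1) →
      (∀ q, a q ≠ 0 → (q.1 : ℕ) < s ∧ (q.2 : ℕ) < s) → ∀ c : EuclideanSpace ℝ (Fin 3),
      ∫⁻ x, ENNReal.ofReal (∑ q, ‖a q * cellWave n q x‖ ^ 2) ^ (3 / 2 : ℝ)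
        ∂ballWeight E c ((n : ℝ) ^ 2) ≤
      ENNReal.ofReal (C * ((n : ℝ) ^ 2) ^ δ) * ENNReal.ofReal (s / n) ^ 2 := by
  have hJ : ∀ r : ℝ, 1 < r → ∫⁻ t : ℝ, ENNReal.ofReal ((1 + |t|) ^ (-r)) ≠ ∞ := by
    intro r hr
    have := finite_integral_one_add_norm (E := ℝ) (μ := volume) (r := r) (by simpa using hr)
    exact this.ne
  set J₁ := (∫⁻ t : ℝ, ENNReal.ofReal ((1 + |t|) ^ (-E))).toReal with hJ₁
  set J₂ := (∫⁻ t : ℝ, ENNReal.ofReal ((1 + |t|) ^ (-(1 + δ)))).toReal with hJ₂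
  have hJ₁0 : 0 ≤ J₁ := ENNReal.toReal_nonneg
  have hJ₂0 : 0 ≤ J₂ := ENNReal.toReal_nonneg
  -- The first two terms are the vertical integrals of the two parts of the uniform bound; the 1
  -- only ensures positivity.
  refine ⟨64 * (2 * J₁ + 2 ^ δ * J₂) + 1, by positivity, ?_⟩
  intro n s hn hs a ha hsupp c
  have hn' : (1 : ℝ) ≤ n := by exact_mod_cast hn
  set R : ℝ := (n : ℝ) ^ 2 with hR
  have hR1 : 1 ≤ R := one_le_pow₀ hn'
  have hR0 : 0 < R := by linarith
  set B : ℝ → ℝ → ℝ≥0∞ := fun t u => ENNReal.ofReal (waveSquare (1 / n) s u t) ^ (3 / 2 : ℝ) with hB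
  set W : ℝ → ℝ≥0∞ := fun t => ENNReal.ofReal ((1 + |t - c 2| / R) ^ (-E)) with hW
  have hBm : Measurable (fun p : ℝ × ℝ => B p.1 p.2) := measurable_waveSquare_rpow (1 / n) s
  have hWm : Measurable W := by simp only [hW]; fun_prop
  have hVm : Measurable fun x => ENNReal.ofReal (∑ q, ‖a q * cellWave n q x‖ ^ 2) ^ (3 / 2 : ℝ) := by
    refine (Continuous.measurable ?_).ennreal_ofReal.pow_const _
    exact continuous_finsetSum _ fun q _ =>
      (continuous_const.mul (continuous_cellWave n q)).norm.pow 2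
  calc _ ≤ _ := lintegral_ballWeight_le E (by linarith) c hR0 _ hVm
    _ ≤ ∫⁻ x : EuclideanSpace ℝ (Fin 3), W (x 2) * (B (x 2) (x 0) * B (x 2) (x 1)) := by
        refine lintegral_mono fun x => ?_
        rw [mul_comm]
        gcongr
        rw [hB]
        simp only
        rw [← ENNReal.mul_rpow_of_nonneg _ _ (by norm_num),
          ← ENNReal.ofReal_mul (waveSquare_nonneg _ _ _ _)]
        gcongr
        exact sum_norm_cellWave_sq_le ha hsupp x
    _ = ∫⁻ t, W t * (∫⁻ u, B t u) ^ 2 := lintegral_mul_mul_space hWm hBm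
    _ ≤ ∫⁻ t, (ENNReal.ofReal (64 * (2 / R)) * W t + ENNReal.ofReal (64 * (2 * R) ^ δ) *
          ENNReal.ofReal ((1 + |t|) ^ (-(1 + δ)))) * ENNReal.ofReal (s / n) ^ 2 := by
        refine lintegral_mono fun t => ?_
        have hW1 : W t ≤ 1 := by
          rw [hW]
          refine ENNReal.ofReal_le_one.2 (Real.rpow_le_one_of_one_le_of_nonpos ?_ (by linarith))
          have : 0 ≤ |t - c 2| / R := by positivity
          linarith
        refine (mul_le_mul_right (lintegral_waveSquare_rpow_le hn hs hδ t) (W t)).trans ?_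
        rw [← mul_assoc]
        gcongr
        rw [mul_add, ENNReal.ofReal_add (by positivity) (by positivity), mul_add, ← mul_assoc 64,
          ENNReal.ofReal_mul (p := 64 * (2 * R) ^ δ) (by positivity)]
        exact add_le_add (mul_comm _ _).le (mul_le_of_le_one_left bot_le hW1)
    _ = (ENNReal.ofReal (64 * (2 / R)) * (∫⁻ t, W t) + ENNReal.ofReal (64 * (2 * R) ^ δ) *
          ∫⁻ t : ℝ, ENNReal.ofReal ((1 + |t|) ^ (-(1 + δ)))) * ENNReal.ofReal (s / n) ^ 2 := by
        rw [lintegral_mul_const' _ _ (by finiteness), lintegral_add_left (hWm.const_mul _),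
          lintegral_const_mul' _ _ ENNReal.ofReal_ne_top,
          lintegral_const_mul' _ _ ENNReal.ofReal_ne_top]
    _ ≤ _ := by
        gcongr
        rw [hW, lintegral_one_add_div_rpow E _ hR0, ← ENNReal.ofReal_toReal (hJ E hE), ← hJ₁,
          ← ENNReal.ofReal_toReal (hJ (1 + δ) (by linarith)), ← hJ₂,
          ← ENNReal.ofReal_mul hR0.le, ← ENNReal.ofReal_mul (by positivity),
          ← ENNReal.ofReal_mul (by positivity), ← ENNReal.ofReal_add (by positivity)
          (by positivity)]
        apply ENNReal.ofReal_le_ofReal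
        rw [Real.mul_rpow (by norm_num) hR0.le]
        have hRδ : 1 ≤ R ^ δ := Real.one_le_rpow hR1 hδ.le
        have e1 : 64 * (2 / R) * (R * J₁) = 128 * J₁ := by field_simp; ring
        rw [e1]
        nlinarith [mul_le_mul_of_nonneg_left hRδ hJ₁0]

/-! ### Moments of sums over random transversals -/

section Moments

variable {κ : Type*} [Fintype κ]

lemma sum_inner_eq_zero {X : κ → ℂ} (hX : ∑ l, X l = 0) (y : ℂ) : ∑ l, inner ℝ y (X l) = 0 := by
  rw [← inner_sum, hX, inner_zero_right]

lemma sum_norm_add_sq_le {X : κ → ℂ} (hX : ∑ l, X l = 0) {V : ℝ} (hV : ∀ l, ‖X l‖ ^ 2 ≤ V)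
    (y : ℂ) : ∑ l, ‖y + X l‖ ^ 2 ≤ Fintype.card κ * (‖y‖ ^ 2 + V) := by
  have h1 : ∀ l, ‖y + X l‖ ^ 2 ≤ (‖y‖ ^ 2 + V) + 2 * inner ℝ y (X l) := fun l => by
    rw [norm_add_sq_real]; linarith [hV l]
  calc _ ≤ ∑ l, ((‖y‖ ^ 2 + V) + 2 * inner ℝ y (X l)) := Finset.sum_le_sum fun l _ => h1 l
    _ = _ := by
      rw [Finset.sum_add_distrib, ← Finset.mul_sum, sum_inner_eq_zero hX]
      simp
      ring

/-- Expand the square of |y|² + 2⟨y, X⟩ + |X|². The term 4|y|²⟨y, X⟩ has mean zero; the other mixed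
terms are handled by Cauchy-Schwarz and 4⟨y, X⟩|X|² ≤ 2⟨y, X⟩² + 2|X|⁴. -/
lemma sum_norm_add_pow_four_le {X : κ → ℂ} (hX : ∑ l, X l = 0) {V : ℝ}
    (hV : ∀ l, ‖X l‖ ^ 2 ≤ V) (y : ℂ) :
    ∑ l, ‖y + X l‖ ^ 4 ≤ Fintype.card κ * (‖y‖ ^ 4 + 8 * ‖y‖ ^ 2 * V + 3 * V ^ 2) := by
  have h1 : ∀ l, ‖y + X l‖ ^ 4 ≤ (‖y‖ ^ 4 + 8 * ‖y‖ ^ 2 * V + 3 * V ^ 2) +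
      4 * ‖y‖ ^ 2 * inner ℝ y (X l) := fun l => by
    have e : ‖y + X l‖ ^ 4 = (‖y + X l‖ ^ 2) ^ 2 := by ring
    have hI := abs_real_inner_le_norm y (X l)
    rw [e, norm_add_sq_real]
    have hI2 : (inner ℝ y (X l)) ^ 2 ≤ ‖y‖ ^ 2 * ‖X l‖ ^ 2 := by
      rw [← mul_pow, ← sq_abs]; exact pow_le_pow_left₀ (abs_nonneg _) hI 2
    have hB0 : 0 ≤ ‖X l‖ ^ 2 := by positivity
    have hA0 : 0 ≤ ‖y‖ ^ 2 := by positivity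
    have e4 : ‖y‖ ^ 4 = (‖y‖ ^ 2) ^ 2 := by ring
    rw [e4]
    have hb := hV l
    generalize inner ℝ y (X l) = I at *
    generalize ‖X l‖ ^ 2 = B at *
    generalize ‖y‖ ^ 2 = A at *
    have h3 : A * B ≤ A * V := mul_le_mul_of_nonneg_left hb hA0
    have h4 : B ^ 2 ≤ V ^ 2 := pow_le_pow_left₀ hB0 hb 2
    nlinarith [sq_nonneg (I - B)]
  calc _ ≤ ∑ l, ((‖y‖ ^ 4 + 8 * ‖y‖ ^ 2 * V + 3 * V ^ 2) + 4 * ‖y‖ ^ 2 * inner ℝ y (X l)) :=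
        Finset.sum_le_sum fun l _ => h1 l
    _ = _ := by
      rw [Finset.sum_add_distrib, ← Finset.mul_sum, sum_inner_eq_zero hX]
      simp
      ring

/-- Separates the first independent choice, which is the induction step of the moment bounds. -/
lemma sum_pi_succ (m : ℕ) (f : Fin (m + 1) → κ → ℂ) (Φ : ℂ → ℝ) :
    ∑ t : Fin (m + 1) → κ, Φ (∑ j, f j (t j)) =
      ∑ t : Fin m → κ, ∑ l, Φ (∑ j, f j.succ (t j) + f 0 l) := by
  rw [← (Fin.consEquiv fun _ => κ).sum_comp, Fintype.sum_prod_type, Finset.sum_comm]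
  refine Finset.sum_congr rfl fun t _ => Finset.sum_congr rfl fun l _ => ?_
  rw [Fin.sum_univ_succ, add_comm]
  simp [Fin.consEquiv]

lemma sum_pi_norm_sq_le (m : ℕ) (f : Fin m → κ → ℂ) (hf : ∀ j, ∑ l, f j l = 0) (V : Fin m → ℝ)
    (hV : ∀ j l, ‖f j l‖ ^ 2 ≤ V j) :
    ∑ t : Fin m → κ, ‖∑ j, f j (t j)‖ ^ 2 ≤ (Fintype.card κ : ℝ) ^ m * ∑ j, V j := by
  induction m with
  | zero => simp
  | succ m ih =>
    rw [sum_pi_succ m f (fun z => ‖z‖ ^ 2)]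
    have := ih (fun j => f j.succ) (fun j => hf _) (fun j => V j.succ) fun j l => hV _ l
    calc _ ≤ ∑ t : Fin m → κ, (Fintype.card κ : ℝ) * (‖∑ j, f j.succ (t j)‖ ^ 2 + V 0) :=
          Finset.sum_le_sum fun t _ => sum_norm_add_sq_le (hf 0) (hV 0) _
      _ = Fintype.card κ * (∑ t : Fin m → κ, ‖∑ j, f j.succ (t j)‖ ^ 2) +
          (Fintype.card κ : ℝ) ^ (m + 1) * V 0 := by
        rw [← Finset.mul_sum, Finset.sum_add_distrib]
        simp
        ring
      _ ≤ Fintype.card κ * ((Fintype.card κ : ℝ) ^ m * ∑ j : Fin m, V j.succ) +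
          (Fintype.card κ : ℝ) ^ (m + 1) * V 0 := by gcongr
      _ = _ := by rw [Fin.sum_univ_succ]; ring

/-- Adding one independent centred term changes 4S² into at most 4S² + 8SV + 3V² ≤ 4(S + V)², which
is why the constant 4 survives the induction. -/
lemma sum_pi_norm_pow_four_le (m : ℕ) (f : Fin m → κ → ℂ) (hf : ∀ j, ∑ l, f j l = 0)
    (V : Fin m → ℝ) (hV0 : ∀ j, 0 ≤ V j) (hV : ∀ j l, ‖f j l‖ ^ 2 ≤ V j) :
    ∑ t : Fin m → κ, ‖∑ j, f j (t j)‖ ^ 4 ≤ 4 * (Fintype.card κ : ℝ) ^ m * (∑ j, V j) ^ 2 := by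
  induction m with
  | zero => simp
  | succ m ih =>
    rw [sum_pi_succ m f (fun z => ‖z‖ ^ 4)]
    have h4 := ih (fun j => f j.succ) (fun j => hf _) (fun j => V j.succ) (fun j => hV0 _)
      fun j l => hV _ l
    have h2 := sum_pi_norm_sq_le m (fun j => f j.succ) (fun j => hf _) (fun j => V j.succ)
      fun j l => hV _ l
    have hV0' := hV0 0
    calc _ ≤ ∑ t : Fin m → κ, (Fintype.card κ : ℝ) * (‖∑ j, f j.succ (t j)‖ ^ 4 +
            8 * ‖∑ j, f j.succ (t j)‖ ^ 2 * V 0 + 3 * V 0 ^ 2) :=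
          Finset.sum_le_sum fun t _ => sum_norm_add_pow_four_le (hf 0) (hV 0) _
      _ = Fintype.card κ * (∑ t : Fin m → κ, ‖∑ j, f j.succ (t j)‖ ^ 4 +
          8 * V 0 * (∑ t : Fin m → κ, ‖∑ j, f j.succ (t j)‖ ^ 2) +
            3 * (Fintype.card κ : ℝ) ^ m * V 0 ^ 2) := by
        rw [← Finset.mul_sum, Finset.sum_add_distrib, Finset.sum_add_distrib, Finset.mul_sum]
        simp only [Finset.sum_const, Finset.card_univ, Fintype.card_pi_const, nsmul_eq_mul,
          Nat.cast_pow]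
        congr 2
        · congr 1
          exact Finset.sum_congr rfl fun t _ => by ring
        · ring
      _ ≤ Fintype.card κ * (4 * (Fintype.card κ : ℝ) ^ m * (∑ j : Fin m, V j.succ) ^ 2 +
          8 * V 0 * ((Fintype.card κ : ℝ) ^ m * ∑ j : Fin m, V j.succ) +
            3 * (Fintype.card κ : ℝ) ^ m * V 0 ^ 2) := by gcongr
      _ ≤ _ := by
        rw [Fin.sum_univ_succ]
        have : 0 ≤ (Fintype.card κ : ℝ) ^ (m + 1) * V 0 ^ 2 := by positivity
        linear_combination this

lemma sum_pi_norm_cube_le (m : ℕ) (f : Fin m → κ → ℂ) (hf : ∀ j, ∑ l, f j l = 0)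
    (V : Fin m → ℝ) (hV0 : ∀ j, 0 ≤ V j) (hV : ∀ j l, ‖f j l‖ ^ 2 ≤ V j) :
    ∑ t : Fin m → κ, ‖∑ j, f j (t j)‖ ^ 3 ≤
      5 / 2 * (Fintype.card κ : ℝ) ^ m * Real.sqrt (∑ j, V j) ^ 3 := by
  have h4 := sum_pi_norm_pow_four_le m f hf V hV0 hV
  have h2 := sum_pi_norm_sq_le m f hf V hV
  set Y : (Fin m → κ) → ℝ := fun t => ‖∑ j, f j (t j)‖ with hY
  have hY0 : ∀ t, 0 ≤ Y t := fun t => norm_nonneg _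
  change ∑ t, Y t ^ 4 ≤ _ at h4
  change ∑ t, Y t ^ 2 ≤ _ at h2
  change ∑ t, Y t ^ 3 ≤ _
  have hS0 : 0 ≤ ∑ j, V j := Finset.sum_nonneg fun j _ => hV0 j
  set v := Real.sqrt (∑ j, V j) with hv
  have hv2 : ∑ j, V j = v ^ 2 := (Real.sq_sqrt hS0).symm
  rw [hv2] at h2 h4
  rcases (Real.sqrt_nonneg (∑ j, V j)).eq_or_lt with h0 | h0
  · rw [← hv] at h0
    rw [← h0] at h2 ⊢
    have h3 : ∀ t, Y t ^ 2 = 0 := by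
      have h5 := le_antisymm (h2.trans (by simp)) (Finset.sum_nonneg fun t _ => sq_nonneg (Y t))
      intro t
      exact (Finset.sum_eq_zero_iff_of_nonneg fun t _ => sq_nonneg (Y t)).1 h5 t (Finset.mem_univ t)
    have h6 : ∀ t, Y t ^ 3 = 0 := fun t => by
      have := pow_eq_zero_iff (two_ne_zero) |>.1 (h3 t)
      rw [this]; norm_num
    simp [h6]
  · rw [← hv] at h0
    -- The third moment lies between the second and the fourth: 2vY³ ≤ Y⁴ + v²Y². The two moment
    -- bounds then give (4 + 1)/2 as constant.
    have key : (2 * v) * ∑ t, Y t ^ 3 ≤ ∑ t, Y t ^ 4 + v ^ 2 * ∑ t, Y t ^ 2 := by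
      rw [Finset.mul_sum, Finset.mul_sum, ← Finset.sum_add_distrib]
      refine Finset.sum_le_sum fun t _ => ?_
      nlinarith [mul_nonneg (sq_nonneg (Y t)) (sq_nonneg (Y t - v))]
    have h6 : v ^ 2 * ∑ t, Y t ^ 2 ≤ v ^ 2 * ((Fintype.card κ : ℝ) ^ m * v ^ 2) := by gcongr
    refine le_of_mul_le_mul_left ?_ (show 0 < 2 * v by positivity)
    refine (key.trans (add_le_add h4 h6)).trans (le_of_eq ?_)
    ring

/-- Third moment of the deviation from its mean of a sum over a random transversal. -/
lemma sum_pi_norm_transversal_sub_mean_cube_le [AddGroup κ] (m : ℕ) (b : Fin m → κ → ℂ) (i : κ) :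
    ∑ t : Fin m → κ, ‖∑ j, b j (i + t j) - (Fintype.card κ : ℂ)⁻¹ * ∑ j, ∑ l, b j l‖ ^ 3 ≤
      20 * (Fintype.card κ : ℝ) ^ m * Real.sqrt (∑ j, ∑ l, ‖b j l‖ ^ 2) ^ 3 := by
  have hK : (0 : ℝ) < Fintype.card κ := by
    have : Nonempty κ := ⟨0⟩
    exact_mod_cast Fintype.card_pos
  have hKC : (Fintype.card κ : ℂ) ≠ 0 := by exact_mod_cast hK.ne'
  set f : Fin m → κ → ℂ := fun j l => b j (i + l) - (Fintype.card κ : ℂ)⁻¹ * ∑ l', b j l' with hf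
  have hf0 : ∀ j, ∑ l, f j l = 0 := by
    intro j
    simp only [hf]
    have e : ∑ l, b j (i + l) = ∑ l, b j l := Equiv.sum_comp (Equiv.addLeft i) (b j)
    rw [Finset.sum_sub_distrib, e]
    simp only [Finset.sum_const, Finset.card_univ, nsmul_eq_mul]
    rw [mul_inv_cancel_left₀ hKC, sub_self]
  -- Bounding one entry by the ℓ² norm of its column is crude by a power of the number of pieces,
  -- but it turns the variance into the full square function.
  have hb : ∀ j l, ‖b j l‖ ≤ Real.sqrt (∑ l', ‖b j l'‖ ^ 2) := by
    intro j l
    apply Real.le_sqrt_of_sq_le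
    exact Finset.single_le_sum (f := fun l' => ‖b j l'‖ ^ 2) (fun _ _ => by positivity)
      (Finset.mem_univ l)
  have hV : ∀ j l, ‖f j l‖ ^ 2 ≤ 4 * ∑ l', ‖b j l'‖ ^ 2 := by
    intro j l
    have h1 : ‖(Fintype.card κ : ℂ)⁻¹ * ∑ l', b j l'‖ ≤ Real.sqrt (∑ l', ‖b j l'‖ ^ 2) := by
      rw [norm_mul, norm_inv, Complex.norm_natCast, inv_mul_le_iff₀ hK]
      refine (norm_sum_le _ _).trans ((Finset.sum_le_sum fun l' _ => hb j l').trans ?_)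
      simp
    have h2 : ‖f j l‖ ≤ 2 * Real.sqrt (∑ l', ‖b j l'‖ ^ 2) :=
      (norm_sub_le _ _).trans (by linarith [hb j (i + l)])
    have h3 := pow_le_pow_left₀ (norm_nonneg _) h2 2
    rw [mul_pow, Real.sq_sqrt (Finset.sum_nonneg fun _ _ => by positivity)] at h3
    linarith
  have h := sum_pi_norm_cube_le m f hf0 (fun j => 4 * ∑ l', ‖b j l'‖ ^ 2)
    (fun j => mul_nonneg (by norm_num) (Finset.sum_nonneg fun _ _ => by positivity)) hV
  rw [← Finset.mul_sum, Real.sqrt_mul (by norm_num),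
    show Real.sqrt 4 = 2 by rw [show (4 : ℝ) = 2 ^ 2 by norm_num]; simp] at h
  refine le_trans (le_of_eq ?_) (h.trans (le_of_eq (by ring)))
  refine Finset.sum_congr rfl fun t _ => ?_
  simp only [hf]
  rw [Finset.sum_sub_distrib, ← Finset.mul_sum]

end Moments

/-! ### Smooth weights against balls -/

lemma lintegral_one_add_dist_div_rpow (E : ℝ) (c : EuclideanSpace ℝ (Fin 3)) {R : ℝ} (hR : 0 < R) :
    ∫⁻ x, ENNReal.ofReal ((1 + dist x c / R) ^ (-E)) =
      ENNReal.ofReal (R ^ 3) *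
        ∫⁻ x : EuclideanSpace ℝ (Fin 3), ENNReal.ofReal ((1 + ‖x‖) ^ (-E)) := by
  have h1 : ∫⁻ x, ENNReal.ofReal ((1 + dist x c / R) ^ (-E)) =
      ∫⁻ x : EuclideanSpace ℝ (Fin 3), ENNReal.ofReal ((1 + ‖x‖ / R) ^ (-E)) := by
    rw [← lintegral_sub_right_eq_self
      (fun x : EuclideanSpace ℝ (Fin 3) => ENNReal.ofReal ((1 + ‖x‖ / R) ^ (-E))) c]
    simp_rw [dist_eq_norm]
  have h2 : ∫⁻ x : EuclideanSpace ℝ (Fin 3), ENNReal.ofReal ((1 + ‖x‖ / R) ^ (-E)) =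
      ∫⁻ x : EuclideanSpace ℝ (Fin 3), ENNReal.ofReal ((1 + ‖x‖) ^ (-E))
        ∂(volume.map (fun x : EuclideanSpace ℝ (Fin 3) => R⁻¹ • x)) := by
    rw [lintegral_map (by fun_prop) (by fun_prop)]
    refine lintegral_congr fun x => ?_
    rw [norm_smul, norm_inv, Real.norm_of_nonneg hR.le, div_eq_inv_mul]
  rw [h1, h2, Measure.map_addHaar_smul volume (inv_ne_zero hR.ne'), lintegral_smul_measure]
  simp only [finrank_euclideanSpace, Fintype.card_fin, smul_eq_mul]
  congr 2
  rw [inv_pow, inv_inv, abs_of_pos (by positivity)]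

/-- The weight is nearly constant at scale `R`, so it may be replaced by its values on the ball
around each point. Fubini then puts the integral of `f` over a ball inside. -/
lemma lintegral_mul_mul_le_of_ball {w f : EuclideanSpace ℝ (Fin 3) → ℝ≥0∞} (hwm : Measurable w)
    (hf : Measurable f) {R : ℝ} {A K V : ℝ≥0∞} (hA : A ≠ ∞) (hV : V ≠ ∞) (hwt : ∀ x, w x ≠ ∞)
    (hw : ∀ x y, dist y x ≤ R → w x ≤ A * w y)
    (hVB : ∀ c : EuclideanSpace ℝ (Fin 3), volume (Metric.closedBall c R) = V)
    (hK : ∀ c, ∫⁻ x in Metric.closedBall c R, f x ≤ K) :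
    (∫⁻ x, f x * w x) * V ≤ A * K * ∫⁻ x, w x := by
  obtain ⟨B, hB⟩ : ∃ B : EuclideanSpace ℝ (Fin 3) → EuclideanSpace ℝ (Fin 3) → ℝ≥0∞,
      ∀ x y, B x y = if dist y x ≤ R then 1 else 0 := ⟨_, fun _ _ => rfl⟩
  have hBm : Measurable (fun p : EuclideanSpace ℝ (Fin 3) × EuclideanSpace ℝ (Fin 3) =>
      B p.1 p.2) := by
    simp_rw [hB]
    exact Measurable.ite (measurableSet_le (by fun_prop) measurable_const) measurable_const
      measurable_const
  have hBf : ∀ (g : EuclideanSpace ℝ (Fin 3) → ℝ≥0∞) (c),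
      ∫⁻ x, B c x * g x = ∫⁻ x in Metric.closedBall c R, g x := by
    intro g c
    rw [← lintegral_indicator Metric.isClosed_closedBall.measurableSet]
    refine lintegral_congr fun x => ?_
    by_cases h : dist x c ≤ R
    · rw [hB, if_pos h, one_mul, Set.indicator_of_mem (Metric.mem_closedBall.2 h)]
    · rw [hB, if_neg h, zero_mul, Set.indicator_of_notMem (fun h' => h (Metric.mem_closedBall.1 h'))]
  have hBint : ∀ x, ∫⁻ y, B x y = V := by
    intro x
    have := hBf (fun _ => 1) x
    simp only [mul_one] at this
    rw [this]
    simpa using hVB x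
  calc _ = ∫⁻ x, f x * w x * ∫⁻ y, B x y := by
        simp_rw [hBint]
        rw [lintegral_mul_const' _ _ hV]
    _ = ∫⁻ x, ∫⁻ y, f x * w x * B x y := by
        refine lintegral_congr fun x => ?_
        rw [lintegral_const_mul]
        exact hBm.comp (measurable_const.prodMk measurable_id)
    _ ≤ ∫⁻ x, ∫⁻ y, A * w y * (B y x * f x) := by
        refine lintegral_mono fun x => lintegral_mono fun y => ?_
        by_cases h : dist y x ≤ R
        · simp only [hB, dist_comm x y, if_pos h]
          rw [mul_one, one_mul, mul_comm]
          exact mul_le_mul_left (hw x y h) _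
        · simp only [hB, if_neg h, mul_zero]
          exact bot_le
    _ = ∫⁻ y, ∫⁻ x, A * w y * (B y x * f x) := by
        apply lintegral_lintegral_swap
        have h1 : Measurable fun p : EuclideanSpace ℝ (Fin 3) × EuclideanSpace ℝ (Fin 3) =>
            A * w p.2 * (B p.2 p.1 * f p.1) :=
          ((hwm.comp measurable_snd).const_mul _).mul
            ((hBm.comp (measurable_snd.prodMk measurable_fst)).mul (hf.comp measurable_fst))
        exact h1.aemeasurable
    _ = ∫⁻ y, A * w y * ∫⁻ x, B y x * f x := by
        refine lintegral_congr fun y => ?_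
        rw [lintegral_const_mul' _ _ (ENNReal.mul_ne_top hA (hwt y))]
    _ ≤ ∫⁻ y, A * K * w y := by
        refine lintegral_mono fun y => ?_
        rw [hBf, mul_right_comm]
        gcongr
        exact hK y
    _ = _ := by rw [lintegral_const_mul _ hwm]

/-- Integrals against the smooth weight are controlled by integrals over balls. -/
lemma exists_lintegral_ballWeight_le {E : ℝ} (hE : 3 < E) :
    ∃ C : ℝ, 0 < C ∧ ∀ (R : ℝ), 0 < R → ∀ (f : EuclideanSpace ℝ (Fin 3) → ℝ≥0∞), Measurable f →
      ∀ K : ℝ≥0∞, (∀ c, ∫⁻ x in Metric.closedBall c R, f x ≤ K) →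
      ∀ c, ∫⁻ x, f x ∂ballWeight E c R ≤ ENNReal.ofReal C * K := by
  have hJ : ∫⁻ x : EuclideanSpace ℝ (Fin 3), ENNReal.ofReal ((1 + ‖x‖) ^ (-E)) ≠ ∞ :=
    (finite_integral_one_add_norm (by simpa using hE)).ne
  set J := (∫⁻ x : EuclideanSpace ℝ (Fin 3), ENNReal.ofReal ((1 + ‖x‖) ^ (-E))).toReal with hJd
  have hJ0 : 0 ≤ J := ENNReal.toReal_nonneg
  set v := volume (Metric.ball (0 : EuclideanSpace ℝ (Fin 3)) 1) with hv
  have hv0 : v ≠ 0 := (Metric.measure_ball_pos volume _ one_pos).ne'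
  have hvt : v ≠ ∞ := measure_ball_lt_top.ne
  have hvr : 0 < v.toReal := ENNReal.toReal_pos hv0 hvt
  refine ⟨2 ^ E * J / v.toReal + 1, by positivity, ?_⟩
  intro R hR f hf K hK c
  set w : EuclideanSpace ℝ (Fin 3) → ℝ≥0∞ :=
    fun x => ENNReal.ofReal ((1 + dist x c / R) ^ (-E)) with hw
  have hwm : Measurable w := by simp only [hw]; fun_prop
  have hw2 : ∀ x y, dist y x ≤ R → w x ≤ ENNReal.ofReal (2 ^ E) * w y := by
    intro x y hxy
    rw [hw, ← ENNReal.ofReal_mul (by positivity)]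
    apply ENNReal.ofReal_le_ofReal
    have hx : 0 < 1 + dist x c / R := by positivity
    have hy : 0 < 1 + dist y c / R := by positivity
    have h1 : (1 + dist y c / R) ≤ 2 * (1 + dist x c / R) := by
      have h2 : dist y c / R ≤ (R + dist x c) / R := by
        gcongr; linarith [dist_triangle y x c]
      rw [add_div, div_self hR.ne'] at h2
      have : 0 ≤ dist x c / R := by positivity
      linarith
    have h3 : (2 * (1 + dist x c / R)) ^ (-E) ≤ (1 + dist y c / R) ^ (-E) :=
      Real.rpow_le_rpow_of_nonpos hy h1 (by linarith)
    rw [Real.mul_rpow (by norm_num) hx.le, Real.rpow_neg (by norm_num), inv_mul_le_iff₀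
      (by positivity)] at h3
    exact h3
  have key := lintegral_mul_mul_le_of_ball (V := ENNReal.ofReal (R ^ 3) * v) hwm hf
    ENNReal.ofReal_ne_top (by finiteness) (fun x => ENNReal.ofReal_ne_top) hw2
    (fun x => by simp [Measure.addHaar_closedBall _ _ hR.le, hv]) hK
  rw [hw, lintegral_one_add_dist_div_rpow E c hR, ← ENNReal.ofReal_toReal hJ, ← hJd, ← hw] at key
  have hR3 : ENNReal.ofReal (R ^ 3) ≠ 0 := by
    rw [Ne, ENNReal.ofReal_eq_zero, not_le]; positivity
  rw [ballWeight, lintegral_withDensity_eq_lintegral_mul _ (by fun_prop) hf]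
  have e : ∫⁻ x, ((fun x => ENNReal.ofReal ((1 + dist x c / R) ^ (-E))) * f) x =
      ∫⁻ x, f x * w x := lintegral_congr fun x => mul_comm _ _
  rw [e]
  have key2 : (∫⁻ x, f x * w x) * v ≤ ENNReal.ofReal (2 ^ E) * K * ENNReal.ofReal J := by
    rw [← ENNReal.mul_le_mul_iff_right hR3 ENNReal.ofReal_ne_top]
    calc _ = _ := by ring
      _ ≤ _ := key
      _ = _ := by ring
  calc _ ≤ ENNReal.ofReal (2 ^ E) * K * ENNReal.ofReal J / v :=
        (ENNReal.le_div_iff_mul_le (Or.inl hv0) (Or.inl hvt)).2 key2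
    _ = ENNReal.ofReal (2 ^ E * J / v.toReal) * K := by
        rw [ENNReal.ofReal_div_of_pos hvr, ENNReal.ofReal_toReal hvt,
          ENNReal.ofReal_mul (by positivity), ENNReal.div_eq_inv_mul, ENNReal.div_eq_inv_mul]
        ring
    _ ≤ _ := by
        gcongr
        linarith

/-! ### Random partitions of the squares -/

/-- The decoupling inequality with constant `Q` for the partitions of the canonical squares into
sets of `M` squares, the partition being given by the fibres of a labelling. -/
def FiberDecoupling (E : ℝ) (n M : ℕ) (Q : ℝ) : Prop :=
  ∀ (Y : Type) [Fintype Y] [DecidableEq Y] (L : Fin n × Fin n → Y),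
    (∀ y, (Finset.univ.filter fun q => L q = y).card = M) →
    ∀ (c : EuclideanSpace ℝ (Fin 3)) (F : EuclideanSpace ℝ (Fin 2) → ℂ),
      IntegrableOn F unitSquare →
      eLpNorm (extensionOp unitSquare F) 3
          (volume.restrict (Metric.closedBall c ((n : ℝ) ^ 2))) ≤
        ENNReal.ofReal Q * (∑ y, eLpNorm (extensionOp (ensemble n
          (Finset.univ.filter fun q => L q = y)) F) 3 (ballWeight E c ((n : ℝ) ^ 2)) ^ 2) ^
            (1 / 2 : ℝ)

/-- As M > 0, all fibres are nonempty, hence distinct: they form a genuine partition and the sum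
over its parts is the sum over labels. -/
lemma LargeEnsembleDecoupling.fiberDecoupling {β E : ℝ} (h : LargeEnsembleDecoupling 3 β E)
    {ε : ℝ} (hε : 0 < ε) :
    ∃ C : ℝ, ∀ (n M : ℕ), 1 ≤ n → ((n : ℝ) ^ 2) ^ β ≤ M → (M : ℝ) ≤ 2 * ((n : ℝ) ^ 2) ^ β →
      FiberDecoupling E n M (C * ((n : ℝ) ^ 2) ^ ε) := by
  obtain ⟨C, hC⟩ := h ε hε
  refine ⟨C, fun n M hn hM1 hM2 Y _ _ L hL c F hF => ?_⟩
  have hM : 0 < M := by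
    have : (0 : ℝ) < M := lt_of_lt_of_le (by positivity) hM1
    exact_mod_cast this
  have hne : ∀ y, (Finset.univ.filter fun q => L q = y).Nonempty := fun y => by
    rw [← Finset.card_pos, hL]; exact hM
  have hinj : Function.Injective fun y => Finset.univ.filter fun q => L q = y := by
    intro y y' hyy
    obtain ⟨q, hq⟩ := hne y
    have h1 := (Finset.mem_filter.1 hq).2
    simp only at hyy
    rw [hyy] at hq
    have h2 := (Finset.mem_filter.1 hq).2
    exact h1.symm.trans h2
  let P : Finpartition (Finset.univ : Finset (Fin n × Fin n)) :=
    Finpartition.ofExistsUnique (Finset.univ.image fun y => Finset.univ.filter fun q => L q = y)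
      (fun p _ => Finset.subset_univ p)
      (fun q _ => by
        refine ⟨Finset.univ.filter fun q' => L q' = L q, ?_, ?_⟩
        · simp
        · rintro S ⟨hS, hq⟩
          obtain ⟨y, -, rfl⟩ := Finset.mem_image.1 hS
          rw [(Finset.mem_filter.1 hq).2])
      (fun h => by
        obtain ⟨y, -, hy⟩ := Finset.mem_image.1 h
        exact (hne y).ne_empty hy)
  have := hC n hn _ rfl M hM1 hM2 P (fun S hS => by
    obtain ⟨y, -, rfl⟩ := Finset.mem_image.1 hS
    exact hL y) c F hF
  refine this.trans (le_of_eq ?_)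
  congr 2
  exact Finset.sum_image fun y _ y' _ hyy => hinj hyy

lemma eLpNorm_three_pow {α : Type*} [MeasurableSpace α] (f : α → ℂ) (μ : Measure α) :
    eLpNorm f 3 μ ^ 3 = ∫⁻ x, ‖f x‖ₑ ^ 3 ∂μ := by
  have := eLpNorm_nnreal_pow_eq_lintegral (f := f) (μ := μ) (p := 3) (by norm_num)
  simpa using this

/-- Arranges the cells in `M` rows, each with `N` corner cells and `N'` cells outside. A set taking
one cell from each row has the prescribed size `M`. -/
lemma exists_equiv_prod_sum {n s M N N' : ℕ} (hs : s ≤ n) (hsM : s ^ 2 = M * N)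
    (hnM : n ^ 2 = M * (N + N')) :
    ∃ e : Fin n × Fin n ≃ Fin M × (Fin N ⊕ Fin N'),
      ∀ j r, ¬ (((e.symm (j, Sum.inr r)).1 : ℕ) < s ∧ ((e.symm (j, Sum.inr r)).2 : ℕ) < s) := by
  classical
  let p : Fin n × Fin n → Prop := fun q => (q.1 : ℕ) < s ∧ (q.2 : ℕ) < s
  have hc1 : Fintype.card {q // p q} = s ^ 2 := by
    rw [Fintype.card_subtype]
    have : (Finset.univ.filter p) = (Finset.univ.filter fun i : Fin n => (i : ℕ) < s) ×ˢ
        (Finset.univ.filter fun i : Fin n => (i : ℕ) < s) := by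
      ext q; simp [p]
    rw [this, Finset.card_product, Fin.card_filter_val_lt, min_eq_right hs, sq]
  have hc2 : Fintype.card {q // ¬ p q} = M * N' := by
    rw [Fintype.card_subtype_compl, hc1, Fintype.card_prod, Fintype.card_fin, ← sq, hnM, hsM]
    rw [mul_add, Nat.add_sub_cancel_left]
  let e1 : {q // p q} ≃ Fin M × Fin N := Fintype.equivOfCardEq (by simp [hc1, hsM])
  let e2 : {q // ¬ p q} ≃ Fin M × Fin N' := Fintype.equivOfCardEq (by simp [hc2])
  let e : Fin n × Fin n ≃ Fin M × (Fin N ⊕ Fin N') :=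
    (Equiv.sumCompl p).symm.trans ((e1.sumCongr e2).trans (Equiv.prodSumDistrib _ _ _).symm)
  refine ⟨e, fun j r => ?_⟩
  have : e.symm (j, Sum.inr r) = (e2.symm (j, r)).1 := rfl
  rw [this]
  exact (e2.symm (j, r)).2

lemma sum_filter_snd_eq {Q Y α : Type*} [Fintype Q] [DecidableEq Y] [Fintype Y] [AddCommMonoid α]
    {M : ℕ} (e : Q ≃ Fin M × Y) (g : Q → α) (y : Y) :
    ∑ q ∈ Finset.univ.filter (fun q => (e q).2 = y), g q = ∑ j, g (e.symm (j, y)) := by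
  rw [Finset.sum_filter, ← e.symm.sum_comp, Fintype.sum_prod_type]
  simp

/-- A random partition into transversals has pieces whose extensions are close to the average. -/
lemma exists_transversal_partition {n M N N' : ℕ} (hN : 0 < N)
    (e : Fin n × Fin n ≃ Fin M × (Fin N ⊕ Fin N')) (a : Fin n × Fin n → ℂ)
    (ha : ∀ j r, a (e.symm (j, Sum.inr r)) = 0) (μ : Measure (EuclideanSpace ℝ (Fin 3))) :
    ∃ L : Fin n × Fin n → Fin N ⊕ Fin N',
      (∀ y, (Finset.univ.filter fun q => L q = y).card = M) ∧
      (∀ r x, ∑ q ∈ Finset.univ.filter (fun q => L q = Sum.inr r), a q * cellWave n q x = 0) ∧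
      ∀ i, ∫⁻ x, ‖∑ q ∈ Finset.univ.filter (fun q => L q = Sum.inl i), a q * cellWave n q x -
          (N : ℂ)⁻¹ * ∑ q, a q * cellWave n q x‖ₑ ^ 3 ∂μ ≤
        20 * N * ∫⁻ x, ENNReal.ofReal (∑ q, ‖a q * cellWave n q x‖ ^ 2) ^ (3 / 2 : ℝ) ∂μ := by
  have : NeZero N := ⟨hN.ne'⟩
  set b : EuclideanSpace ℝ (Fin 3) → Fin M → Fin N → ℂ := fun x j l =>
    a (e.symm (j, Sum.inl l)) * cellWave n (e.symm (j, Sum.inl l)) x with hb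
  have hbc : ∀ j l, Continuous fun x => b x j l := fun j l =>
    continuous_const.mul (continuous_cellWave n _)
  -- The randomness: the corner cells of row j are shifted cyclically by t j. Column i then takes
  -- the cell i + t j of row j, so the columns partition the cells for every t, while for fixed i
  -- the choices in distinct rows are independent.
  let et : (Fin M → Fin N) → (Fin n × Fin n ≃ Fin M × (Fin N ⊕ Fin N')) := fun t =>
    (((Equiv.refl (Fin M)).prodShear fun j =>
      (Equiv.addRight (t j)).sumCongr (Equiv.refl (Fin N'))).trans e.symm).symm
  have het1 : ∀ t j i, (et t).symm (j, Sum.inl i) = e.symm (j, Sum.inl (i + t j)) :=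
    fun t j i => rfl
  have het2 : ∀ t j r, (et t).symm (j, Sum.inr r) = e.symm (j, Sum.inr r) := fun t j r => rfl
  have hsum : ∀ (Φ : Fin n × Fin n → ℝ), (∀ j r, Φ (e.symm (j, Sum.inr r)) = 0) →
      ∑ q, Φ q = ∑ j, ∑ l, Φ (e.symm (j, Sum.inl l)) := by
    intro Φ hΦ
    rw [← e.symm.sum_comp, Fintype.sum_prod_type]
    simp [Fintype.sum_sum_type, hΦ]
  have hG : ∀ x, ∑ q, a q * cellWave n q x = ∑ j, ∑ l, b x j l := by
    intro x
    rw [← e.symm.sum_comp, Fintype.sum_prod_type]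
    simp [Fintype.sum_sum_type, ha, hb]
  have hV : ∀ x, ∑ q, ‖a q * cellWave n q x‖ ^ 2 = ∑ j, ∑ l, ‖b x j l‖ ^ 2 := fun x =>
    hsum _ fun j r => by simp [ha]
  set Sq := ∫⁻ x, ENNReal.ofReal (∑ q, ‖a q * cellWave n q x‖ ^ 2) ^ (3 / 2 : ℝ) ∂μ with hSq
  set Y : (Fin M → Fin N) → Fin N → EuclideanSpace ℝ (Fin 3) → ℂ := fun t i x =>
    ∑ j, b x j (i + t j) - (N : ℂ)⁻¹ * ∑ j, ∑ l, b x j l with hY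
  have hYc : ∀ t i, Continuous (Y t i) := by
    intro t i
    exact (continuous_finsetSum _ fun j _ => hbc _ _).sub
      (continuous_const.mul (continuous_finsetSum _ fun j _ => continuous_finsetSum _ fun l _ =>
        hbc _ _))
  have hmom : ∀ i, ∑ t, ∫⁻ x, ‖Y t i x‖ₑ ^ 3 ∂μ ≤ 20 * (N : ℝ≥0∞) ^ M * Sq := by
    intro i
    rw [← lintegral_finsetSum _ fun t _ => (hYc t i).measurable.enorm.pow_const 3, hSq,
      ← lintegral_const_mul' _ _ (by finiteness)]
    refine lintegral_mono fun x => ?_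
    have h1 := sum_pi_norm_transversal_sub_mean_cube_le M (b x) i
    rw [Fintype.card_fin] at h1
    have h2 : ∑ t, ‖Y t i x‖ₑ ^ 3 = ENNReal.ofReal (∑ t, ‖Y t i x‖ ^ 3) := by
      rw [ENNReal.ofReal_sum_of_nonneg fun _ _ => by positivity]
      refine Finset.sum_congr rfl fun t _ => ?_
      rw [ENNReal.ofReal_pow (norm_nonneg _), ofReal_norm]
    rw [h2, hV x]
    have hS0 : 0 ≤ ∑ j, ∑ l, ‖b x j l‖ ^ 2 :=
      Finset.sum_nonneg fun _ _ => Finset.sum_nonneg fun _ _ => by positivity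
    refine (ENNReal.ofReal_le_ofReal h1).trans (le_of_eq ?_)
    rw [ENNReal.ofReal_mul (by positivity), ENNReal.ofReal_mul (by norm_num),
      ENNReal.ofReal_pow (by positivity), ENNReal.ofReal_natCast,
      ENNReal.ofReal_rpow_of_nonneg hS0 (by norm_num)]
    congr 2
    · simp
    · rw [Real.sqrt_eq_rpow, ← Real.rpow_natCast, ← Real.rpow_mul hS0]; norm_num
  -- One t must serve all pieces at once, so the third moments are summed over i before averaging
  -- over the N^M shifts; this costs the factor N.
  have hex : ∃ t, ∑ i, ∫⁻ x, ‖Y t i x‖ₑ ^ 3 ∂μ ≤ 20 * N * Sq := by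
    by_contra hcon
    push Not at hcon
    have h1 := ENNReal.sum_lt_sum_of_nonempty (s := (Finset.univ : Finset (Fin M → Fin N)))
      Finset.univ_nonempty fun t _ => hcon t
    refine absurd h1 (not_lt.2 ?_)
    rw [Finset.sum_comm]
    refine (Finset.sum_le_sum fun i _ => hmom i).trans (le_of_eq ?_)
    simp
    ring
  obtain ⟨t, ht⟩ := hex
  refine ⟨fun q => (et t q).2, fun y => ?_, fun r x => ?_, fun i => ?_⟩
  · rw [Finset.card_eq_sum_ones, sum_filter_snd_eq (et t)]
    simp
  · rw [sum_filter_snd_eq (et t)]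
    simp [het2, ha]
  · refine le_trans (le_of_eq ?_) ((Finset.single_le_sum
      (f := fun i => ∫⁻ x, ‖Y t i x‖ₑ ^ 3 ∂μ) (fun _ _ => bot_le) (Finset.mem_univ i)).trans ht)
    refine lintegral_congr fun x => ?_
    rw [sum_filter_snd_eq (et t), hG x]
    simp only [het1, hY, hb]

/-! ### Absorbing the mean in the decoupling inequality -/

lemma ENNReal.add_sq_le_four_mul (a b : ℝ≥0∞) : (a + b) ^ 2 ≤ 4 * (a ^ 2 + b ^ 2) := by
  rcases le_total a b with h | h
  · calc (a + b) ^ 2 ≤ (b + b) ^ 2 := by gcongr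
      _ = 4 * b ^ 2 := by ring
      _ ≤ _ := by gcongr; exact le_add_self
  · calc (a + b) ^ 2 ≤ (a + a) ^ 2 := by gcongr
      _ = 4 * a ^ 2 := by ring
      _ ≤ _ := by gcongr; exact le_self_add

lemma ENNReal.le_of_pow_le_pow {a b : ℝ≥0∞} {k : ℕ} (hk : k ≠ 0) (h : a ^ k ≤ b ^ k) : a ≤ b :=
  le_of_not_gt fun hlt => absurd h (not_le.2 (ENNReal.pow_right_strictMono hk hlt))

lemma continuous_sum_cellWave (n : ℕ) (a : Fin n × Fin n → ℂ) (S : Finset (Fin n × Fin n)) :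
    Continuous fun x => ∑ q ∈ S, a q * cellWave n q x :=
  continuous_finsetSum _ fun q _ => continuous_const.mul (continuous_cellWave n q)

lemma exists_norm_sum_cellWave_le (n : ℕ) (a : Fin n × Fin n → ℂ) :
    ∃ B : ℝ, ∀ x, ‖∑ q, a q * cellWave n q x‖ ≤ B := by
  refine ⟨∑ q : Fin n × Fin n, ‖a q‖ * ((((q.1 : ℝ) + 1) / n - (q.1 : ℝ) / n) *
    (((q.2 : ℝ) + 1) / n - (q.2 : ℝ) / n)), fun x => (norm_sum_le _ _).trans ?_⟩
  refine Finset.sum_le_sum fun q _ => ?_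
  rw [norm_mul, cellWave, norm_mul]
  have h : ∀ j : Fin n, (j : ℝ) / n ≤ ((j : ℝ) + 1) / n := fun j => by gcongr; linarith
  gcongr
  · linarith [h q.1]
  · exact norm_wave_le (h q.1) _ _
  · exact norm_wave_le (h q.2) _ _

/-- Insert the random partition into decoupling: N pieces of norm at most κD/N + y contribute
Q²(4κ²D²/N + 4Ny²) to the square of the norm. The condition `A * Q ^ 2 ≤ N` makes the first term at
most D²/2. -/
theorem lintegral_extensionOp_stepFunction_le {E : ℝ} (hE : 3 < E) {δ : ℝ} (hδ : 0 < δ) :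
    ∃ A : ℝ, 0 < A ∧ ∀ (n s M N N' : ℕ) (Q : ℝ), 0 < n → s ≤ n → 0 < N → s ^ 2 = M * N →
      n ^ 2 = M * (N + N') → 0 ≤ Q → FiberDecoupling E n M Q → A * Q ^ 2 ≤ N →
      ∀ a : Fin n × Fin n → ℂ, (∀ q, ‖a q‖ ≤ 1) →
      (∀ q, a q ≠ 0 → (q.1 : ℕ) < s ∧ (q.2 : ℕ) < s) → ∀ c : EuclideanSpace ℝ (Fin 3),
      ∫⁻ x in Metric.closedBall c ((n : ℝ) ^ 2), ‖∑ q, a q * cellWave n q x‖ₑ ^ 3 ≤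
        ENNReal.ofReal (A * Q ^ 3 * (N : ℝ) ^ 4 * ((n : ℝ) ^ 2) ^ δ) *
          ENNReal.ofReal (s / n) ^ 2 := by
  obtain ⟨Cw, hCw0, hCw⟩ := exists_lintegral_ballWeight_le hE
  obtain ⟨Cs, hCs0, hCs⟩ := lintegral_squareFunction_le (E := E) (by linarith) hδ
  -- The first summand makes the mean absorbable; in the second, 540 = 27 · 20 combines the cube of
  -- 3 with the constant of the third moment.
  refine ⟨8 * (Cw + 1) ^ 2 + 540 * Cs, by positivity, ?_⟩
  intro n s M N N' Q hn hsn hN hsM hnM hQ hdec hQN a ha hsupp c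
  obtain ⟨e, he⟩ := exists_equiv_prod_sum hsn hsM hnM
  have hae : ∀ j r, a (e.symm (j, Sum.inr r)) = 0 := fun j r => by
    by_contra h
    exact he j r (hsupp _ h)
  have hn' : (0 : ℝ) < n := by exact_mod_cast hn
  set R : ℝ := (n : ℝ) ^ 2 with hR
  have hR0 : 0 < R := by positivity
  set G : EuclideanSpace ℝ (Fin 3) → ℂ := fun x => ∑ q, a q * cellWave n q x with hG
  have hGc : Continuous G := continuous_sum_cellWave n a _
  have hGE : extensionOp unitSquare (stepFunction n a) = G :=
    funext fun x => extensionOp_unitSquare_stepFunction n a x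
  -- The supremum over all centres is needed because the weighted norms on the right see every ball;
  -- its finiteness is what permits absorption.
  set D : ℝ≥0∞ := ⨆ c, eLpNorm G 3 (volume.restrict (Metric.closedBall c R)) with hD
  have hDt : D ≠ ∞ := by
    obtain ⟨B, hB⟩ := exists_norm_sum_cellWave_le n a
    have h1 : ∀ c, eLpNorm G 3 (volume.restrict (Metric.closedBall c R)) ≤
        volume (Metric.closedBall (0 : EuclideanSpace ℝ (Fin 3)) R) ^ ((3 : ℝ≥0∞).toReal)⁻¹ *
          ENNReal.ofReal B := by
      intro c
      refine (eLpNorm_le_of_ae_bound (Filter.Eventually.of_forall hB)).trans (le_of_eq ?_)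
      rw [Measure.restrict_apply_univ, Measure.addHaar_closedBall_center]
    refine ne_top_of_le_ne_top ?_ (iSup_le h1)
    refine ENNReal.mul_ne_top (ENNReal.rpow_ne_top_of_nonneg (by positivity) ?_)
      ENNReal.ofReal_ne_top
    exact measure_closedBall_lt_top.ne
  set κ := ENNReal.ofReal (Cw + 1) with hκ
  have hκ1 : 1 ≤ κ := ENNReal.one_le_ofReal.2 (by linarith)
  set ν := (N : ℝ≥0∞) with hν
  have hν1 : 1 ≤ ν := by rw [hν]; exact_mod_cast hN
  have hν0 : ν ≠ 0 := (zero_lt_one.trans_le hν1).ne'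
  have hνt : ν ≠ ∞ := ENNReal.natCast_ne_top N
  set θ := ENNReal.ofReal Q with hθ
  set S₀ := ENNReal.ofReal (Cs * R ^ δ) * ENNReal.ofReal (s / n) ^ 2 with hS₀
  set y : ℝ≥0∞ := (20 * ν * S₀) ^ (1 / 3 : ℝ) with hy
  have hy3 : y ^ 3 = 20 * ν * S₀ := by
    rw [hy, ← ENNReal.rpow_natCast, ← ENNReal.rpow_mul]; norm_num
  have hyt : y ≠ ∞ := ENNReal.rpow_ne_top_of_nonneg (by norm_num) (by finiteness)
  have hg : ∀ c, eLpNorm G 3 (ballWeight E c R) ≤ κ * D := by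
    intro c
    apply ENNReal.le_of_pow_le_pow (k := 3) (by norm_num)
    rw [eLpNorm_three_pow]
    have h1 := hCw R hR0 (fun x => ‖G x‖ₑ ^ 3) (hGc.measurable.enorm.pow_const 3) (D ^ 3)
      (fun c' => by
        rw [← eLpNorm_three_pow]
        gcongr
        exact le_iSup (fun c => eLpNorm G 3 (volume.restrict (Metric.closedBall c R))) c') c
    refine h1.trans ?_
    rw [mul_pow]
    gcongr
    calc ENNReal.ofReal Cw ≤ κ := ENNReal.ofReal_le_ofReal (by linarith)
      _ ≤ κ ^ 3 := le_self_pow hκ1 (by norm_num)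
  have hpiece : ∀ c, eLpNorm G 3 (volume.restrict (Metric.closedBall c R)) ^ 2 ≤
      θ ^ 2 * (4 * ν⁻¹ * (κ * D) ^ 2 + 4 * ν * y ^ 2) := by
    intro c
    -- The partition may depend on the ball, since only bounds uniform in the centre are kept.
    obtain ⟨L, hL1, hL2, hL3⟩ := exists_transversal_partition hN e a hae (ballWeight E c R)
    have h1 := hdec _ L hL1 c (stepFunction n a) (integrable_stepFunction n a).integrableOn
    rw [hGE, Fintype.sum_sum_type] at h1
    have hinr : ∀ r, eLpNorm (extensionOp (ensemble n (Finset.univ.filter fun q => L q = Sum.inr r))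
        (stepFunction n a)) 3 (ballWeight E c R) = 0 := by
      intro r
      have : extensionOp (ensemble n (Finset.univ.filter fun q => L q = Sum.inr r))
          (stepFunction n a) = fun _ => 0 := by
        ext x
        rw [extensionOp_ensemble_stepFunction, hL2]
      rw [this]
      exact eLpNorm_zero'
    have hinl : ∀ i, eLpNorm (extensionOp (ensemble n (Finset.univ.filter fun q => L q = Sum.inl i))
        (stepFunction n a)) 3 (ballWeight E c R) ≤ ν⁻¹ * (κ * D) + y := by
      intro i
      set Y : EuclideanSpace ℝ (Fin 3) → ℂ := fun x =>
        ∑ q ∈ Finset.univ.filter (fun q => L q = Sum.inl i), a q * cellWave n q x -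
          (N : ℂ)⁻¹ * G x with hY
      have hYc : Continuous Y := (continuous_sum_cellWave n a _).sub (continuous_const.mul hGc)
      have hsplit : extensionOp (ensemble n (Finset.univ.filter fun q => L q = Sum.inl i))
          (stepFunction n a) = (N : ℂ)⁻¹ • G + Y := by
        ext x
        rw [extensionOp_ensemble_stepFunction]
        simp [hY]
      have hYn : eLpNorm Y 3 (ballWeight E c R) ≤ y := by
        apply ENNReal.le_of_pow_le_pow (k := 3) (by norm_num)
        rw [eLpNorm_three_pow, hy3]
        refine (hL3 i).trans ?_
        gcongr
        exact hCs n s hn hsn a ha hsupp c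
      rw [hsplit]
      refine (eLpNorm_add_le (hGc.aestronglyMeasurable.const_smul _) hYc.aestronglyMeasurable
        (by norm_num)).trans ?_
      rw [eLpNorm_const_smul]
      have : ‖(N : ℂ)⁻¹‖ₑ = ν⁻¹ := by
        have hN0 : (N : ℂ) ≠ 0 := by exact_mod_cast hN.ne'
        rw [enorm_inv hN0, hν]
        congr 1
        rw [← ofReal_norm, Complex.norm_natCast, ENNReal.ofReal_natCast]
      rw [this]
      gcongr
      exact hg c
    simp only [← hR, hinr] at h1
    calc _ ≤ (θ * (∑ i : Fin N, (ν⁻¹ * (κ * D) + y) ^ 2) ^ (1 / 2 : ℝ)) ^ 2 := by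
          gcongr
          refine h1.trans ?_
          simp only [ne_eq, OfNat.ofNat_ne_zero, not_false_eq_true, zero_pow,
            Finset.sum_const_zero, add_zero]
          gcongr with i _
          exact hinl i
      _ = θ ^ 2 * (ν * (ν⁻¹ * (κ * D) + y) ^ 2) := by
          rw [mul_pow, ← ENNReal.rpow_natCast (_ ^ (1 / 2 : ℝ)), ← ENNReal.rpow_mul]
          simp [hν]
      _ ≤ θ ^ 2 * (ν * (4 * ((ν⁻¹ * (κ * D)) ^ 2 + y ^ 2))) := by
          gcongr
          exact ENNReal.add_sq_le_four_mul _ _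
      _ = θ ^ 2 * (4 * (ν * ν⁻¹) * ν⁻¹ * (κ * D) ^ 2 + 4 * ν * y ^ 2) := by ring
      _ = _ := by rw [ENNReal.mul_inv_cancel hν0 hνt, mul_one]
  have hsmall : θ ^ 2 * (4 * ν⁻¹ * (κ * D) ^ 2) ≤ D ^ 2 / 2 := by
    have h1 : 8 * θ ^ 2 * κ ^ 2 ≤ ν := by
      rw [hθ, hκ, hν, ← ENNReal.ofReal_pow hQ, ← ENNReal.ofReal_pow (by positivity),
        ← ENNReal.ofReal_natCast N, show (8 : ℝ≥0∞) = ENNReal.ofReal 8 by simp,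
        ← ENNReal.ofReal_mul (by norm_num), ← ENNReal.ofReal_mul (by positivity)]
      apply ENNReal.ofReal_le_ofReal
      nlinarith [mul_nonneg hCs0.le (sq_nonneg Q)]
    rw [ENNReal.le_div_iff_mul_le (Or.inl (by norm_num)) (Or.inl (by norm_num))]
    calc _ = (8 * θ ^ 2 * κ ^ 2) * ν⁻¹ * D ^ 2 := by ring
      _ ≤ ν * ν⁻¹ * D ^ 2 := by gcongr
      _ = _ := by rw [ENNReal.mul_inv_cancel hν0 hνt, one_mul]
  have hD2 : D ^ 2 ≤ D ^ 2 / 2 + 4 * θ ^ 2 * ν * y ^ 2 := by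
    have h1 : ∀ c, eLpNorm G 3 (volume.restrict (Metric.closedBall c R)) ^ 2 ≤
        D ^ 2 / 2 + 4 * θ ^ 2 * ν * y ^ 2 := by
      intro c
      refine (hpiece c).trans ?_
      rw [mul_add]
      refine add_le_add hsmall (le_of_eq (by ring))
    have h2 : ∀ T : ℝ≥0∞, (T ^ (1 / 2 : ℝ)) ^ 2 = T := fun T => by
      rw [← ENNReal.rpow_natCast, ← ENNReal.rpow_mul]; norm_num
    rw [← h2 (D ^ 2 / 2 + 4 * θ ^ 2 * ν * y ^ 2)]
    gcongr
    refine iSup_le fun c => ENNReal.le_of_pow_le_pow (k := 2) (by norm_num) ?_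
    rw [h2]
    exact h1 c
  have hD3 : D ≤ 3 * θ * ν * y := by
    apply ENNReal.le_of_pow_le_pow (k := 2) (by norm_num)
    have h1 : D ^ 2 / 2 ≤ 4 * θ ^ 2 * ν * y ^ 2 := by
      have h2 : D ^ 2 / 2 ≠ ∞ := by finiteness
      rw [← ENNReal.add_le_add_iff_left h2, ENNReal.add_halves]
      exact hD2
    calc D ^ 2 = D ^ 2 / 2 + D ^ 2 / 2 := (ENNReal.add_halves _).symm
      _ ≤ 4 * θ ^ 2 * ν * y ^ 2 + 4 * θ ^ 2 * ν * y ^ 2 := by gcongr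
      _ = 8 * θ ^ 2 * y ^ 2 * ν := by ring
      -- Rounded up to a perfect square so that the root can be taken.
      _ ≤ 9 * θ ^ 2 * y ^ 2 * ν ^ 2 := by
          gcongr
          · norm_num
          · exact le_self_pow hν1 (by norm_num)
      _ = _ := by ring
  calc _ = eLpNorm G 3 (volume.restrict (Metric.closedBall c R)) ^ 3 := (eLpNorm_three_pow _ _).symm
    _ ≤ D ^ 3 := by
        gcongr
        exact le_iSup (fun c => eLpNorm G 3 (volume.restrict (Metric.closedBall c R))) c
    _ ≤ (3 * θ * ν * y) ^ 3 := by gcongr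
    _ = 27 * θ ^ 3 * ν ^ 3 * y ^ 3 := by ring
    _ = (540 * θ ^ 3 * ν ^ 4 * ENNReal.ofReal (Cs * R ^ δ)) * ENNReal.ofReal (s / n) ^ 2 := by
        rw [hy3, hS₀]; ring
    _ ≤ _ := by
        gcongr
        rw [hθ, hν, ← ENNReal.ofReal_natCast N, show (540 : ℝ≥0∞) = ENNReal.ofReal 540 by simp,
          ← ENNReal.ofReal_pow hQ, ← ENNReal.ofReal_pow (by positivity),
          ← ENNReal.ofReal_mul (by norm_num), ← ENNReal.ofReal_mul (by positivity),
          ← ENNReal.ofReal_mul (by positivity)]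
        apply ENNReal.ofReal_le_ofReal
        have h1 : 0 ≤ 8 * (Cw + 1) ^ 2 * (Q ^ 3 * (N : ℝ) ^ 4 * R ^ δ) := by positivity
        nlinarith

/-! ### Parabolic rescaling of the corner -/

lemma wave_mul (l a b u t : ℝ) :
    wave (l * a) (l * b) u t = l * wave a b (l * u) (l ^ 2 * t) := by
  rw [wave, ← intervalIntegral.smul_integral_comp_mul_left, wave, Complex.real_smul]
  congr 1
  refine intervalIntegral.integral_congr fun η _ => ?_
  congr 1
  ring

/-- Coordinatewise dilation of space. -/
def dilate (d : Fin 3 → ℝ) (x : EuclideanSpace ℝ (Fin 3)) : EuclideanSpace ℝ (Fin 3) :=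
  WithLp.toLp 2 fun i => d i * x i

lemma dilate_apply (d : Fin 3 → ℝ) (x : EuclideanSpace ℝ (Fin 3)) (i : Fin 3) :
    dilate d x i = d i * x i := rfl

lemma lintegral_dilate {f : EuclideanSpace ℝ (Fin 3) → ℝ≥0∞} (hf : Measurable f) {d : Fin 3 → ℝ}
    (hd : ∏ i, d i ≠ 0) :
    ∫⁻ x, f x = ENNReal.ofReal |∏ i, d i| * ∫⁻ x, f (dilate d x) := by
  have hp := PiLp.volume_preserving_toLp (Fin 3)
  have hfm : Measurable fun y : Fin 3 → ℝ => f (WithLp.toLp 2 y) := hf.comp hp.measurable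
  have h1 : ∀ g : EuclideanSpace ℝ (Fin 3) → ℝ≥0∞,
      ∫⁻ x, g x = ∫⁻ y : Fin 3 → ℝ, g (WithLp.toLp 2 y) := fun g =>
    (hp.lintegral_comp_emb (MeasurableEquiv.toLp 2 (Fin 3 → ℝ)).measurableEmbedding g).symm
  rw [h1, h1]
  conv_lhs => rw [← Real.smul_map_diagonal_volume_pi (D := d) (by rwa [Matrix.det_diagonal])]
  rw [lintegral_smul_measure, lintegral_map hfm (LinearMap.continuous_of_finiteDimensional _).measurable,
    Matrix.det_diagonal, smul_eq_mul]
  congr 1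
  refine lintegral_congr fun y => ?_
  congr 2
  ext i
  simp [Matrix.toLin'_apply, Matrix.mulVec_diagonal]

lemma norm_dilate_le {d : Fin 3 → ℝ} {b : ℝ} (hb : 0 ≤ b) (hd : ∀ i, |d i| ≤ b)
    (x : EuclideanSpace ℝ (Fin 3)) : ‖dilate d x‖ ≤ b * ‖x‖ := by
  have h : ‖dilate d x‖ ^ 2 ≤ (b * ‖x‖) ^ 2 := by
    rw [mul_pow, EuclideanSpace.norm_sq_eq, EuclideanSpace.norm_sq_eq, Finset.mul_sum]
    refine Finset.sum_le_sum fun i _ => ?_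
    rw [dilate_apply, norm_mul, mul_pow, Real.norm_eq_abs]
    gcongr
    exact hd i
  exact le_of_sq_le_sq h (by positivity)

/-- Extension by zero of the coefficients on a square grid to a larger grid. -/
def extendCoeff (n : ℕ) {s : ℕ} (a : Fin s × Fin s → ℂ) (q : Fin n × Fin n) : ℂ :=
  if h : (q.1 : ℕ) < s ∧ (q.2 : ℕ) < s then a (⟨q.1, h.1⟩, ⟨q.2, h.2⟩) else 0

/-- With l = n/s, scaling frequencies by l scales horizontal variables by l and the vertical one by
l². Each of the two frequency integrals yields one factor l. -/
lemma sum_cellWave_eq {n s : ℕ} (hs : 0 < s) (hsn : s ≤ n) (a : Fin s × Fin s → ℂ)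
    (x : EuclideanSpace ℝ (Fin 3)) :
    ∑ q, a q * cellWave s q x = ((n / s : ℝ) : ℂ) ^ 2 *
      ∑ q, extendCoeff n a q *
        cellWave n q (dilate ![(n / s : ℝ), (n / s : ℝ), (n / s : ℝ) ^ 2] x) := by
  have hn : (0 : ℝ) < n := by exact_mod_cast hs.trans_le hsn
  have hs' : (0 : ℝ) < s := by exact_mod_cast hs
  set l : ℝ := n / s with hl
  have hw : ∀ (j : ℕ) (u t : ℝ), wave ((j : ℝ) / s) (((j : ℝ) + 1) / s) u t =
      l * wave ((j : ℝ) / n) (((j : ℝ) + 1) / n) (l * u) (l ^ 2 * t) := by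
    intro j u t
    rw [← wave_mul]
    congr 1 <;> rw [hl] <;> field_simp
  let ι : Fin s × Fin s ↪ Fin n × Fin n :=
    ⟨fun q => (Fin.castLE hsn q.1, Fin.castLE hsn q.2), fun q q' h => by
      have h1 := congrArg Prod.fst h
      have h2 := congrArg Prod.snd h
      exact Prod.ext (Fin.castLE_injective hsn h1) (Fin.castLE_injective hsn h2)⟩
  rw [Finset.mul_sum]
  have hsub : ∑ q ∈ Finset.univ.map ι, (l : ℂ) ^ 2 * (extendCoeff n a q *
        cellWave n q (dilate ![l, l, l ^ 2] x)) = ∑ q, (l : ℂ) ^ 2 * (extendCoeff n a q *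
        cellWave n q (dilate ![l, l, l ^ 2] x)) := by
    refine Finset.sum_subset (Finset.subset_univ _) fun q _ hq => ?_
    have : extendCoeff n a q = 0 := by
      rw [extendCoeff, dif_neg]
      intro h
      exact hq (Finset.mem_map.2 ⟨(⟨q.1, h.1⟩, ⟨q.2, h.2⟩), Finset.mem_univ _, rfl⟩)
    rw [this]; ring
  rw [← hsub, Finset.sum_map]
  refine Finset.sum_congr rfl fun q _ => ?_
  have h1 : extendCoeff n a (ι q) = a q := by
    have h : ((ι q).1 : ℕ) < s ∧ ((ι q).2 : ℕ) < s := ⟨q.1.2, q.2.2⟩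
    rw [extendCoeff, dif_pos h]
    rfl
  have e0 : dilate ![l, l, l ^ 2] x 0 = l * x 0 := rfl
  have e1 : dilate ![l, l, l ^ 2] x 1 = l * x 1 := rfl
  have e2 : dilate ![l, l, l ^ 2] x 2 = l ^ 2 * x 2 := rfl
  have c1 : (((ι q).1 : ℕ) : ℝ) = ((q.1 : ℕ) : ℝ) := rfl
  have c2 : (((ι q).2 : ℕ) : ℝ) = ((q.2 : ℕ) : ℝ) := rfl
  rw [h1, cellWave, cellWave, e0, e1, e2, c1, c2, hw, hw]
  ring

/-- Parabolic rescaling: a bound at scale `n` for coefficients in the corner square gives a bound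
on the ball of radius `r ≤ s²`. -/
lemma lintegral_sum_cellWave_le {n s : ℕ} (hs : 0 < s) (hsn : s ≤ n) {a : Fin s × Fin s → ℂ}
    {r : ℝ} (hr : r ≤ (s : ℝ) ^ 2) {K : ℝ≥0∞}
    (hK : ∫⁻ x in Metric.closedBall 0 ((n : ℝ) ^ 2), ‖∑ q, extendCoeff n a q * cellWave n q x‖ₑ ^ 3 ≤
      K * ENNReal.ofReal (s / n) ^ 2) :
    ∫⁻ x in Metric.closedBall 0 r, ‖∑ q, a q * cellWave s q x‖ₑ ^ 3 ≤ K := by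
  have hn : (0 : ℝ) < n := by exact_mod_cast hs.trans_le hsn
  have hs' : (0 : ℝ) < s := by exact_mod_cast hs
  have hsn' : (s : ℝ) ≤ n := by exact_mod_cast hsn
  set l : ℝ := n / s with hl
  have hl1 : 1 ≤ l := (one_le_div hs').2 hsn'
  have hl0 : 0 < l := by linarith
  set d : Fin 3 → ℝ := ![l, l, l ^ 2] with hd
  have hprod : ∏ i, d i = l ^ 4 := by
    rw [Fin.prod_univ_three]; simp [hd]; ring
  set g : EuclideanSpace ℝ (Fin 3) → ℝ≥0∞ :=
    fun x => ‖∑ q, extendCoeff n a q * cellWave n q x‖ₑ ^ 3 with hg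
  have hgm : Measurable g :=
    (continuous_sum_cellWave n (extendCoeff n a) Finset.univ).measurable.enorm.pow_const 3
  have hball : ∀ x ∈ Metric.closedBall (0 : EuclideanSpace ℝ (Fin 3)) r,
      dilate d x ∈ Metric.closedBall (0 : EuclideanSpace ℝ (Fin 3)) ((n : ℝ) ^ 2) := by
    intro x hx
    rw [mem_closedBall_zero_iff] at hx ⊢
    have hll : l ≤ l ^ 2 := by nlinarith
    have h1 := norm_dilate_le (d := d) (b := l ^ 2) (by positivity) (by
      intro i
      fin_cases i
      · simpa [hd, abs_of_pos hl0] using hll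
      · simpa [hd, abs_of_pos hl0] using hll
      · simp [hd]) x
    calc _ ≤ l ^ 2 * ‖x‖ := h1
      _ ≤ l ^ 2 * (s : ℝ) ^ 2 := by gcongr; linarith
      _ = _ := by rw [hl]; field_simp
  have h1 := lintegral_dilate (f := (Metric.closedBall 0 ((n : ℝ) ^ 2)).indicator g)
    (hgm.indicator Metric.isClosed_closedBall.measurableSet) (d := d) (by rw [hprod]; positivity)
  rw [lintegral_indicator Metric.isClosed_closedBall.measurableSet, hprod,
    abs_of_pos (by positivity)] at h1
  have h2 : ∫⁻ x in Metric.closedBall 0 r, g (dilate d x) ≤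
      ∫⁻ x, (Metric.closedBall 0 ((n : ℝ) ^ 2)).indicator g (dilate d x) := by
    rw [← lintegral_indicator Metric.isClosed_closedBall.measurableSet]
    refine lintegral_mono fun x => ?_
    by_cases hx : x ∈ Metric.closedBall (0 : EuclideanSpace ℝ (Fin 3)) r
    · rw [Set.indicator_of_mem hx, Set.indicator_of_mem (hball x hx)]
    · rw [Set.indicator_of_notMem hx]; exact bot_le
  have h3 : ∀ x, ‖∑ q, a q * cellWave s q x‖ₑ ^ 3 = ENNReal.ofReal (l ^ 6) * g (dilate d x) := by
    intro x
    rw [sum_cellWave_eq hs hsn a x, enorm_mul, mul_pow, hg]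
    congr 1
    rw [← ofReal_norm, norm_pow, Complex.norm_real, Real.norm_of_nonneg hl0.le,
      ← ENNReal.ofReal_pow (by positivity)]
    congr 1
    ring
  simp_rw [h3]
  rw [lintegral_const_mul' _ _ ENNReal.ofReal_ne_top]
  -- The cubed amplitude gives l⁶ and the Jacobian takes l⁴. The remaining l² cancels against
  -- (s/n)².
  have e6 : ENNReal.ofReal (l ^ 6) = ENNReal.ofReal (l ^ 2) * ENNReal.ofReal (l ^ 4) := by
    rw [← ENNReal.ofReal_mul (by positivity)]; congr 1; ring
  calc _ ≤ ENNReal.ofReal (l ^ 6) *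
        ∫⁻ x, (Metric.closedBall 0 ((n : ℝ) ^ 2)).indicator g (dilate d x) := by gcongr
    _ = ENNReal.ofReal (l ^ 2) * ∫⁻ x in Metric.closedBall 0 ((n : ℝ) ^ 2), g x := by
        rw [h1, e6, mul_assoc]
    _ ≤ ENNReal.ofReal (l ^ 2) * (K * ENNReal.ofReal (s / n) ^ 2) := by gcongr
    _ = (ENNReal.ofReal (l ^ 2) * ENNReal.ofReal (s / n) ^ 2) * K := by ring
    _ = K := by
        rw [← ENNReal.ofReal_pow (by positivity), ← ENNReal.ofReal_mul (by positivity)]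
        have : l ^ 2 * (s / n : ℝ) ^ 2 = 1 := by rw [hl]; field_simp
        rw [this, ENNReal.ofReal_one, one_mul]

/-! ### Bounded densities and the norm of the extension operator -/

/-- `F` is measurable and bounded by `b` almost everywhere on the unit square. -/
def EssBounded (b : ℝ) (F : EuclideanSpace ℝ (Fin 2) → ℂ) : Prop :=
  AEStronglyMeasurable F (volume.restrict unitSquare) ∧
    ∀ᵐ ξ ∂volume.restrict unitSquare, ‖F ξ‖ ≤ b

instance isProbabilityMeasure_restrict_unitSquare :
    IsProbabilityMeasure (volume.restrict unitSquare) :=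
  ⟨by rw [Measure.restrict_apply_univ, volume_unitSquare]⟩

lemma EssBounded.integrable {b : ℝ} {F : EuclideanSpace ℝ (Fin 2) → ℂ} (h : EssBounded b F) :
    IntegrableOn F unitSquare :=
  Integrable.of_bound h.1 b h.2

lemma EssBounded.mul_bound {b b' : ℝ} (hb : 0 ≤ b) {F G : EuclideanSpace ℝ (Fin 2) → ℂ}
    (h : EssBounded b F) (hGm : AEStronglyMeasurable G (volume.restrict unitSquare))
    (hG : ∀ ξ ∈ unitSquare, ‖G ξ‖ ≤ b') :
    EssBounded (b * b') (fun ξ => F ξ * G ξ) := by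
  refine ⟨h.1.mul hGm, ?_⟩
  filter_upwards [h.2, ae_restrict_mem measurableSet_unitSquare] with ξ h1 h2
  rw [norm_mul]
  exact mul_le_mul h1 (hG ξ h2) (norm_nonneg _) hb

lemma norm_extensionOp_le {b : ℝ} {F : EuclideanSpace ℝ (Fin 2) → ℂ} (h : EssBounded b F)
    (x : EuclideanSpace ℝ (Fin 3)) : ‖extensionOp unitSquare F x‖ ≤ b := by
  rw [extensionOp_eq]
  have := norm_integral_le_of_norm_le_const (μ := volume.restrict unitSquare)
    (f := fun ξ => F ξ * unitExp (inner ℝ (paraboloidPoint ξ) x)) (C := b) (by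
      filter_upwards [h.2] with ξ hξ
      rwa [norm_mul, norm_unitExp, mul_one])
  simpa using this

lemma continuous_extensionOp {F : EuclideanSpace ℝ (Fin 2) → ℂ} (h : IntegrableOn F unitSquare) :
    Continuous (extensionOp unitSquare F) := by
  have e : extensionOp unitSquare F = fun x =>
      ∫ ξ in unitSquare, F ξ * unitExp (inner ℝ (paraboloidPoint ξ) x) := rfl
  rw [e]
  refine continuous_of_dominated (bound := fun ξ => ‖F ξ‖) (fun x => ?_) (fun x => ?_) h.norm ?_
  · exact h.1.mul (continuous_unitExp_inner x).aestronglyMeasurable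
  · refine Filter.Eventually.of_forall fun ξ => ?_
    rw [norm_mul, norm_unitExp, mul_one]
  · refine Filter.Eventually.of_forall fun ξ => ?_
    exact continuous_const.mul (continuous_unitExp.comp (continuous_const.inner continuous_id))

/-- The `L^∞ → L³(B_r)` norm of the extension operator. -/
def extensionNorm (r : ℝ) : ℝ≥0∞ :=
  ⨆ (F : EuclideanSpace ℝ (Fin 2) → ℂ) (_ : EssBounded 1 F),
    eLpNorm (extensionOp unitSquare F) 3 (volume.restrict (Metric.closedBall 0 r))

lemma eLpNorm_extensionOp_le_one {r : ℝ} {F : EuclideanSpace ℝ (Fin 2) → ℂ}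
    (h : EssBounded 1 F) :
    eLpNorm (extensionOp unitSquare F) 3 (volume.restrict (Metric.closedBall 0 r)) ≤
      extensionNorm r :=
  le_iSup₂ (f := fun (F : EuclideanSpace ℝ (Fin 2) → ℂ) (_ : EssBounded 1 F) =>
    eLpNorm (extensionOp unitSquare F) 3 (volume.restrict (Metric.closedBall 0 r))) F h

lemma extensionNorm_ne_top (r : ℝ) : extensionNorm r ≠ ∞ := by
  have h : extensionNorm r ≤ volume (Metric.closedBall (0 : EuclideanSpace ℝ (Fin 3)) r) ^
      ((3 : ℝ≥0∞).toReal)⁻¹ * ENNReal.ofReal 1 := by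
    refine iSup₂_le fun F hF => ?_
    refine (eLpNorm_le_of_ae_bound (Filter.Eventually.of_forall (norm_extensionOp_le hF))).trans_eq ?_
    rw [Measure.restrict_apply_univ]
  refine ne_top_of_le_ne_top ?_ h
  refine ENNReal.mul_ne_top (ENNReal.rpow_ne_top_of_nonneg (by positivity) ?_)
    ENNReal.ofReal_ne_top
  exact measure_closedBall_lt_top.ne

lemma extensionOp_const_mul (S : Set (EuclideanSpace ℝ (Fin 2))) (z : ℂ)
    (F : EuclideanSpace ℝ (Fin 2) → ℂ) :
    extensionOp S (fun ξ => z * F ξ) = z • extensionOp S F := by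
  ext x
  rw [Pi.smul_apply, smul_eq_mul, extensionOp_eq, extensionOp_eq, ← integral_const_mul]
  refine integral_congr_ae (Filter.Eventually.of_forall fun ξ => ?_)
  simp only
  ring

lemma eLpNorm_extensionOp_le {r b : ℝ} (hb : 0 < b) {F : EuclideanSpace ℝ (Fin 2) → ℂ}
    (h : EssBounded b F) :
    eLpNorm (extensionOp unitSquare F) 3 (volume.restrict (Metric.closedBall 0 r)) ≤
      ENNReal.ofReal b * extensionNorm r := by
  have h1 : EssBounded 1 (fun ξ => (b : ℂ)⁻¹ * F ξ) := by
    refine ⟨h.1.const_mul _, ?_⟩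
    filter_upwards [h.2] with ξ hξ
    rw [norm_mul, norm_inv, Complex.norm_real, Real.norm_of_nonneg hb.le, inv_mul_le_iff₀ hb]
    simpa using hξ
  have hbC : (b : ℂ) ≠ 0 := by exact_mod_cast hb.ne'
  have e : F = fun ξ => (b : ℂ) * ((b : ℂ)⁻¹ * F ξ) := by
    ext ξ; rw [mul_inv_cancel_left₀ hbC]
  rw [e, extensionOp_const_mul, eLpNorm_const_smul]
  have : ‖(b : ℂ)‖ₑ = ENNReal.ofReal b := by
    rw [← ofReal_norm, Complex.norm_real, Real.norm_of_nonneg hb.le]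
  rw [this]
  gcongr
  exact eLpNorm_extensionOp_le_one h1

/-! ### Taylor expansion of a perturbed phase -/

section Taylor

variable {H : EuclideanSpace ℝ (Fin 2) → ℂ} {g : EuclideanSpace ℝ (Fin 2) → Fin 3 → ℝ}

/-- The density `H` multiplied by a monomial in the functions `g`. -/
def monomialDensity (H : EuclideanSpace ℝ (Fin 2) → ℂ) (g : EuclideanSpace ℝ (Fin 2) → Fin 3 → ℝ)
    {k : ℕ} (w : Fin k → Fin 3) (ξ : EuclideanSpace ℝ (Fin 2)) : ℂ :=
  H ξ * ((∏ i, g ξ (w i) : ℝ) : ℂ)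

/-- Monomials in the displacement stay within bounded densities. Every Taylor term is thus again
controlled by `extensionNorm`. -/
lemma essBounded_monomialDensity (hH : EssBounded 2 H) (hg : ∀ l, Measurable fun ξ => g ξ l)
    {b : ℝ} (hgb : ∀ ξ ∈ unitSquare, ∀ l, |g ξ l| ≤ b) {k : ℕ} (w : Fin k → Fin 3) :
    EssBounded (2 * b ^ k) (monomialDensity H g w) := by
  refine hH.mul_bound (by norm_num) ?_ fun ξ hξ => ?_
  · have : Measurable fun ξ => ((∏ i, g ξ (w i) : ℝ) : ℂ) :=
      Complex.measurable_ofReal.comp (Finset.measurable_fun_prod _ fun i _ => hg (w i))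
    exact this.aestronglyMeasurable
  · rw [Complex.norm_real, Real.norm_eq_abs, Finset.abs_prod]
    calc _ ≤ ∏ i : Fin k, b := Finset.prod_le_prod (fun _ _ => abs_nonneg _) fun i _ => hgb ξ hξ _
      _ = _ := by simp

/-- The power of the inner product is expanded over words in the coordinates, which separates x from
v without multinomial coefficients. The finite truncation avoids exchanging a series with integrals.
-/
lemma one_sub_unitExp_eq (K : ℕ) (v x : Fin 3 → ℝ) :
    ∃ ρ : ℂ, 1 - unitExp (∑ l, v l * x l) =
      -(∑ k ∈ Finset.range K, ∑ w : Fin (k + 1) → Fin 3,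
        ((2 * Real.pi * Complex.I) ^ (k + 1) / (k + 1).factorial * ((∏ i, x (w i) : ℝ) : ℂ)) *
          ((∏ i, v (w i) : ℝ) : ℂ)) - ρ ∧
      (2 * Real.pi * |∑ l, v l * x l| ≤ 1 / 8 → ‖ρ‖ ≤ (1 / 8) ^ K) := by
  set θ := ∑ l, v l * x l with hθ
  set z : ℂ := 2 * Real.pi * Complex.I * (θ : ℂ) with hz
  refine ⟨Complex.exp z - ∑ m ∈ Finset.range (K + 1), z ^ m / m.factorial, ?_, ?_⟩
  · rw [Finset.sum_range_succ']
    have h1 : ∀ k ∈ Finset.range K, ∑ w : Fin (k + 1) → Fin 3,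
        ((2 * Real.pi * Complex.I) ^ (k + 1) / (k + 1).factorial * ((∏ i, x (w i) : ℝ) : ℂ)) *
          ((∏ i, v (w i) : ℝ) : ℂ) = z ^ (k + 1) / (k + 1).factorial := by
      intro k _
      have h2 : ((θ ^ (k + 1) : ℝ) : ℂ) = ∑ w : Fin (k + 1) → Fin 3,
          ((∏ i, x (w i) : ℝ) : ℂ) * ((∏ i, v (w i) : ℝ) : ℂ) := by
        rw [hθ, Fintype.sum_pow, Complex.ofReal_sum]
        refine Finset.sum_congr rfl fun w _ => ?_
        rw [Finset.prod_mul_distrib, Complex.ofReal_mul, mul_comm]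
      rw [hz, mul_pow _ (θ : ℂ), ← Complex.ofReal_pow, h2, Finset.mul_sum, Finset.sum_div]
      refine Finset.sum_congr rfl fun w _ => ?_
      ring
    rw [Finset.sum_congr rfl h1]
    simp only [pow_zero, Nat.factorial_zero, Nat.cast_one, div_one]
    rw [unitExp, hz]
    ring
  · intro h
    have hzn : ‖z‖ ≤ 1 / 8 := by
      rw [hz, norm_mul, Complex.norm_real, Real.norm_eq_abs]
      have : ‖(2 * Real.pi * Complex.I : ℂ)‖ = 2 * Real.pi := by
        simp [abs_of_pos Real.pi_pos]
      rwa [this]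
    have h1 := Complex.exp_bound' (x := z) (n := K + 1) (by
      rw [div_le_iff₀ (by positivity)]
      push_cast
      nlinarith [(Nat.cast_nonneg K : (0 : ℝ) ≤ K)])
    refine h1.trans ?_
    have h2 : ‖z‖ ^ (K + 1) ≤ (1 / 8) ^ (K + 1) := pow_le_pow_left₀ (norm_nonneg _) hzn _
    have h3 : ‖z‖ ^ (K + 1) / (K + 1).factorial ≤ ‖z‖ ^ (K + 1) :=
      div_le_self (by positivity) (by exact_mod_cast Nat.succ_le_of_lt (Nat.factorial_pos _))
    have h4 : (0 : ℝ) < (1 / 8) ^ K := by positivity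
    rw [pow_succ (1 / 8 : ℝ)] at h2
    linarith

/-- In each Taylor term the monomial in x leaves the integral and is bounded by a power of r, and
the monomial in g joins the density. No term of degree 0 occurs, which is the source of smallness.
-/
lemma norm_integral_one_sub_unitExp_le (hH : EssBounded 2 H) (hg : ∀ l, Measurable fun ξ => g ξ l)
    {b r : ℝ} (hgb : ∀ ξ ∈ unitSquare, ∀ l, |g ξ l| ≤ b)
    (hbr : 6 * Real.pi * r * b ≤ 1 / 8) (K : ℕ) {x : EuclideanSpace ℝ (Fin 3)}
    (hx : ∀ l, |x l| ≤ r) :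
    ‖∫ ξ in unitSquare, H ξ * unitExp (inner ℝ (paraboloidPoint ξ) x) *
        (1 - unitExp (∑ l, g ξ l * x l))‖ ≤
      ∑ k ∈ Finset.range K, ∑ w : Fin (k + 1) → Fin 3, (2 * Real.pi * r) ^ (k + 1) *
        ‖extensionOp unitSquare (monomialDensity H g w) x‖ + 2 * (1 / 8) ^ K := by
  have hpi := Real.pi_pos
  have hr : 0 ≤ r := (abs_nonneg _).trans (hx 0)
  choose ρ hρ1 hρ2 using fun ξ => one_sub_unitExp_eq K (g ξ) x
  have hρb : ∀ ξ ∈ unitSquare, ‖ρ ξ‖ ≤ (1 / 8) ^ K := by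
    intro ξ hξ
    apply hρ2
    have h1 : |∑ l, g ξ l * x l| ≤ 3 * (b * r) := by
      refine (Finset.abs_sum_le_sum_abs _ _).trans ?_
      calc _ ≤ ∑ l : Fin 3, b * r := by
            refine Finset.sum_le_sum fun l _ => ?_
            rw [abs_mul]
            exact mul_le_mul (hgb ξ hξ l) (hx l) (abs_nonneg _)
              ((abs_nonneg _).trans (hgb ξ hξ l))
        _ = _ := by simp
    calc _ ≤ 2 * Real.pi * (3 * (b * r)) := by gcongr
      _ = 6 * Real.pi * r * b := by ring
      _ ≤ _ := hbr
  set c : (k : ℕ) → (Fin (k + 1) → Fin 3) → ℂ := fun k w =>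
    (2 * Real.pi * Complex.I) ^ (k + 1) / (k + 1).factorial * ((∏ i, x (w i) : ℝ) : ℂ) with hc
  have hcb : ∀ k w, ‖c k w‖ ≤ (2 * Real.pi * r) ^ (k + 1) := by
    intro k w
    rw [hc, norm_mul, norm_div, norm_pow, Complex.norm_real, Complex.norm_natCast,
      Real.norm_eq_abs, Finset.abs_prod, mul_pow (2 * Real.pi)]
    have e : ‖(2 * Real.pi * Complex.I : ℂ)‖ = 2 * Real.pi := by
      simp [abs_of_pos Real.pi_pos]
    rw [e]
    gcongr
    · exact div_le_self (by positivity)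
        (by exact_mod_cast Nat.succ_le_of_lt (Nat.factorial_pos _))
    · calc _ ≤ ∏ i : Fin (k + 1), r :=
            Finset.prod_le_prod (fun _ _ => abs_nonneg _) fun i _ => hx _
        _ = _ := by simp
  set m : (k : ℕ) → (Fin (k + 1) → Fin 3) → EuclideanSpace ℝ (Fin 2) → ℂ := fun k w ξ =>
    monomialDensity H g w ξ * unitExp (inner ℝ (paraboloidPoint ξ) x) with hm
  have hmi : ∀ k w, IntegrableOn (m k w) unitSquare := by
    intro k w
    have h1 := (essBounded_monomialDensity hH hg hgb w).mul_bound (b' := 1)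
      (G := fun ξ => unitExp (inner ℝ (paraboloidPoint ξ) x)) (by
        have : unitSquare.Nonempty := by
          by_contra hne
          rw [Set.not_nonempty_iff_eq_empty] at hne
          have := volume_unitSquare
          simp [hne] at this
        obtain ⟨ξ, hξ⟩ := this
        have := (abs_nonneg _).trans (hgb ξ hξ 0)
        positivity)
      (continuous_unitExp_inner x).aestronglyMeasurable fun ξ _ => (norm_unitExp _).le
    exact h1.integrable
  set T : EuclideanSpace ℝ (Fin 2) → ℂ := fun ξ =>
    ∑ k ∈ Finset.range K, ∑ w : Fin (k + 1) → Fin 3, c k w * m k w ξ with hT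
  have hTi : IntegrableOn T unitSquare :=
    integrable_finsetSum _ fun k _ => integrable_finsetSum _ fun w _ => (hmi k w).const_mul _
  have hTint : ∫ ξ in unitSquare, T ξ = ∑ k ∈ Finset.range K, ∑ w : Fin (k + 1) → Fin 3,
      c k w * extensionOp unitSquare (monomialDensity H g w) x := by
    rw [hT, integral_finsetSum _ fun k _ =>
      integrable_finsetSum _ fun w _ => (hmi k w).const_mul _]
    refine Finset.sum_congr rfl fun k _ => ?_
    rw [integral_finsetSum _ fun w _ => (hmi k w).const_mul _]
    refine Finset.sum_congr rfl fun w _ => ?_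
    rw [integral_const_mul, extensionOp_eq]
  set I : EuclideanSpace ℝ (Fin 2) → ℂ := fun ξ =>
    H ξ * unitExp (inner ℝ (paraboloidPoint ξ) x) * (1 - unitExp (∑ l, g ξ l * x l)) with hI
  have hId : ∀ ξ, I ξ = -T ξ - H ξ * unitExp (inner ℝ (paraboloidPoint ξ) x) * ρ ξ := by
    intro ξ
    have h1 : T ξ = H ξ * unitExp (inner ℝ (paraboloidPoint ξ) x) *
        ∑ k ∈ Finset.range K, ∑ w : Fin (k + 1) → Fin 3, c k w *
          ((∏ i, g ξ (w i) : ℝ) : ℂ) := by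
      simp only [hT, hm, monomialDensity]
      rw [Finset.mul_sum]
      refine Finset.sum_congr rfl fun k _ => ?_
      rw [Finset.mul_sum]
      refine Finset.sum_congr rfl fun w _ => ?_
      ring
    rw [h1]
    simp only [hI]
    rw [hρ1 ξ]
    ring
  have hIi : IntegrableOn I unitSquare := by
    have h1 : EssBounded (2 * 2) I := by
      have h2 : ∀ ξ, I ξ = H ξ * (unitExp (inner ℝ (paraboloidPoint ξ) x) *
        (1 - unitExp (∑ l, g ξ l * x l))) := fun ξ => by simp only [hI]; ring
      rw [show I = fun ξ => H ξ * (unitExp (inner ℝ (paraboloidPoint ξ) x) *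
        (1 - unitExp (∑ l, g ξ l * x l))) from funext h2]
      refine hH.mul_bound (by norm_num) ?_ fun ξ _ => ?_
      · refine (continuous_unitExp_inner x).aestronglyMeasurable.mul ?_
        have : Measurable fun ξ => 1 - unitExp (∑ l, g ξ l * x l) :=
          measurable_const.sub (continuous_unitExp.measurable.comp
            (Finset.measurable_fun_sum _ fun l _ => (hg l).mul_const _))
        exact this.aestronglyMeasurable
      · rw [norm_mul, norm_unitExp, one_mul]
        refine (norm_sub_le _ _).trans ?_
        rw [norm_one, norm_unitExp]
        norm_num
    exact h1.integrable
  have hsplit : ∫ ξ in unitSquare, I ξ = (∫ ξ in unitSquare, (I ξ + T ξ)) -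
      ∫ ξ in unitSquare, T ξ := by
    rw [integral_add hIi hTi]; ring
  have hrem : ‖∫ ξ in unitSquare, (I ξ + T ξ)‖ ≤ 2 * (1 / 8) ^ K := by
    have := norm_integral_le_of_norm_le_const (μ := volume.restrict unitSquare)
      (f := fun ξ => I ξ + T ξ) (C := 2 * (1 / 8) ^ K) (by
        filter_upwards [hH.2, ae_restrict_mem measurableSet_unitSquare] with ξ h1 h2
        rw [hId ξ]
        have e : -T ξ - H ξ * unitExp (inner ℝ (paraboloidPoint ξ) x) * ρ ξ + T ξ =
          -(H ξ * unitExp (inner ℝ (paraboloidPoint ξ) x) * ρ ξ) := by ring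
        rw [e, norm_neg, norm_mul, norm_mul, norm_unitExp, mul_one]
        exact mul_le_mul h1 (hρb ξ h2) (norm_nonneg _) (by norm_num))
    simpa using this
  change ‖∫ ξ in unitSquare, I ξ‖ ≤ _
  rw [hsplit, hTint]
  refine (norm_sub_le _ _).trans ?_
  rw [add_comm]
  refine add_le_add ((norm_sum_le _ _).trans ?_) hrem
  refine Finset.sum_le_sum fun k _ => (norm_sum_le _ _).trans (Finset.sum_le_sum fun w _ => ?_)
  rw [norm_mul]
  gcongr
  exact hcb k w

end Taylor

/-! ### Subtracting averages over cells -/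

lemma exists_mem_Icc_div {s : ℕ} (hs : 0 < s) {v : ℝ} (hv : v ∈ Set.Icc (0 : ℝ) 1) :
    ∃ j : Fin s, v ∈ Set.Icc ((j : ℝ) / s) (((j : ℝ) + 1) / s) := by
  have hs' : (0 : ℝ) < s := by exact_mod_cast hs
  rcases hv.2.eq_or_lt with h1 | h1
  · refine ⟨⟨s - 1, by omega⟩, ?_⟩
    have e : ((s - 1 : ℕ) : ℝ) = s - 1 := by
      rw [Nat.cast_sub (Nat.succ_le_of_lt hs)]; simp
    simp only [e, h1]
    refine ⟨(div_le_one hs').2 (by linarith), ?_⟩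
    rw [sub_add_cancel, div_self hs'.ne']
  · have h0 : 0 ≤ s * v := mul_nonneg hs'.le hv.1
    refine ⟨⟨⌊s * v⌋₊, (Nat.floor_lt h0).2 (by nlinarith)⟩, ?_, ?_⟩
    · rw [div_le_iff₀ hs']
      linarith [Nat.floor_le h0]
    · rw [le_div_iff₀ hs']
      linarith [Nat.lt_floor_add_one (s * v)]

lemma unitSquare_eq_iUnion {s : ℕ} (hs : 0 < s) : unitSquare = ⋃ q, canonicalSquare s q := by
  refine Set.Subset.antisymm (fun ξ hξ => ?_) (Set.iUnion_subset (canonicalSquare_subset s))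
  obtain ⟨i, hi⟩ := exists_mem_Icc_div hs (hξ 0)
  obtain ⟨j, hj⟩ := exists_mem_Icc_div hs (hξ 1)
  exact Set.mem_iUnion.2 ⟨(i, j), hi, hj⟩

lemma integral_unitSquare_eq_sum {s : ℕ} (hs : 0 < s) {f : EuclideanSpace ℝ (Fin 2) → ℂ}
    (hf : IntegrableOn f unitSquare) :
    ∫ ξ in unitSquare, f ξ = ∑ q, ∫ ξ in canonicalSquare s q, f ξ := by
  rw [unitSquare_eq_iUnion hs] at hf ⊢
  rw [integral_iUnion_ae (fun q => (measurableSet_canonicalSquare s q).nullMeasurableSet)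
    (fun q q' h => volume_canonicalSquare_inter s h) hf, tsum_fintype]

lemma ae_restrict_unitSquare_iff {s : ℕ} (hs : 0 < s) {p : EuclideanSpace ℝ (Fin 2) → Prop} :
    (∀ᵐ ξ ∂volume.restrict unitSquare, p ξ) ↔
      ∀ q, ∀ᵐ ξ ∂volume.restrict (canonicalSquare s q), p ξ := by
  rw [unitSquare_eq_iUnion hs, ae_restrict_iUnion_iff]

lemma stepFunction_ae_eq (s : ℕ) (a : Fin s × Fin s → ℂ) (q : Fin s × Fin s) :
    ∀ᵐ ξ ∂volume.restrict (canonicalSquare s q), stepFunction s a ξ = a q := by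
  have h : ∀ q' : Fin s × Fin s, q' ≠ q →
      ∀ᵐ ξ ∂volume.restrict (canonicalSquare s q), ξ ∉ canonicalSquare s q' := by
    intro q' hq'
    rw [ae_restrict_iff' (measurableSet_canonicalSquare s q), ae_iff]
    refine measure_mono_null (fun ξ hξ => ?_) (volume_canonicalSquare_inter s hq')
    simp only [Classical.not_imp, not_not, Set.mem_ofPred_eq] at hξ
    exact ⟨hξ.2, hξ.1⟩
  have h2 : ∀ᵐ ξ ∂volume.restrict (canonicalSquare s q), ∀ q', q' ≠ q →
      ξ ∉ canonicalSquare s q' := by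
    rw [ae_all_iff]
    intro q'
    by_cases hq : q' = q
    · exact Filter.Eventually.of_forall fun ξ h' => absurd hq h'
    · filter_upwards [h q' hq] with ξ hξ _ using hξ
  filter_upwards [h2, ae_restrict_mem (measurableSet_canonicalSquare s q)] with ξ h3 h4
  rw [stepFunction, Finset.sum_eq_single q]
  · rw [Set.indicator_of_mem h4]
  · intro q' _ hq'
    rw [Set.indicator_of_notMem (h3 q' hq')]
  · intro hq; exact absurd (Finset.mem_univ q) hq

lemma essBounded_stepFunction {s : ℕ} (hs : 0 < s) {a : Fin s × Fin s → ℂ} (ha : ∀ q, ‖a q‖ ≤ 1) :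
    EssBounded 1 (stepFunction s a) := by
  refine ⟨(integrable_stepFunction s a).aestronglyMeasurable.restrict, ?_⟩
  rw [ae_restrict_unitSquare_iff hs]
  intro q
  filter_upwards [stepFunction_ae_eq s a q] with ξ hξ
  rw [hξ]
  exact ha q

/-- The averages of `F` over the canonical squares. -/
def cellAverage (s : ℕ) (F : EuclideanSpace ℝ (Fin 2) → ℂ) (q : Fin s × Fin s) : ℂ :=
  (s : ℂ) ^ 2 * ∫ ξ in canonicalSquare s q, F ξ

lemma norm_cellAverage_le {s : ℕ} (hs : 0 < s) {F : EuclideanSpace ℝ (Fin 2) → ℂ}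
    (hF : EssBounded 1 F) (q : Fin s × Fin s) : ‖cellAverage s F q‖ ≤ 1 := by
  have hs' : (0 : ℝ) < s := by exact_mod_cast hs
  have h1 := norm_setIntegral_le_of_norm_le_const_ae (μ := volume) (s := canonicalSquare s q)
    (f := F) (C := 1) (by rw [volume_canonicalSquare]; exact ENNReal.ofReal_lt_top)
    ((ae_restrict_unitSquare_iff hs).1 hF.2 q)
  rw [Measure.real, volume_canonicalSquare, ENNReal.toReal_ofReal (by positivity)] at h1
  rw [cellAverage, norm_mul, norm_pow, Complex.norm_natCast]
  calc _ ≤ (s : ℝ) ^ 2 * (1 * (1 / (s : ℝ) ^ 2)) := by gcongr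
    _ = 1 := by field_simp

lemma integral_sub_stepFunction_cellAverage {s : ℕ} (hs : 0 < s)
    {F : EuclideanSpace ℝ (Fin 2) → ℂ} (hF : IntegrableOn F unitSquare) (q : Fin s × Fin s) :
    ∫ ξ in canonicalSquare s q, (F ξ - stepFunction s (cellAverage s F) ξ) = 0 := by
  have hs' : (s : ℂ) ≠ 0 := by exact_mod_cast hs.ne'
  rw [integral_sub (hF.mono_set (canonicalSquare_subset s q)).integrable
    (integrable_stepFunction s _).integrableOn, integral_congr_ae (stepFunction_ae_eq s _ q),
    setIntegral_const, Measure.real, volume_canonicalSquare, ENNReal.toReal_ofReal (by positivity),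
    cellAverage, Complex.real_smul]
  push_cast
  field_simp
  ring

/-- The lower left corner of the canonical square that contains `ξ`. -/
def cellCorner (s : ℕ) (ξ : EuclideanSpace ℝ (Fin 2)) : EuclideanSpace ℝ (Fin 2) :=
  WithLp.toLp 2 fun i => (⌊s * ξ i⌋ : ℝ) / s

lemma measurable_cellCorner (s : ℕ) : Measurable (cellCorner s) := by
  unfold cellCorner
  refine (PiLp.volume_preserving_toLp (Fin 2)).measurable.comp (measurable_pi_lambda _ fun i => ?_)
  have : Measurable fun ξ : EuclideanSpace ℝ (Fin 2) => (s : ℝ) * ξ i := by fun_prop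
  exact (measurable_from_top (f := fun z : ℤ => (z : ℝ))).comp (this.floor) |>.div_const _

lemma floor_mul_eq {s j : ℕ} (hs : 0 < s) {v : ℝ}
    (hv : v ∈ Set.Icc ((j : ℝ) / s) (((j : ℝ) + 1) / s)) (hne : v ≠ ((j : ℝ) + 1) / s) :
    ⌊s * v⌋ = (j : ℤ) := by
  have hs' : (0 : ℝ) < s := by exact_mod_cast hs
  rw [Int.floor_eq_iff]
  have h1 := hv.1
  have h2 := lt_of_le_of_ne hv.2 hne
  rw [div_le_iff₀ hs'] at h1
  rw [lt_div_iff₀ hs'] at h2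
  constructor <;> push_cast <;> linarith

/-- The floor jumps to the next cell on the right and upper edges, which are null. -/
lemma cellCorner_ae_eq {s : ℕ} (hs : 0 < s) (q : Fin s × Fin s) :
    ∀ᵐ ξ ∂volume.restrict (canonicalSquare s q),
      cellCorner s ξ = WithLp.toLp 2 ![(q.1 : ℝ) / s, (q.2 : ℝ) / s] := by
  have hl : ∀ (i : Fin 2) (v : ℝ), ∀ᵐ ξ ∂volume.restrict (canonicalSquare s q), ξ i ≠ v :=
    fun i v => ae_restrict_of_ae (by rw [ae_iff]; simpa using volume_line_eq_zero v i)
  filter_upwards [hl 0 (((q.1 : ℝ) + 1) / s), hl 1 (((q.2 : ℝ) + 1) / s),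
    ae_restrict_mem (measurableSet_canonicalSquare s q)] with ξ h0 h1 hq
  ext i
  fin_cases i
  · simp [cellCorner, floor_mul_eq hs hq.1 h0]
  · simp [cellCorner, floor_mul_eq hs hq.2 h1]

lemma abs_cellCorner_sub_le {s : ℕ} (hs : 0 < s) (ξ : EuclideanSpace ℝ (Fin 2)) (i : Fin 2) :
    |cellCorner s ξ i - ξ i| ≤ 1 / s := by
  have hs' : (0 : ℝ) < s := by exact_mod_cast hs
  have e : cellCorner s ξ i - ξ i = -((s * ξ i - ⌊s * ξ i⌋) / s) := by
    simp only [cellCorner]; field_simp; ring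
  rw [e, abs_neg, abs_div, abs_of_pos hs']
  gcongr
  rw [abs_le]
  constructor <;> linarith [Int.floor_le (s * ξ i), Int.lt_floor_add_one (s * ξ i)]

lemma abs_paraboloidPoint_cellCorner_sub_le {s : ℕ} (hs : 0 < s) {ξ : EuclideanSpace ℝ (Fin 2)}
    (hξ : ξ ∈ unitSquare) (l : Fin 3) :
    |paraboloidPoint (cellCorner s ξ) l - paraboloidPoint ξ l| ≤ 4 / s := by
  have hs' : (0 : ℝ) < s := by exact_mod_cast hs
  have h14 : (1 : ℝ) / s ≤ 4 / s := by gcongr; norm_num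
  have hsq : ∀ ζ : EuclideanSpace ℝ (Fin 2), ‖ζ‖ ^ 2 = ζ 0 ^ 2 + ζ 1 ^ 2 := fun ζ => by
    rw [EuclideanSpace.norm_sq_eq]; simp
  have hc : ∀ i, |cellCorner s ξ i ^ 2 - ξ i ^ 2| ≤ 2 / s := by
    intro i
    have h0 : 0 ≤ cellCorner s ξ i := by
      have : (0 : ℤ) ≤ ⌊s * ξ i⌋ := Int.floor_nonneg.2 (mul_nonneg hs'.le (hξ i).1)
      have : (0 : ℝ) ≤ ⌊s * ξ i⌋ := by exact_mod_cast this
      simp only [cellCorner]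
      positivity
    have h1 : cellCorner s ξ i ≤ ξ i := by
      simp only [cellCorner]
      rw [div_le_iff₀ hs']
      linarith [Int.floor_le (s * ξ i)]
    have h2 := abs_cellCorner_sub_le hs ξ i
    have e : cellCorner s ξ i ^ 2 - ξ i ^ 2 =
        (cellCorner s ξ i - ξ i) * (cellCorner s ξ i + ξ i) := by ring
    rw [e, abs_mul, abs_of_nonneg (add_nonneg h0 (hξ i).1)]
    calc _ ≤ 1 / (s : ℝ) * 2 := by
          have h3 : ξ i ≤ 1 := (hξ i).2
          exact mul_le_mul h2 (by linarith) (add_nonneg h0 (hξ i).1) (by positivity)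
      _ = 2 / (s : ℝ) := by ring
  fin_cases l
  · exact (abs_cellCorner_sub_le hs ξ 0).trans h14
  · exact (abs_cellCorner_sub_le hs ξ 1).trans h14
  · show |‖cellCorner s ξ‖ ^ 2 - ‖ξ‖ ^ 2| ≤ 4 / s
    rw [hsq, hsq]
    have e : cellCorner s ξ 0 ^ 2 + cellCorner s ξ 1 ^ 2 - (ξ 0 ^ 2 + ξ 1 ^ 2) =
      (cellCorner s ξ 0 ^ 2 - ξ 0 ^ 2) + (cellCorner s ξ 1 ^ 2 - ξ 1 ^ 2) := by ring
    rw [e]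
    refine (abs_add_le _ _).trans ?_
    have e2 : (4 : ℝ) / s = 2 / s + 2 / s := by ring
    rw [e2]
    exact add_le_add (hc 0) (hc 1)

/-- The frequency displacement from a point of the paraboloid to the corner of its cap. -/
def capDisplacement (s : ℕ) (ξ : EuclideanSpace ℝ (Fin 2)) (l : Fin 3) : ℝ :=
  paraboloidPoint (cellCorner s ξ) l - paraboloidPoint ξ l

lemma measurable_capDisplacement (s : ℕ) (l : Fin 3) :
    Measurable fun ξ => capDisplacement s ξ l := by
  have h : Measurable fun ξ => paraboloidPoint ξ l :=
    ((by fun_prop : Continuous fun x : EuclideanSpace ℝ (Fin 3) => x l).comp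
      continuous_paraboloidPoint).measurable
  exact (h.comp (measurable_cellCorner s)).sub h

/-- The character at the cell corner is constant on each cell, where the density has mean zero.
Subtracting it changes nothing and leaves the small factor 1 - e(g·x). -/
lemma extensionOp_sub_stepFunction_eq {s : ℕ} (hs : 0 < s) {F : EuclideanSpace ℝ (Fin 2) → ℂ}
    (hF : EssBounded 1 F) (x : EuclideanSpace ℝ (Fin 3)) :
    extensionOp unitSquare (fun ξ => F ξ - stepFunction s (cellAverage s F) ξ) x =
      ∫ ξ in unitSquare, (F ξ - stepFunction s (cellAverage s F) ξ) *
        unitExp (inner ℝ (paraboloidPoint ξ) x) *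
          (1 - unitExp (∑ l, capDisplacement s ξ l * x l)) := by
  set H : EuclideanSpace ℝ (Fin 2) → ℂ := fun ξ => F ξ - stepFunction s (cellAverage s F) ξ with hH
  have hHi : IntegrableOn H unitSquare :=
    hF.integrable.sub (integrable_stepFunction s _).integrableOn
  have hmc : Measurable fun ξ => unitExp (inner ℝ (paraboloidPoint (cellCorner s ξ)) x) :=
    (continuous_unitExp_inner x).measurable.comp (measurable_cellCorner s)
  have hi1 : IntegrableOn (fun ξ => H ξ * unitExp (inner ℝ (paraboloidPoint ξ) x)) unitSquare :=
    hHi.mul_bdd (c := 1) (continuous_unitExp_inner x).aestronglyMeasurable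
      (Filter.Eventually.of_forall fun ξ => (norm_unitExp _).le)
  have hi2 : IntegrableOn (fun ξ => H ξ *
      unitExp (inner ℝ (paraboloidPoint (cellCorner s ξ)) x)) unitSquare :=
    hHi.mul_bdd (c := 1) hmc.aestronglyMeasurable
      (Filter.Eventually.of_forall fun ξ => (norm_unitExp _).le)
  have hzero : ∫ ξ in unitSquare, H ξ *
      unitExp (inner ℝ (paraboloidPoint (cellCorner s ξ)) x) = 0 := by
    rw [integral_unitSquare_eq_sum hs hi2]
    refine Finset.sum_eq_zero fun q _ => ?_
    have h1 : ∫ ξ in canonicalSquare s q, H ξ *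
        unitExp (inner ℝ (paraboloidPoint (cellCorner s ξ)) x) =
        ∫ ξ in canonicalSquare s q, H ξ * unitExp (inner ℝ (paraboloidPoint
          (WithLp.toLp 2 ![(q.1 : ℝ) / s, (q.2 : ℝ) / s])) x) := by
      refine integral_congr_ae ?_
      filter_upwards [cellCorner_ae_eq hs q] with ξ hξ
      rw [hξ]
    rw [h1, integral_mul_const, integral_sub_stepFunction_cellAverage hs hF.integrable q, zero_mul]
  have hpt : ∀ ξ, H ξ * unitExp (inner ℝ (paraboloidPoint ξ) x) *
      (1 - unitExp (∑ l, capDisplacement s ξ l * x l)) =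
      H ξ * unitExp (inner ℝ (paraboloidPoint ξ) x) -
        H ξ * unitExp (inner ℝ (paraboloidPoint (cellCorner s ξ)) x) := by
    intro ξ
    have h1 : (inner ℝ (paraboloidPoint (cellCorner s ξ)) x : ℝ) =
        inner ℝ (paraboloidPoint ξ) x + ∑ l, capDisplacement s ξ l * x l := by
      simp only [PiLp.inner_apply, capDisplacement]
      rw [← Finset.sum_add_distrib]
      refine Finset.sum_congr rfl fun l _ => ?_
      simp
      ring
    rw [h1, unitExp_add]
    ring
  rw [extensionOp_eq]
  refine Eq.trans ?_ (integral_congr_ae (Filter.Eventually.of_forall fun ξ => (hpt ξ).symm))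
  rw [integral_sub hi1 hi2, hzero, sub_zero]

/-! ### From step functions to bounded densities -/

lemma sum_two_mul_eighth_pow (K : ℕ) :
    ∑ k ∈ Finset.range K, 2 * (1 / 8 : ℝ) ^ (k + 1) ≤ 1 / 2 := by
  -- Strengthened by a multiple of the tail so that the induction closes.
  have h : ∑ k ∈ Finset.range K, 2 * (1 / 8 : ℝ) ^ (k + 1) + (1 / 2) * (1 / 8) ^ K ≤ 1 / 2 := by
    induction K with
    | zero => simp
    | succ K ih =>
      rw [Finset.sum_range_succ]
      have : (0 : ℝ) < (1 / 8) ^ K := by positivity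
      rw [pow_succ]
      linarith
  have : (0 : ℝ) < (1 / 8) ^ K := by positivity
  linarith

/-- Degree k contributes 3^k words, each at most (2πr)^k · 2b^k times the norm, so 2(6πrb)^k ≤ 2 ·
8^{-k} altogether. The sum over k ≥ 1 is below 1/2, small enough to be absorbed. -/
lemma eLpNorm_integral_one_sub_unitExp_le {H : EuclideanSpace ℝ (Fin 2) → ℂ}
    {g : EuclideanSpace ℝ (Fin 2) → Fin 3 → ℝ} (hH : EssBounded 2 H)
    (hg : ∀ l, Measurable fun ξ => g ξ l) {b r : ℝ} (hb : 0 < b) (hr : 0 ≤ r)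
    (hgb : ∀ ξ ∈ unitSquare, ∀ l, |g ξ l| ≤ b) (hbr : 6 * Real.pi * r * b ≤ 1 / 8) :
    eLpNorm (fun x : EuclideanSpace ℝ (Fin 3) => ∫ ξ in unitSquare,
      H ξ * unitExp (inner ℝ (paraboloidPoint ξ) x) * (1 - unitExp (∑ l, g ξ l * x l))) 3
      (volume.restrict (Metric.closedBall 0 r)) ≤ ENNReal.ofReal (1 / 2) * extensionNorm r + 1 := by
  have hpi := Real.pi_pos
  set μ := volume.restrict (Metric.closedBall (0 : EuclideanSpace ℝ (Fin 3)) r) with hμ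
  set V : ℝ≥0∞ := μ Set.univ ^ ((3 : ℝ≥0∞).toReal)⁻¹ with hV
  have hVt : V ≠ ∞ := by
    refine ENNReal.rpow_ne_top_of_nonneg (by positivity) ?_
    rw [hμ, Measure.restrict_apply_univ]
    exact measure_closedBall_lt_top.ne
  -- The truncation order depends on the volume of the ball, but no bound below depends on it: the
  -- remainder contributes at most 1.
  obtain ⟨K, hK⟩ : ∃ K : ℕ, V * ENNReal.ofReal (2 * (1 / 8) ^ K) ≤ 1 := by
    obtain ⟨K, hK⟩ := exists_pow_lt_of_lt_one (y := (1 / 8 : ℝ))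
      (x := 1 / (2 * (V.toReal + 1))) (by positivity) (by norm_num)
    refine ⟨K, ?_⟩
    rw [← ENNReal.ofReal_toReal hVt, ← ENNReal.ofReal_mul ENNReal.toReal_nonneg,
      ← ENNReal.ofReal_one]
    refine ENNReal.ofReal_le_ofReal ?_
    have h0 : 0 ≤ V.toReal := ENNReal.toReal_nonneg
    rw [lt_div_iff₀ (by positivity)] at hK
    have : (0 : ℝ) < (1 / 8) ^ K := by positivity
    nlinarith
  let t : (k : ℕ) → (Fin (k + 1) → Fin 3) → EuclideanSpace ℝ (Fin 3) → ℝ := fun k w x =>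
    (2 * Real.pi * r) ^ (k + 1) * ‖extensionOp unitSquare (monomialDensity H g w) x‖
  have htm : ∀ k w, Continuous (t k w) := fun k w =>
    continuous_const.mul
      (continuous_extensionOp (essBounded_monomialDensity hH hg hgb w).integrable).norm
  have htn : ∀ k w, eLpNorm (t k w) 3 μ ≤
      ENNReal.ofReal ((2 * Real.pi * r) ^ (k + 1) * (2 * b ^ (k + 1))) * extensionNorm r := by
    intro k w
    have e : t k w = (2 * Real.pi * r) ^ (k + 1) •
        fun x => ‖extensionOp unitSquare (monomialDensity H g w) x‖ := rfl
    rw [e, eLpNorm_const_smul, eLpNorm_norm, ENNReal.ofReal_mul (by positivity),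
      mul_assoc (ENNReal.ofReal _), ← ofReal_norm, Real.norm_of_nonneg (by positivity)]
    refine mul_le_mul_right ?_ _
    exact eLpNorm_extensionOp_le (by positivity) (essBounded_monomialDensity hH hg hgb w)
  have hts : ∀ k, eLpNorm (fun x => ∑ w, t k w x) 3 μ ≤
      ENNReal.ofReal (2 * (1 / 8) ^ (k + 1)) * extensionNorm r := by
    intro k
    have e : (fun x => ∑ w, t k w x) = ∑ w, t k w := by ext x; simp
    rw [e]
    refine (eLpNorm_sum_le (fun w _ => (htm k w).aestronglyMeasurable) (by norm_num)).trans ?_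
    refine (Finset.sum_le_sum fun w _ => htn k w).trans ?_
    rw [← Finset.sum_mul]
    gcongr
    rw [← ENNReal.ofReal_sum_of_nonneg fun w _ => by positivity]
    refine ENNReal.ofReal_le_ofReal ?_
    rw [Finset.sum_const, Finset.card_univ, Fintype.card_fun, Fintype.card_fin, Fintype.card_fin,
      nsmul_eq_mul]
    push_cast
    calc (3 : ℝ) ^ (k + 1) * ((2 * Real.pi * r) ^ (k + 1) * (2 * b ^ (k + 1)))
        = 2 * (6 * Real.pi * r * b) ^ (k + 1) := by
          rw [show 6 * Real.pi * r * b = 3 * (2 * Real.pi * r) * b by ring, mul_pow _ b,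
            mul_pow 3]
          ring
      _ ≤ _ := by gcongr
  have hmain : ∀ᵐ x ∂μ, ‖∫ ξ in unitSquare, H ξ * unitExp (inner ℝ (paraboloidPoint ξ) x) *
      (1 - unitExp (∑ l, g ξ l * x l))‖ ≤
      ((fun x => ∑ k ∈ Finset.range K, ∑ w, t k w x) +
        fun _ : EuclideanSpace ℝ (Fin 3) => (2 * (1 / 8) ^ K : ℝ)) x := by
    filter_upwards [ae_restrict_mem Metric.isClosed_closedBall.measurableSet] with x hx
    rw [mem_closedBall_zero_iff] at hx
    exact norm_integral_one_sub_unitExp_le hH hg hgb hbr K fun l =>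
      (PiLp.norm_apply_le x l).trans hx
  refine (eLpNorm_mono_ae_real hmain).trans ?_
  have hcs : ∀ k, Continuous fun x => ∑ w, t k w x :=
    fun k => continuous_finsetSum _ fun w _ => htm k w
  refine (eLpNorm_add_le (continuous_finsetSum _ fun k _ => hcs k).aestronglyMeasurable
    aestronglyMeasurable_const (by norm_num)).trans ?_
  refine add_le_add ?_ ?_
  · have e : (fun x => ∑ k ∈ Finset.range K, ∑ w, t k w x) =
        ∑ k ∈ Finset.range K, fun x => ∑ w, t k w x := by ext x; simp
    rw [e]
    refine (eLpNorm_sum_le (fun k _ => (hcs k).aestronglyMeasurable) (by norm_num)).trans ?_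
    refine (Finset.sum_le_sum fun k _ => hts k).trans ?_
    rw [← Finset.sum_mul]
    gcongr
    rw [← ENNReal.ofReal_sum_of_nonneg fun k _ => by positivity]
    exact ENNReal.ofReal_le_ofReal (sum_two_mul_eighth_pow K)
  · refine (eLpNorm_le_of_ae_bound (C := 2 * (1 / 8) ^ K)
      (Filter.Eventually.of_forall fun x => ?_)).trans hK
    rw [Real.norm_of_nonneg (by positivity)]

lemma EssBounded.sub {b b' : ℝ} {F G : EuclideanSpace ℝ (Fin 2) → ℂ}
    (hF : EssBounded b F) (hG : EssBounded b' G) :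
    EssBounded (b + b') (fun ξ => F ξ - G ξ) := by
  refine ⟨hF.1.sub hG.1, ?_⟩
  filter_upwards [hF.2, hG.2] with ξ h1 h2
  exact (norm_sub_le _ _).trans (add_le_add h1 h2)

lemma extensionOp_add {F G : EuclideanSpace ℝ (Fin 2) → ℂ} (hF : IntegrableOn F unitSquare)
    (hG : IntegrableOn G unitSquare) :
    extensionOp unitSquare (fun ξ => F ξ + G ξ) =
      extensionOp unitSquare F + extensionOp unitSquare G := by
  have h : ∀ {F : EuclideanSpace ℝ (Fin 2) → ℂ}, IntegrableOn F unitSquare → ∀ x,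
      IntegrableOn (fun ξ => F ξ * unitExp (inner ℝ (paraboloidPoint ξ) x)) unitSquare :=
    fun hF x => Integrable.mul_bdd (c := 1) hF (continuous_unitExp_inner x).aestronglyMeasurable
      (Filter.Eventually.of_forall fun ξ => (norm_unitExp _).le)
  ext x
  rw [Pi.add_apply, extensionOp_eq, extensionOp_eq, extensionOp_eq,
    ← integral_add (h hF x) (h hG x)]
  refine integral_congr_ae (Filter.Eventually.of_forall fun ξ => ?_)
  simp only
  ring

/-- Bounds for step functions at scale `1 / s` control the extension operator on `B_r`, if `s` is
larger than `r`. -/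
lemma extensionNorm_le {s : ℕ} (hs : 0 < s) {r : ℝ} (hr : 0 ≤ r) (hrs : 1024 * r ≤ s) {K : ℝ≥0∞}
    (hK : ∀ a : Fin s × Fin s → ℂ, (∀ q, ‖a q‖ ≤ 1) →
      ∫⁻ x in Metric.closedBall 0 r, ‖∑ q, a q * cellWave s q x‖ₑ ^ 3 ≤ K ^ 3) :
    extensionNorm r ≤ 2 * K + 2 := by
  have hs' : (0 : ℝ) < s := by exact_mod_cast hs
  -- Cap displacements are at most 4/s, and 192π < 1024.
  have hbr : 6 * Real.pi * r * (4 / s) ≤ 1 / 8 := by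
    rw [show 6 * Real.pi * r * (4 / s) = 24 * Real.pi * r / s by ring, div_le_iff₀ hs']
    nlinarith [Real.pi_lt_four]
  -- The averaged part is a step function and costs K; the mean-zero part returns half of the norm
  -- itself.
  have h : extensionNorm r ≤ K + (ENNReal.ofReal (1 / 2) * extensionNorm r + 1) := by
    refine iSup₂_le fun F hF => ?_
    have ha := norm_cellAverage_le hs hF
    have hst := essBounded_stepFunction hs ha
    have hH := hF.sub hst
    have e : F = fun ξ => stepFunction s (cellAverage s F) ξ +
        (F ξ - stepFunction s (cellAverage s F) ξ) := by ext ξ; ring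
    conv_lhs => rw [e]
    rw [extensionOp_add hst.integrable hH.integrable]
    refine (eLpNorm_add_le (continuous_extensionOp hst.integrable).aestronglyMeasurable
      (continuous_extensionOp hH.integrable).aestronglyMeasurable (by norm_num)).trans ?_
    refine add_le_add ?_ ?_
    · refine ENNReal.le_of_pow_le_pow three_ne_zero ?_
      rw [eLpNorm_three_pow]
      simp only [extensionOp_unitSquare_stepFunction]
      exact hK _ ha
    · rw [show extensionOp unitSquare (fun ξ => F ξ - stepFunction s (cellAverage s F) ξ) = _ from
        funext fun x => extensionOp_sub_stepFunction_eq hs hF x]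
      have h2 : EssBounded 2 (fun ξ => F ξ - stepFunction s (cellAverage s F) ξ) := by
        convert hH using 1; norm_num
      exact eLpNorm_integral_one_sub_unitExp_le h2 (measurable_capDisplacement s)
        (by positivity) hr
        (fun ξ hξ l => abs_paraboloidPoint_cellCorner_sub_le hs hξ l) hbr
  rcases eq_or_ne K ∞ with rfl | hKt
  · simp
  lift K to NNReal using hKt
  have hX := extensionNorm_ne_top r
  generalize extensionNorm r = X at h hX ⊢
  lift X to NNReal using hX
  rw [ENNReal.ofReal] at h
  norm_cast at h ⊢
  rw [← NNReal.coe_le_coe] at h ⊢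
  push_cast at h ⊢
  rw [Real.coe_toNNReal _ (by norm_num)] at h
  linarith

/-! ### Choice of scales -/

lemma FiberDecoupling.mono {E : ℝ} {n M : ℕ} {Q Q' : ℝ} (h : FiberDecoupling E n M Q)
    (hQ : Q ≤ Q') : FiberDecoupling E n M Q' := by
  intro Y _ _ L hL c F hF
  refine (h Y L hL c F hF).trans ?_
  gcongr

/-- Dyadic exponents for the scales `2 ^ a ≤ 2 ^ k`, the cardinality `2 ^ j` of the ensembles and
the number `2 ^ m` of ensembles that fit into the corner square. -/
lemma exists_dyadic_exponents {β η : ℝ} (hβ0 : 0 < β) (hη : 0 < η) (hηβ : 6 * η ≤ 1 - β)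
    (L : ℝ) :
    ∃ k₀ : ℕ, ∀ k : ℕ, k₀ ≤ k → ∃ a j m : ℕ, a ≤ k ∧ 2 * a = j + m ∧
      2 * k * β ≤ j ∧ (j : ℝ) ≤ 2 * k * β + 1 ∧ 6 * k * η ≤ m ∧ (m : ℝ) ≤ 6 * k * η + 2 ∧
      L ≤ (2 : ℝ) ^ (2 * k * η) := by
  have h1β : 0 < 1 - β := by linarith
  obtain ⟨k₁, hk₁⟩ := exists_nat_ge (3 / (1 - β))
  obtain ⟨k₂, hk₂⟩ := exists_nat_ge (Real.logb 2 (max L 1) / (2 * η))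
  refine ⟨max k₁ k₂, fun k hk => ?_⟩
  have h1 : (k₁ : ℝ) ≤ k := by exact_mod_cast (le_max_left _ _).trans hk
  have h2 : (k₂ : ℝ) ≤ k := by exact_mod_cast (le_max_right _ _).trans hk
  have h3 : 3 ≤ k * (1 - β) := by
    rw [← div_le_iff₀ h1β]; exact hk₁.trans h1
  have hL : L ≤ (2 : ℝ) ^ (2 * k * η) := by
    have h4 : Real.logb 2 (max L 1) ≤ 2 * k * η := by
      have := hk₂.trans h2
      rw [div_le_iff₀ (by positivity)] at this
      linarith
    have hpos : 0 < max L 1 := lt_max_of_lt_right one_pos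
    exact (le_max_left L 1).trans ((Real.logb_le_iff_le_rpow one_lt_two hpos).1 h4)
  have hk0 : (0 : ℝ) ≤ k := k.cast_nonneg
  set j := ⌈2 * k * β⌉₊ with hj
  -- With j fixed first, rounding up the half sum makes m = 2a - j have the parity of j and lie
  -- within 2 of 6kη. The corner then has exactly 2^j · 2^m cells.
  set a := ⌈(j + 6 * k * η) / 2⌉₊ with ha
  have hj1 : 2 * k * β ≤ j := Nat.le_ceil _
  have hj2 : (j : ℝ) < 2 * k * β + 1 := Nat.ceil_lt_add_one (by positivity)
  have ha1 : (j + 6 * k * η) / 2 ≤ a := Nat.le_ceil _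
  have ha2 : (a : ℝ) < (j + 6 * k * η) / 2 + 1 := Nat.ceil_lt_add_one (by positivity)
  have hkη : 0 ≤ k * η := by positivity
  have hja : j ≤ 2 * a := by
    have : (j : ℝ) ≤ (2 * a : ℕ) := by push_cast; linarith
    exact_mod_cast this
  have hm : ((2 * a - j : ℕ) : ℝ) = 2 * a - j := by rw [Nat.cast_sub hja]; push_cast; ring
  refine ⟨a, j, 2 * a - j, ?_, by omega, hj1, hj2.le, ?_, ?_, hL⟩
  -- The corner fits in the grid: the exponents 2kβ and 6kη leave a margin k(1 - β) ≥ 3, which pays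
  -- for both roundings.
  · have h5 : k * (6 * η) ≤ k * (1 - β) := mul_le_mul_of_nonneg_left hηβ hk0
    have h6 : (a : ℝ) < k + 1 := by nlinarith
    have h7 : a < k + 1 := by exact_mod_cast h6
    omega
  · rw [hm]; linarith
  · rw [hm]; linarith

/-- Bounds for step functions at dyadic scales. -/
lemma exists_lintegral_sum_cellWave_le {β E η : ℝ} (hβ0 : 0 < β) (hE : 3 < E)
    (hdec : LargeEnsembleDecoupling 3 β E) (hη : 0 < η) (hηβ : 6 * η ≤ 1 - β) :
    ∃ B : ℝ, 0 ≤ B ∧ ∃ k₀ : ℕ, ∀ k : ℕ, k₀ ≤ k → ∃ s : ℕ, 0 < s ∧ (2 : ℝ) ^ (k * β) ≤ s ∧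
      ∀ a : Fin s × Fin s → ℂ, (∀ q, ‖a q‖ ≤ 1) → ∀ r : ℝ, r ≤ (s : ℝ) ^ 2 →
        ∫⁻ x in Metric.closedBall 0 r, ‖∑ q, a q * cellWave s q x‖ₑ ^ 3 ≤
          ENNReal.ofReal (B * (2 : ℝ) ^ (32 * k * η)) := by
  obtain ⟨C₀, hC₀⟩ := hdec.fiberDecoupling hη
  obtain ⟨A, hA, hcore⟩ := lintegral_extensionOp_stepFunction_le hE hη
  set C := max C₀ 0 with hC
  have hC0 : 0 ≤ C := le_max_right _ _
  obtain ⟨k₀, hk₀⟩ := exists_dyadic_exponents hβ0 hη hηβ (A * C ^ 2)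
  refine ⟨256 * A * C ^ 3, by positivity, k₀, fun k hk => ?_⟩
  obtain ⟨a, j, m, hak, hajm, hj1, hj2, hm1, hm2, hL⟩ := hk₀ k hk
  have hpow : ∀ i : ℕ, (((2 ^ i : ℕ) : ℕ) : ℝ) = (2 : ℝ) ^ (i : ℝ) := fun i => by
    rw [Real.rpow_natCast]; push_cast; rfl
  have hD : ∀ x : ℝ, ((((2 ^ k : ℕ) : ℕ) : ℝ) ^ 2) ^ x = (2 : ℝ) ^ (2 * k * x) := fun x => by
    rw [hpow, ← Real.rpow_natCast, ← Real.rpow_mul two_pos.le, ← Real.rpow_mul two_pos.le]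
    congr 1; push_cast; ring
  have h2 : ∀ {x y : ℝ}, x ≤ y → (2 : ℝ) ^ x ≤ (2 : ℝ) ^ y := fun h =>
    Real.rpow_le_rpow_of_exponent_le one_le_two h
  have hn1 : 0 < 2 ^ k := by positivity
  have hfib : FiberDecoupling E (2 ^ k) (2 ^ j) (C * (2 : ℝ) ^ (2 * k * η)) := by
    refine (hC₀ (2 ^ k) (2 ^ j) hn1 ?_ ?_).mono ?_
    · rw [hD, hpow]; exact h2 hj1
    · rw [hD, hpow]
      calc (2 : ℝ) ^ (j : ℝ) ≤ 2 ^ (2 * k * β + 1) := h2 hj2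
        _ = _ := by rw [Real.rpow_add two_pos, Real.rpow_one]; ring
    · rw [hD]
      gcongr
      exact le_max_left _ _
  -- Q² costs the exponent 4kη and the constant A C² at most another 2kη; hence the exponent 6kη for
  -- N.
  have hAQ : A * (C * (2 : ℝ) ^ (2 * k * η)) ^ 2 ≤ ((2 ^ m : ℕ) : ℝ) := by
    rw [hpow]
    calc A * (C * (2 : ℝ) ^ (2 * k * η)) ^ 2 = A * C ^ 2 * ((2 : ℝ) ^ (2 * k * η)) ^ 2 := by ring
      _ ≤ (2 : ℝ) ^ (2 * k * η) * ((2 : ℝ) ^ (2 * k * η)) ^ 2 := by gcongr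
      _ = (2 : ℝ) ^ (6 * k * η) := by
        rw [← pow_succ', ← Real.rpow_natCast, ← Real.rpow_mul two_pos.le]
        congr 1; push_cast; ring
      _ ≤ _ := h2 hm1
  have hjk : m ≤ 2 * k - j := by omega
  have hN' : 2 ^ m + (2 ^ (2 * k - j) - 2 ^ m) = 2 ^ (2 * k - j) :=
    Nat.add_sub_cancel' (Nat.pow_le_pow_right two_pos hjk)
  have hsM : (2 ^ a) ^ 2 = 2 ^ j * 2 ^ m := by
    rw [← pow_mul, ← pow_add, ← hajm, mul_comm]
  have hnM : (2 ^ k) ^ 2 = 2 ^ j * (2 ^ m + (2 ^ (2 * k - j) - 2 ^ m)) := by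
    rw [hN', ← pow_mul, ← pow_add]
    congr 1; omega
  have hsn : 2 ^ a ≤ 2 ^ k := Nat.pow_le_pow_right two_pos hak
  refine ⟨2 ^ a, by positivity, ?_, fun c hc r hr => ?_⟩
  · rw [hpow]
    have : (2 * a : ℝ) = j + m := by exact_mod_cast hajm
    have : (0 : ℝ) ≤ m := m.cast_nonneg
    exact h2 (by linarith)
  · refine lintegral_sum_cellWave_le (by positivity) hsn hr ?_
    refine (hcore (2 ^ k) (2 ^ a) (2 ^ j) (2 ^ m) _ _ hn1 hsn (by positivity) hsM hnM
      (by positivity) hfib hAQ (extendCoeff (2 ^ k) c) (fun q => ?_) (fun q hq => ?_) 0).trans ?_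
    · rw [extendCoeff]
      split_ifs with h
      · exact hc _
      · simp
    · by_contra h
      exact hq (by rw [extendCoeff, dif_neg h])
    · refine mul_le_mul_left (ENNReal.ofReal_le_ofReal ?_) _
      rw [hD, hpow]
      calc A * (C * (2 : ℝ) ^ (2 * k * η)) ^ 3 * ((2 : ℝ) ^ (m : ℝ)) ^ 4 * (2 : ℝ) ^ (2 * k * η)
          ≤ A * (C * (2 : ℝ) ^ (2 * k * η)) ^ 3 * ((2 : ℝ) ^ (6 * k * η + 2)) ^ 4 *
            (2 : ℝ) ^ (2 * k * η) := by
              have := h2 hm2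
              gcongr ?_ * ?_ ^ 4 * _
        -- In units of 2^{2kη}: 3 from Q³, 12 from N⁴ and 1 from the square function, 16 in all; 256
        -- = 4⁴ comes from rounding m.
        _ = 256 * A * C ^ 3 * ((2 : ℝ) ^ (2 * k * η)) ^ 16 := by
          have e : (2 : ℝ) ^ (6 * k * η + 2) = ((2 : ℝ) ^ (2 * k * η)) ^ 3 * 4 := by
            rw [Real.rpow_add two_pos, ← Real.rpow_natCast (_ ^ _) 3, ← Real.rpow_mul two_pos.le]
            congr 1
            · congr 1; push_cast; ring
            · norm_num
          rw [e]; ring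
        _ = _ := by
          rw [← Real.rpow_natCast (_ ^ _) 16, ← Real.rpow_mul two_pos.le]
          congr 2; push_cast; ring

/-- Large ensemble decoupling gives the restriction estimate on balls centred at the origin. -/
lemma exists_extensionNorm_pow_le {β E ε : ℝ} (hβ0 : 0 < β) (hβ1 : β < 1) (hE : 3 < E)
    (hdec : LargeEnsembleDecoupling 3 β E) (hε : 0 < ε) :
    ∃ B : ℝ, ∀ r : ℝ, 1 ≤ r → extensionNorm r ^ 3 ≤ ENNReal.ofReal (B * r ^ ε) := by
  -- A radius r needs 2^{kβ} of order r, so the loss 2^{32kη} has exponent 32η/β in r; the second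
  -- bound leaves room for the corner.
  set η := min (β * ε / 32) ((1 - β) / 6) with hηd
  have h1β : 0 < 1 - β := by linarith
  have hη : 0 < η := lt_min (by positivity) (by positivity)
  have hη1 : 32 * η ≤ β * ε := by linarith [min_le_left (β * ε / 32) ((1 - β) / 6)]
  have hη2 : 6 * η ≤ 1 - β := by linarith [min_le_right (β * ε / 32) ((1 - β) / 6)]
  obtain ⟨B, hB, k₀, h⟩ := exists_lintegral_sum_cellWave_le hβ0 hE hdec hη hη2
  set G : ℝ := (2 : ℝ) ^ (32 * (k₀ + 1) * η) * 1024 ^ ε with hG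
  refine ⟨32 * (B * G) + 32, fun r hr => ?_⟩
  have hr0 : 0 < r := by linarith
  set v := Real.logb 2 (1024 * r) with hv
  have hv0 : 0 ≤ v := Real.logb_nonneg one_lt_two (by linarith)
  have h2v : (2 : ℝ) ^ v = 1024 * r := Real.rpow_logb two_pos (by norm_num) (by positivity)
  -- Chosen so that s ≥ 2^{kβ} ≥ 1024 r, with k exceeding v/β only by a constant.
  set k := k₀ + ⌈v / β⌉₊ with hk
  obtain ⟨s, hs, hsk, hstep⟩ := h k (Nat.le_add_right _ _)
  have hk1 : v / β ≤ k := by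
    rw [hk]; push_cast
    linarith [Nat.le_ceil (v / β), (k₀.cast_nonneg : (0 : ℝ) ≤ k₀)]
  have hk2 : (k : ℝ) ≤ k₀ + 1 + v / β := by
    rw [hk]; push_cast
    linarith [Nat.ceil_lt_add_one (a := v / β) (by positivity)]
  have hrs : 1024 * r ≤ s := by
    rw [← h2v]
    refine le_trans (Real.rpow_le_rpow_of_exponent_le one_le_two ?_) hsk
    rwa [div_le_iff₀ hβ0] at hk1
  have hs1 : (1 : ℝ) ≤ s := by exact_mod_cast hs
  have hrs2 : r ≤ (s : ℝ) ^ 2 := by nlinarith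
  have hD : (2 : ℝ) ^ (32 * k * η) ≤ G * r ^ ε := by
    have h1 : 32 * k * η ≤ 32 * (k₀ + 1) * η + v * ε := by
      have h3 : 32 * k * η ≤ 32 * (k₀ + 1 + v / β) * η := by gcongr
      have h4 : v / β * (32 * η) ≤ v / β * (β * ε) := by gcongr
      have h5 : v / β * (β * ε) = v * ε := by field_simp
      linarith
    calc (2 : ℝ) ^ (32 * k * η) ≤ 2 ^ (32 * (k₀ + 1) * η + v * ε) :=
          Real.rpow_le_rpow_of_exponent_le one_le_two h1
      _ = _ := by
        rw [Real.rpow_add two_pos, Real.rpow_mul two_pos.le v, h2v,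
          Real.mul_rpow (by norm_num) hr0.le, hG, mul_assoc (2 ^ _ : ℝ)]
  have hG0 : 0 < G := by positivity
  have hrε : 1 ≤ r ^ ε := Real.one_le_rpow hr hε.le
  set T : ℝ := B * (G * r ^ ε) with hT
  have hT0 : 0 ≤ T := by positivity
  set t : ℝ := T ^ (1 / 3 : ℝ) with ht
  have ht0 : 0 ≤ t := by positivity
  have ht3 : t ^ 3 = T := by
    rw [ht, ← Real.rpow_natCast, ← Real.rpow_mul hT0]; norm_num
  have hmain := extensionNorm_le hs hr0.le hrs (K := ENNReal.ofReal t) fun a ha => by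
    refine (hstep a ha r hrs2).trans ?_
    rw [← ENNReal.ofReal_pow ht0, ht3]
    exact ENNReal.ofReal_le_ofReal (mul_le_mul_of_nonneg_left hD hB)
  have e : 2 * ENNReal.ofReal t + 2 = ENNReal.ofReal (2 * t + 2) := by
    rw [ENNReal.ofReal_add (by positivity) (by norm_num), ENNReal.ofReal_mul (by norm_num)]
    simp
  rw [e] at hmain
  calc extensionNorm r ^ 3 ≤ ENNReal.ofReal (2 * t + 2) ^ 3 := by gcongr
    _ = ENNReal.ofReal ((2 * t + 2) ^ 3) := by rw [ENNReal.ofReal_pow (by positivity)]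
    _ ≤ _ := by
      refine ENNReal.ofReal_le_ofReal ?_
      have h6 : (2 * t + 2) ^ 3 ≤ 32 * t ^ 3 + 32 := by
        nlinarith [mul_nonneg (add_nonneg ht0 zero_le_one) (sq_nonneg (t - 1))]
      rw [ht3] at h6
      calc _ ≤ 32 * T + 32 * 1 := by linarith
        _ ≤ 32 * T + 32 * r ^ ε := by gcongr
        _ = _ := by rw [hT]; ring

/-! ### Arbitrary centres and conclusion -/

/-- Translation in space is modulation of the density, which preserves its modulus; balls centred at
the origin therefore suffice. -/
lemma extensionOp_add_right (F : EuclideanSpace ℝ (Fin 2) → ℂ) (c x : EuclideanSpace ℝ (Fin 3)) :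
    extensionOp unitSquare F (x + c) = extensionOp unitSquare
      (fun ξ => F ξ * unitExp (inner ℝ (paraboloidPoint ξ) c)) x := by
  rw [extensionOp_eq, extensionOp_eq]
  refine integral_congr_ae (Filter.Eventually.of_forall fun ξ => ?_)
  simp only [inner_add_right, unitExp_add]
  ring

lemma setLIntegral_closedBall_eq (f : EuclideanSpace ℝ (Fin 3) → ℝ≥0∞)
    (c : EuclideanSpace ℝ (Fin 3)) (r : ℝ) :
    ∫⁻ x in Metric.closedBall c r, f x = ∫⁻ x in Metric.closedBall 0 r, f (x + c) := by
  have h := (measurePreserving_add_right (volume : Measure (EuclideanSpace ℝ (Fin 3)))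
    c).setLIntegral_comp_preimage_emb (MeasurableEquiv.addRight c).measurableEmbedding f
    (Metric.closedBall c r)
  rw [← h]
  congr 2
  ext x
  simp [dist_eq_norm]

theorem theorem2p5 (β : ℝ) (hβ0 : 0 < β) (hβ1 : β < 1) (E : ℝ) (hE : 3 < E)
    (hdec : LargeEnsembleDecoupling 3 β E) :
    RestrictionConjectureParaboloid := by
  intro ε hε
  -- The exponent is doubled because the radius is √R.
  obtain ⟨B, hB⟩ := exists_extensionNorm_pow_le hβ0 hβ1 hE hdec (ε := 2 * ε) (by positivity)
  refine ⟨B, fun R hR c F hF => ?_⟩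
  have hmeas := hF.1
  have hfin : eLpNorm F ∞ (volume.restrict unitSquare) ≠ ∞ := hF.2.ne
  have hRε : Real.sqrt R ^ (2 * ε) = R ^ ε := by
    rw [Real.rpow_mul (Real.sqrt_nonneg _)]
    congr 1
    rw [Real.rpow_two, Real.sq_sqrt (by linarith)]
  -- Normalising F divides by its norm, so the null function is treated apart.
  rcases eq_or_ne (eLpNorm F ∞ (volume.restrict unitSquare)) 0 with h0 | h0
  · have hF0 : F =ᵐ[volume.restrict unitSquare] 0 :=
      (eLpNorm_eq_zero_iff hmeas (by simp)).1 h0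
    have hE0 : ∀ x, extensionOp unitSquare F x = 0 := fun x => by
      rw [extensionOp_eq]
      refine integral_eq_zero_of_ae ?_
      filter_upwards [hF0] with ξ hξ
      simp [hξ]
    simp [hE0]
  · set b := (eLpNorm F ∞ (volume.restrict unitSquare)).toReal with hb
    have hb0 : 0 < b := ENNReal.toReal_pos h0 hfin
    have hbe : ENNReal.ofReal b = eLpNorm F ∞ (volume.restrict unitSquare) :=
      ENNReal.ofReal_toReal hfin
    have hFb : EssBounded b F := by
      refine ⟨hmeas, ?_⟩
      filter_upwards [ae_le_eLpNormEssSup (f := F) (μ := volume.restrict unitSquare)] with ξ hξ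
      rw [← eLpNorm_exponent_top, ← hbe, ← ofReal_norm] at hξ
      exact (ENNReal.ofReal_le_ofReal_iff hb0.le).1 hξ
    have hG : EssBounded b (fun ξ => F ξ * unitExp (inner ℝ (paraboloidPoint ξ) c)) := by
      have := hFb.mul_bound hb0.le (continuous_unitExp_inner c).aestronglyMeasurable
        fun ξ _ => (norm_unitExp _).le
      rwa [mul_one] at this
    rw [setLIntegral_closedBall_eq]
    simp only [extensionOp_add_right]
    rw [← eLpNorm_three_pow]
    calc _ ≤ (ENNReal.ofReal b * extensionNorm (Real.sqrt R)) ^ 3 := by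
          gcongr
          exact eLpNorm_extensionOp_le hb0 hG
      _ = extensionNorm (Real.sqrt R) ^ 3 *
          eLpNorm F ∞ (volume.restrict unitSquare) ^ 3 := by rw [hbe, mul_pow, mul_comm]
      _ ≤ _ := by
        gcongr
        rw [← hRε]
        exact hB _ (Real.one_le_sqrt.2 hR)

end
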